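/- **Setting.** Let $X\in\mathbb R^{n\times n}$ be symmetric with zero diagonal, let $J=I_n-\frac1n 1_n1_n^\top$, let $\sigma(x)=1/(1+e^{-x})$ (applied entrywise to matrices), and let $M_1\in\mathbb R$, $M_2,r_G,r_\alpha,r_\beta\ge 0$ satisfy $r_G+2r_\alpha+r_\beta\le M_1$. The true parameters are a positive semidefinite $G_\star\in\mathbb R^{n\times n}$ with $JG_\star=G_\star$, $\alpha_\star\in\mathbb R^n$ and $\beta_\star\in\mathbb R$ with $$\max_i (G_\star)_{ii}\le r_G,\quad \|\alpha_\star\|_\infty\le r_\alpha,\quad |\beta_\star|\max_{i<j}|X_{ij}|\le r_\beta,\quad \max_{i\ne j}(\Theta_\star)_{ij}\le -M_2,$$ where $\Theta_\star=\alpha_\star1_n^\top+1_n\alpha_\star^\top+\beta_\star X+G_\star$. One observes a random symmetric $0/1$ matrix $A$ with zero diagonal whose entries $A_{ij}$, $i<j$, are independent Bernoulli$(\sigma((\Theta_\star)_{ij}))$ variables. Let $k\ge1$, let $U_kD_kU_k^\top$ consist of the top $k$ eigen-components of $G_\star$, let $Z_\star=U_kD_k^{1/2}$ and $\bar G_k=G_\star-Z_\star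 Z_\star^\top$. Assume that all singular values of $Z_\star$ are positive, and let $\kappa$ be the ratio of the largest to the smallest of them. For $Z\in\mathbb R^{n\times k}$, $\alpha\in\mathbb R^n$, $\beta\in\mathbb R$ let $$e(Z,\alpha,\beta)=\|Z_\star\|_{\rm op}^2\min_{R\in O(k)}\|Z-Z_\star R\|_F^2+2\|(\alpha-\alpha_\star)1_n^\top\|_F^2+\|(\beta-\beta_\star)X\|_F^2 .$$ **Algorithm.** Given a step size $\eta$ and parameters $\lambda,\gamma$, start from $G^0=0$, $\alpha^0=0$, $\beta^0=0$ and, for $t=0,1,2,\dots$, with $\Theta^t=\alpha^t1_n^\top+1_n(\alpha^t)^\top+\beta^tX+G^t$, put $$G^{t+1}=\mathcal P_{\mathcal C_G}\big(G^t+\eta(A-\sigma(\Theta^t)-\lambda I_n-\gamma G^t)\big),\qquad \alpha^{t+1}=\mathcal P_{\mathcal C_\alpha}\Big(\alpha^t+\eta\big(\tfrac1{2n}(A-\sigma(\Theta^t))1_n-\gamma\alpha^t\big)\Big),$$ $$\beta^{t+1}=\mathcal P_{\mathcal C_\beta}\Big(\beta^t+\eta\big(\langle A-\sigma(\Theta^t),X\rangle/\|X\|_F^2-\gamma\beta^t\big)\Big)$$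 (if $X=0$, $\beta$ is not updated), where $\mathcal P$ denotes Euclidean (Frobenius) projection and $$\mathcal C_G=\{G\succeq0:\ JG=G,\ \max_{i,j}|G_{ij}|\le r_G\},\quad \mathcal C_\alpha=\{\alpha:\|\alpha\|_\infty\le r_\alpha\},\quad \mathcal C_\beta=\{\beta:|\beta|\max_{i,j}|X_{ij}|\le r_\beta\}.$$ After $T$ steps the output is $(Z^T,\alpha^T,\beta^T)$, where $Z^T=U D^{1/2}$ for the top $k$ eigen-components $UDU^\top$ of $G^T$ (with any choice in case of ties); let $e_T=e(Z^T,\alpha^T,\beta^T)$. **Statement.** There are absolute constants $M_0,c>0$ such that for every $K>0$ there are $C_1,C_{\min}>0$ (depending only on $K$) such that for every $C_0\ge C_{\min}$ and every $c_1>0$, for every sufficiently small $c_0>0$ (depending only on $K,C_0,c_1$), there is a constant $C>0$ (depending only on $K,C_0,c_1,c_0$) for which the following holds for all $n,k,M_1,M_2,r_G,r_\alpha,r_\beta,X$ and all true parameters as above. Suppose that * if $X\neq0$, then $\|X\|_F^2/\|X\|_{\rm op}^2\ge M_0k$; * $\|\alpha_\star1_n^\top\|_F\le K\|G_\star\|_F$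 and $\|\beta_\star X\|_F\le K\|G_\star\|_F$; * $\displaystyle \|G_\star\|_{\rm op}^2\ \ge\ C\,\kappa^6e^{2M_1}\max\Big\{e^{2M_1}nk\max\big\{e^{-M_2},\tfrac{\log n}{n}\big\},\ \tfrac1k\|\bar G_k\|_*^2,\ \|\bar G_k\|_F^2\Big\}$; * $0<\eta\le 2/9$, $\ \gamma=\gamma_n=\dfrac{c_0}{e^{2M_1}\sqrt k\,\kappa^3}\ $ and $\ \lambda=\lambda_n=C_0\gamma_n\|G_\star\|_{\rm op}$. Then, with probability at least $1-n^{-c}$, $$e_T\le c_1^2e^{-2M_1}\|Z_\star\|_{\rm op}^4/\kappa^4\quad\text{for all integers } T\ge \max\{T_0,0\},\qquad T_0=\log\Big(\frac{C_1e^{2M_1}k\kappa^6}{c_1^2}\Big)\Big/\log\Big(\frac1{1-\gamma_n\eta}\Big).$$ In particular $T_0$ depends on $n$ only through $M_1,k,\kappa$ (and $\eta$). -/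

import Mathlib

open MeasureTheory ProbabilityTheory

namespace LatentSpace

noncomputable section

/-! ### Matrix norms and spectral quantities -/

/-- Frobenius norm. -/
def frob {m n : Type*} [Fintype m] [Fintype n] (M : Matrix m n ℝ) : ℝ :=
  √(∑ i, ∑ j, M i j ^ 2)

/-- Trace inner product `⟨M, N⟩ = Tr(Mᵀ N)`. -/
def trInner {m n : Type*} [Fintype m] [Fintype n] (M N : Matrix m n ℝ) : ℝ :=
  ∑ i, ∑ j, M i j * N i j

/-- Euclidean norm of a vector. -/
def vecNorm {n : Type*} [Fintype n] (v : n → ℝ) : ℝ := √(∑ i, v i ^ 2)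

open scoped Matrix.Norms.L2Operator in
/-- Operator norm induced by the Euclidean norms. -/
def opNorm {m n : Type*} [Fintype m] [Fintype n] [DecidableEq n] (M : Matrix m n ℝ) : ℝ := ‖M‖

/-- The singular values of `M` (one for each column): the square roots of the eigenvalues of
`Mᵀ M`. -/
def singVal {m n : Type*} [Fintype m] [Fintype n] [DecidableEq n] (M : Matrix m n ℝ) (j : n) : ℝ :=
  √((Matrix.isHermitian_conjTranspose_mul_self M).eigenvalues j)

/-- Nuclear norm: the sum of the singular values. -/
def nuclearNorm {m n : Type*} [Fintype m] [Fintype n] [DecidableEq n] (M : Matrix m n ℝ) : ℝ :=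
  ∑ j, singVal M j

/-- Condition number: the ratio of the largest to the smallest singular value. -/
def condNumber {m n : Type*} [Fintype m] [Fintype n] [DecidableEq n] (M : Matrix m n ℝ) : ℝ :=
  (⨆ j, singVal M j) / (⨅ j, singVal M j)

/-- Stable rank `‖M‖_F² / ‖M‖_op²`. -/
def stableRank {m n : Type*} [Fintype m] [Fintype n] [DecidableEq n] (M : Matrix m n ℝ) : ℝ :=
  frob M ^ 2 / opNorm M ^ 2

/-- `Z = U_k D_k^{1/2}`, where `U_k D_k U_kᵀ` consists of the top `k` eigen-components of the
symmetric matrix `G`: `G = V diag(d) Vᵀ` with `V` orthogonal and `d` non-increasing, and the `j`-th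
column of `Z` is `√d_j` times the `j`-th column of `V`. In case of ties `Z` is not unique. -/
def IsTopFactor {n k : ℕ} (G : Matrix (Fin n) (Fin n) ℝ) (Z : Matrix (Fin n) (Fin k) ℝ) : Prop :=
  ∃ hk : k ≤ n, ∃ V ∈ Matrix.orthogonalGroup (Fin n) ℝ, ∃ d : Fin n → ℝ,
    Antitone d ∧ G = V * Matrix.diagonal d * V.transpose ∧
    ∀ i j, Z i j = V i (Fin.castLE hk j) * √(d (Fin.castLE hk j))

/-- `dist(Z₁, Z₂) = min_{R ∈ O(k)} ‖Z₁ - Z₂ R‖_F`. -/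
def orthDist {n k : ℕ} (Z₁ Z₂ : Matrix (Fin n) (Fin k) ℝ) : ℝ :=
  ⨅ R : Matrix.orthogonalGroup (Fin k) ℝ, frob (Z₁ - Z₂ * (R : Matrix (Fin k) (Fin k) ℝ))

/-! ### The model -/

/-- The centering matrix `J = I - (1/n) 1 1ᵀ`. -/
def centering (n : ℕ) : Matrix (Fin n) (Fin n) ℝ := 1 - Matrix.of fun _ _ => 1 / (n : ℝ)

/-- The matrix `α 1ᵀ`. -/
def rowConst {n : ℕ} (α : Fin n → ℝ) : Matrix (Fin n) (Fin n) ℝ := Matrix.of fun i _ => α i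

/-- `Θ = α 1ᵀ + 1 αᵀ + β X + G`. -/
def theta {n : ℕ} (X G : Matrix (Fin n) (Fin n) ℝ) (α : Fin n → ℝ) (β : ℝ) :
    Matrix (Fin n) (Fin n) ℝ :=
  rowConst α + (rowConst α).transpose + β • X + G

/-- The sigmoid function applied entrywise. -/
def sigm {n : ℕ} (Θ : Matrix (Fin n) (Fin n) ℝ) : Matrix (Fin n) (Fin n) ℝ :=
  Θ.map Real.sigmoid

/-- Pairwise covariates: a symmetric matrix with zero diagonal. -/
structure IsCovariate {n : ℕ} (X : Matrix (Fin n) (Fin n) ℝ) : Prop where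
  symm : X.IsSymm
  diag : ∀ i, X i i = 0

/-- The parameter space: `G` is positive semidefinite and centered, the entries of `G`, `α`, `β X`
are bounded by `rG`, `rα`, `rβ`, and `Θ i j ≤ -M₂` off the diagonal. -/
structure InParamSpace {n : ℕ} (M₂ rG rα rβ : ℝ) (X G : Matrix (Fin n) (Fin n) ℝ)
    (α : Fin n → ℝ) (β : ℝ) : Prop where
  psd : G.PosSemidef
  centered : centering n * G = G
  G_le : ∀ i, G i i ≤ rG
  α_le : ∀ i, |α i| ≤ rα
  β_le : ∀ i j, i < j → |β| * |X i j| ≤ rβ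
  sparse : ∀ i j, i ≠ j → theta X G α β i j ≤ -M₂

/-- `A` is a random symmetric adjacency matrix without self-loops whose entries above the diagonal
are independent, `A i j` being Bernoulli with success probability `σ(Θ i j)`. -/
structure IsNetwork {n : ℕ} {Ω : Type*} [MeasurableSpace Ω] (μ : Measure Ω)
    (Θ : Matrix (Fin n) (Fin n) ℝ) (A : Ω → Matrix (Fin n) (Fin n) ℝ) : Prop where
  measurable : ∀ i j, Measurable fun ω => A ω i j
  symm : ∀ ω, (A ω).IsSymm
  diag : ∀ ω i, A ω i i = 0
  zero_or_one : ∀ ω i j, A ω i j = 0 ∨ A ω i j = 1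
  bernoulli : ∀ i j, i < j → μ.real {ω | A ω i j = 1} = Real.sigmoid (Θ i j)
  indep : iIndepFun (fun (p : {p : Fin n × Fin n // p.1 < p.2}) ω => A ω p.1.1 p.1.2) μ

/-! ### Initialization by projected gradient descent in the lifted space -/

/-- A point of `C` nearest to `y`, where the distance of `y` and `p` is `size (y - p)`. It is used
below for Euclidean norms and nonempty closed convex sets, where it is the metric projection. -/
def nearest {E : Type*} [AddGroup E] (size : E → ℝ) (C : Set E) (y : E) : E :=
  Classical.epsilon fun p => p ∈ C ∧ ∀ q ∈ C, size (y - p) ≤ size (y - q)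

/-- The constraint set for `G`. -/
def setG (n : ℕ) (rG : ℝ) : Set (Matrix (Fin n) (Fin n) ℝ) :=
  {G | G.PosSemidef ∧ centering n * G = G ∧ ∀ i j, |G i j| ≤ rG}

/-- The constraint set for `α`. -/
def setα (n : ℕ) (rα : ℝ) : Set (Fin n → ℝ) := {α | ∀ i, |α i| ≤ rα}

/-- The constraint set for `β`. -/
def setβ {n : ℕ} (X : Matrix (Fin n) (Fin n) ℝ) (rβ : ℝ) : Set ℝ :=
  {β | ∀ i j, |β| * |X i j| ≤ rβ}

/-- The current state of the algorithm. -/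
structure State (n : ℕ) where
  G : Matrix (Fin n) (Fin n) ℝ
  α : Fin n → ℝ
  β : ℝ

/-- The residual matrix `A - σ(Θ)` at a state. -/
def residual {n : ℕ} (A X : Matrix (Fin n) (Fin n) ℝ) (s : State n) : Matrix (Fin n) (Fin n) ℝ :=
  A - sigm (theta X s.G s.α s.β)

open Classical in
/-- One step of the algorithm: a gradient step followed by a projection for each of the three
components. If there is no covariate (`X = 0`), then `β` is not updated. -/
def step {n : ℕ} (A X : Matrix (Fin n) (Fin n) ℝ) (rG rα rβ η lam γ : ℝ) (s : State n) :
    State n where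
  G := nearest frob (setG n rG)
    (s.G + η • (residual A X s - lam • (1 : Matrix (Fin n) (Fin n) ℝ) - γ • s.G))
  α := nearest vecNorm (setα n rα)
    (fun i => s.α i + η * ((∑ j, residual A X s i j) / (2 * n) - γ * s.α i))
  β := if X = 0 then s.β else
    nearest abs (setβ X rβ)
      (s.β + η * (trInner (residual A X s) X / frob X ^ 2 - γ * s.β))

/-- The state after `T` steps from `G⁰ = 0`, `α⁰ = 0`, `β⁰ = 0`. -/
def iterate {n : ℕ} (A X : Matrix (Fin n) (Fin n) ℝ) (rG rα rβ η lam γ : ℝ) (T : ℕ) : State n :=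
  (step A X rG rα rβ η lam γ)^[T] ⟨0, 0, 0⟩

/-- The error
`‖Z⋆‖_op² dist(Z, Z⋆)² + 2 ‖(α - α⋆) 1ᵀ‖_F² + ‖(β - β⋆) X‖_F²`. -/
def initError {n k : ℕ} (X : Matrix (Fin n) (Fin n) ℝ) (Zs : Matrix (Fin n) (Fin k) ℝ)
    (αs : Fin n → ℝ) (βs : ℝ) (Z : Matrix (Fin n) (Fin k) ℝ) (α : Fin n → ℝ) (β : ℝ) : ℝ :=
  opNorm Zs ^ 2 * orthDist Z Zs ^ 2 + 2 * frob (rowConst (α - αs)) ^ 2 + frob ((β - βs) • X) ^ 2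

/-- `γ = c₀ / (e^{2 M₁} √k κ³)`. -/
def gammaChoice (c₀ M₁ : ℝ) (k : ℕ) (κ : ℝ) : ℝ := c₀ / (Real.exp (2 * M₁) * √k * κ ^ 3)

/-- `T₀ = log(C₁ e^{2 M₁} k κ⁶ / c₁²) / log(1 / (1 - γ η))`. -/
def numSteps (C₁ c₁ M₁ : ℝ) (k : ℕ) (κ γ η : ℝ) : ℝ :=
  Real.log (C₁ * Real.exp (2 * M₁) * k * κ ^ 6 / c₁ ^ 2) / Real.log (1 / (1 - γ * η))

/-- `ψ² = e^{2 M₁} n k max{e^{-M₂}, log n / n}`. -/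
def psiSq (n k : ℕ) (M₁ M₂ : ℝ) : ℝ :=
  Real.exp (2 * M₁) * n * k * max (Real.exp (-M₂)) (Real.log n / n)

end

end LatentSpace

open LatentSpace

namespace LatentSpace

/-! Give the `α` component the weight `4n` and the `β` component the weight `‖X‖_F²` (`stateInner`).
In this geometry the algorithm is projected gradient descent for a convex function: the negative
log-likelihood, plus `lam` times the trace of `G`, plus the ridge term `γ/2 ‖·‖²`. The ridge term
makes it `γ`-strongly convex, the bound `σ' ≤ 1/4` makes it `(3/4 + γ)`-smooth, so every step
multiplies the squared distance to the constrained minimizer `q` by at most `1 - ηγ`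
(`step_contraction`). What is left is to compare `q` with the truth, and then to pass from `G` to
its top factor.

For the first comparison, the objective at `q` is at most that at the truth. The likelihood
contributes curvature of order `e^{-M₁}`. The noise `W = A - σ(Θ⋆)` has operator norm at most
`lam/4`, and since the trace is the nuclear norm on positive semidefinite matrices, the penalty pays
for the part of `q.G` outside the top `k` eigenspace of `G⋆` (`basic_inequality`). Centering of `G`
and the large stable rank of `X` make the three components of `Θ - Θ⋆` almost orthogonal
(`frob_theta_sq_ge`). The result is an error of order `Λ = lam √k e^{M₁}`
(`error_le_of_objective_le`). With the prescribed `γ` and `lam` this is `C₀ c₀ ‖G⋆‖_op / (e^{M₁}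
κ³)`, a small multiple of the target scale, and the lower bound on `‖G⋆‖_op` puts noise and spectral
tail below it.

The noise bound `‖W‖_op ≲ √(nq)` with `q = max(e^{-M₂}, log n / n)` holds with probability at least
`1 - 1/n` (`prob_noise`), without an additional logarithmic factor. It is the Kahn–Szemerédi
argument: the quadratic form is tested on a lattice net; light pairs of coordinates obey a Chernoff
bound with a union over the net, and heavy pairs are controlled by bounded degrees and bounded
discrepancy of the graph.

The passage to the factor needs no eigengap: Eckart–Young bounds the distance of the rank `k`
truncations by that of the full matrices, and a Procrustes inequality turns the distance of Gram
matrices into `orthDist`, at the cost of `κ²` (`opNorm_sq_mul_orthDist_sq_le`). -/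

theorem integral_of_zero_or_one {Ω : Type*} [MeasurableSpace Ω] {μ : Measure Ω} {ξ : Ω → ℝ} (hm : Measurable ξ) (h01 : ∀ ω, ξ ω = 0 ∨ ξ ω = 1) :
    ∫ ω, ξ ω ∂μ = μ.real {ω | ξ ω = 1} := by
  have : ξ = Set.indicator {ω | ξ ω = 1} 1 := by
    funext ω
    rcases h01 ω with h | h <;> simp [Set.indicator, h]
  have hs : MeasurableSet {ω | ξ ω = 1} := hm (measurableSet_singleton 1)
  conv_lhs => rw [this]
  rw [integral_indicator_one hs]

/-! ### Tail bounds for sums of independent Bernoulli variables -/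

section Chernoff

variable {Ω ι : Type*} [MeasurableSpace Ω] {μ : Measure Ω} [IsProbabilityMeasure μ] [Fintype ι]

theorem mgf_of_zero_or_one {ξ : Ω → ℝ} (hm : Measurable ξ) (h01 : ∀ ω, ξ ω = 0 ∨ ξ ω = 1)
    (c : ℝ) : mgf (fun ω => c * ξ ω) μ 1 = 1 + μ.real {ω | ξ ω = 1} * (Real.exp c - 1) := by
  have h : (fun ω => Real.exp (1 * (c * ξ ω))) = fun ω => 1 + ξ ω * (Real.exp c - 1) := by
    funext ω
    rcases h01 ω with h | h <;> simp [h]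
  have hint : Integrable ξ μ := by
    refine Integrable.of_bound hm.aestronglyMeasurable 1 (ae_of_all _ fun ω => ?_)
    rcases h01 ω with h | h <;> simp [h]
  rw [mgf, h, integral_add (integrable_const _) (hint.mul_const _), integral_mul_const,
    integral_of_zero_or_one hm h01]
  simp

/-- Chernoff's bound for a linear combination of independent Bernoulli variables. -/
theorem chernoff {ξ : ι → Ω → ℝ} (hind : iIndepFun ξ μ) (hm : ∀ i, Measurable (ξ i))
    (h01 : ∀ i ω, ξ i ω = 0 ∨ ξ i ω = 1) (c : ι → ℝ) (s : ℝ) :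
    μ.real {ω | s ≤ ∑ i, c i * ξ i ω} ≤
      Real.exp (-s + ∑ i, μ.real {ω | ξ i ω = 1} * (Real.exp (c i) - 1)) := by
  have hind' : iIndepFun (fun i ω => c i * ξ i ω) μ :=
    hind.comp (fun i x => c i * x) fun i => measurable_const_mul _
  have hm' : ∀ i, Measurable fun ω => c i * ξ i ω := fun i => (hm i).const_mul _
  have hsum : (fun ω => ∑ i, c i * ξ i ω) = ∑ i, fun ω => c i * ξ i ω := by
    funext ω; simp
  have hint : Integrable (fun ω => Real.exp (1 * ∑ i, c i * ξ i ω)) μ := by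
    refine Integrable.of_bound (C := Real.exp (∑ i, |c i|)) (by fun_prop)
      (ae_of_all _ fun ω => ?_)
    rw [Real.norm_eq_abs, Real.abs_exp, one_mul]
    refine Real.exp_le_exp.2 (Finset.sum_le_sum fun i _ => ?_)
    rcases h01 i ω with h | h
    · simp [h]
    · simpa [h] using le_abs_self _
  have h := measure_ge_le_exp_mul_mgf (μ := μ) (t := 1) s zero_le_one hint
  refine h.trans ?_
  rw [hsum, hind'.mgf_sum hm', Real.exp_add, Real.exp_sum]
  simp only [neg_mul, one_mul]
  refine mul_le_mul_of_nonneg_left ?_ (Real.exp_pos _).le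
  refine Finset.prod_le_prod (fun i _ => mgf_nonneg) fun i _ => ?_
  rw [mgf_of_zero_or_one (hm i) (h01 i)]
  -- `1 + x ≤ e^x` replaces each factor of the product by a Poisson moment generating function.
  linarith [Real.add_one_le_exp (μ.real {ω | ξ i ω = 1} * (Real.exp (c i) - 1))]

/-- The upper tail of an edge count. The parameter `t` stays free because small blocks in a sparse
graph need large `t`. -/
theorem chernoff_indicator {ξ : ι → Ω → ℝ} (hind : iIndepFun ξ μ) (hm : ∀ i, Measurable (ξ i))
    (h01 : ∀ i ω, ξ i ω = 0 ∨ ξ i ω = 1) {q : ℝ} (hq : ∀ i, μ.real {ω | ξ i ω = 1} ≤ q)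
    (I : Finset ι) {t : ℝ} (ht : 0 ≤ t) (s : ℝ) :
    μ.real {ω | s ≤ t * ∑ i ∈ I, ξ i ω} ≤ Real.exp (-s + q * I.card * (Real.exp t - 1)) := by
  classical
  have h := chernoff hind hm h01 (fun i => if i ∈ I then t else 0) s
  have h1 : ∀ ω, ∑ i, (if i ∈ I then t else 0) * ξ i ω = t * ∑ i ∈ I, ξ i ω := by
    intro ω
    simp [ite_mul, Finset.mul_sum]
  simp only [h1] at h
  refine h.trans (Real.exp_le_exp.2 ?_)
  have h2 : ∀ i, μ.real {ω | ξ i ω = 1} * (Real.exp (if i ∈ I then t else 0) - 1) ≤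
      if i ∈ I then q * (Real.exp t - 1) else 0 := by
    intro i
    split_ifs
    · exact mul_le_mul_of_nonneg_right (hq i) (by linarith [Real.one_le_exp ht])
    · simp
  have h3 := Finset.sum_le_sum fun i (_ : i ∈ Finset.univ) => h2 i
  rw [Finset.sum_ite_mem, Finset.univ_inter, Finset.sum_const, nsmul_eq_mul] at h3
  linarith

/-- For `|c| ≤ 1` one has `e^c - 1 - c ≤ c²`, so the exponent carries the variance proxy `q ∑ c²`.
Unlike in Hoeffding's inequality, the sparsity `q` is gained. -/
theorem chernoff_centered {ξ : ι → Ω → ℝ} (hind : iIndepFun ξ μ) (hm : ∀ i, Measurable (ξ i))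
    (h01 : ∀ i ω, ξ i ω = 0 ∨ ξ i ω = 1) {q : ℝ} (hq : ∀ i, μ.real {ω | ξ i ω = 1} ≤ q)
    (c : ι → ℝ) (hc : ∀ i, |c i| ≤ 1) (s : ℝ) :
    μ.real {ω | s ≤ ∑ i, c i * (ξ i ω - μ.real {ω | ξ i ω = 1})} ≤
      Real.exp (-s + q * ∑ i, c i ^ 2) := by
  have h := chernoff hind hm h01 c (s + ∑ i, c i * μ.real {ω | ξ i ω = 1})
  have h1 : {ω | s ≤ ∑ i, c i * (ξ i ω - μ.real {ω | ξ i ω = 1})} =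
      {ω | s + ∑ i, c i * μ.real {ω | ξ i ω = 1} ≤ ∑ i, c i * ξ i ω} := by
    ext ω
    simp only [Set.mem_ofPred_eq, mul_sub, Finset.sum_sub_distrib]
    constructor <;> intro h <;> linarith
  rw [h1]
  refine h.trans (Real.exp_le_exp.2 ?_)
  have h2 : ∑ i, (μ.real {ω | ξ i ω = 1} * (Real.exp (c i) - 1) -
      c i * μ.real {ω | ξ i ω = 1}) ≤ ∑ i, q * c i ^ 2 := by
    refine Finset.sum_le_sum fun i _ => ?_
    have h3 := Real.abs_exp_sub_one_sub_id_le (hc i)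
    have h4 := (abs_le.1 h3).2
    have h5 : 0 ≤ μ.real {ω | ξ i ω = 1} := measureReal_nonneg
    nlinarith [hq i, sq_nonneg (c i)]
  rw [Finset.sum_sub_distrib, ← Finset.mul_sum] at h2
  linarith

theorem chernoff_centered_abs {ξ : ι → Ω → ℝ} (hind : iIndepFun ξ μ) (hm : ∀ i, Measurable (ξ i))
    (h01 : ∀ i ω, ξ i ω = 0 ∨ ξ i ω = 1) {q : ℝ} (hq : ∀ i, μ.real {ω | ξ i ω = 1} ≤ q)
    (c : ι → ℝ) (hc : ∀ i, |c i| ≤ 1) (s : ℝ) :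
    μ.real {ω | s ≤ |∑ i, c i * (ξ i ω - μ.real {ω | ξ i ω = 1})|} ≤
      2 * Real.exp (-s + q * ∑ i, c i ^ 2) := by
  have h1 := chernoff_centered hind hm h01 hq c hc s
  have h2 := chernoff_centered hind hm h01 hq (fun i => -c i) (by simpa using hc) s
  simp only [neg_mul, Finset.sum_neg_distrib, neg_sq] at h2
  have h3 : {ω | s ≤ |∑ i, c i * (ξ i ω - μ.real {ω | ξ i ω = 1})|} ⊆
      {ω | s ≤ ∑ i, c i * (ξ i ω - μ.real {ω | ξ i ω = 1})} ∪
      {ω | s ≤ -∑ i, c i * (ξ i ω - μ.real {ω | ξ i ω = 1})} := by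
    intro ω hω
    simpa [le_abs] using hω
  refine (measureReal_mono h3).trans ((measureReal_union_le _ _).trans ?_)
  linarith

/-- Hoeffding's inequality for a linear combination of independent Bernoulli variables. -/
theorem hoeffding_bernoulli {ξ : ι → Ω → ℝ} (hind : iIndepFun ξ μ) (hm : ∀ i, Measurable (ξ i))
    (h01 : ∀ i ω, ξ i ω = 0 ∨ ξ i ω = 1) (c : ι → ℝ) {s : ℝ} (hs : 0 ≤ s)
    (hc : 0 < ∑ i, c i ^ 2) :
    μ.real {ω | s ≤ ∑ i, c i * (ξ i ω - μ.real {ω | ξ i ω = 1})} ≤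
      Real.exp (-(2 * s ^ 2 / ∑ i, c i ^ 2)) := by
  set Y : ι → Ω → ℝ := fun i ω => c i * (ξ i ω - μ.real {ω | ξ i ω = 1})
  have hindY : iIndepFun Y μ :=
    hind.comp (fun i x => c i * (x - μ.real {ω | ξ i ω = 1})) fun i => by fun_prop
  have hsub : ∀ i, ∃ w : NNReal, (w : ℝ) = c i ^ 2 / 4 ∧ HasSubgaussianMGF (Y i) w μ := by
    intro i
    have h := hasSubgaussianMGF_of_mem_Icc (μ := μ) (X := ξ i) (a := 0) (b := 1)
      (hm i).aemeasurable (ae_of_all _ fun ω => by rcases h01 i ω with h | h <;> simp [h])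
    rw [integral_of_zero_or_one (hm i) (h01 i)] at h
    refine ⟨_, ?_, h.const_mul (c i)⟩
    change c i ^ 2 * ((‖(1 : ℝ) - 0‖₊ / 2) ^ 2 : NNReal) = _
    push_cast
    norm_num
    ring
  choose w hw hsub using hsub
  have h := HasSubgaussianMGF.measure_sum_ge_le_of_iIndepFun hindY (s := Finset.univ)
    (fun i _ => hsub i) hs
  refine h.trans (Real.exp_le_exp.2 (le_of_eq ?_))
  rw [NNReal.coe_sum, Finset.sum_congr rfl fun i _ => hw i, ← Finset.sum_div]
  field_simp
  norm_num

end Chernoff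

/-! ### Heavy pairs: a deterministic bound from degrees and discrepancy -/

section Discrepancy

/-- The entropy weight of a vertex set of size `s` at dyadic level `a`. -/
noncomputable def levelEntropy (n a : ℕ) (s : ℝ) : ℝ := 3 * a * s + n * Real.exp (-(3 * a))

theorem levelEntropy_nonneg (n a : ℕ) {s : ℝ} (hs : 0 ≤ s) : 0 ≤ levelEntropy n a s := by
  unfold levelEntropy; positivity

theorem sum_weight_halves (N : ℕ) :
    ∑ r ∈ Finset.range N, (1 + (r : ℝ)) * (1 / 2) ^ r ≤ 4 := by
  have h : ∀ N : ℕ, ∑ r ∈ Finset.range N, (1 + (r : ℝ)) * (1 / 2) ^ r =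
      4 - (2 * N + 4) * (1 / 2) ^ N := by
    intro N
    induction N with
    | zero => norm_num
    | succ N ih => rw [Finset.sum_range_succ, ih, pow_succ]; push_cast; ring
  rw [h]
  have : (0 : ℝ) ≤ (2 * N + 4) * (1 / 2) ^ N := by positivity
  linarith

theorem sum_halves (N : ℕ) : ∑ r ∈ Finset.range N, ((1 : ℝ) / 2) ^ r ≤ 2 := by
  have h : ∀ N : ℕ, ∑ r ∈ Finset.range N, ((1 : ℝ) / 2) ^ r = 2 - 2 * (1 / 2) ^ N := by
    intro N
    induction N with
    | zero => norm_num
    | succ N ih => rw [Finset.sum_range_succ, ih, pow_succ]; ring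
  rw [h]
  have : (0 : ℝ) ≤ 2 * (1 / 2) ^ N := by positivity
  linarith

theorem sum_weight_shift (n N : ℕ) :
    ∑ b ∈ Finset.range n, (if b ≤ N then (1 + ((N - b : ℕ) : ℝ)) * (1 / 2) ^ (N - b) else 0) ≤ 4 := by
  rw [← Finset.sum_filter]
  have hsub : (Finset.range n).filter (fun b => b ≤ N) ⊆ Finset.range (N + 1) := by
    intro b hb
    simp only [Finset.mem_filter, Finset.mem_range] at hb ⊢
    omega
  refine (Finset.sum_le_sum_of_subset_of_nonneg hsub fun i _ _ => by positivity).trans ?_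
  have := Finset.sum_range_reflect (fun r : ℕ => (1 + (r : ℝ)) * (1 / 2) ^ r) (N + 1)
  simp only [Nat.add_sub_cancel] at this
  rw [this]
  exact sum_weight_halves _

theorem exp_neg_three_mul_le (a : ℕ) : Real.exp (-(3 * a)) * 4 ^ a ≤ (1 / 2) ^ a := by
  have h1 : Real.exp (-(3 * a)) = (Real.exp (-3)) ^ a := by
    rw [← Real.exp_nat_mul]; ring_nf
  rw [h1, ← mul_pow]
  refine pow_le_pow_left₀ (by positivity) ?_ a
  have h2 : Real.exp (-3) = (Real.exp 1)⁻¹ ^ 3 := by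
    rw [← Real.exp_neg, ← Real.exp_nat_mul]; norm_num
  have h3 : (Real.exp 1)⁻¹ ≤ 1 / 2 := by
    rw [inv_eq_one_div]
    exact one_div_le_one_div_of_le two_pos (by linarith [Real.add_one_le_exp (1 : ℝ)])
  have h4 : (Real.exp 1)⁻¹ ^ 3 ≤ (1 / 2) ^ 3 := pow_le_pow_left₀ (by positivity) h3 3
  rw [h2]; linarith

/-- A level pair's entropy term is summable against the geometric weights. -/
theorem entropy_term_le {n a b m : ℕ} (h1 : m < a + b + 2) (h2 : b ≤ a + m) {s : ℝ} (hs : 0 ≤ s) :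
    2 ^ (a + b) / ((a + b + 2 - m : ℕ) : ℝ) * levelEntropy n a s ≤
      (3 / 2) * 2 ^ m * ((1 + ((a + m - b : ℕ) : ℝ)) * (1 / 2) ^ (a + m - b)) *
        (s * 4 ^ a + n * (1 / 2) ^ a) := by
  obtain ⟨r, hr⟩ : ∃ r, a + m = b + r := ⟨a + m - b, by omega⟩
  obtain ⟨l, hl⟩ : ∃ l, a + b + 2 = m + (l + 1) := ⟨a + b + 2 - m - 1, by omega⟩
  have e1 : a + m - b = r := by omega
  have e2 : a + b + 2 - m = l + 1 := by omega
  rw [e1, e2]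
  have hpow : (2 : ℝ) ^ (a + b) = 2 ^ m * 4 ^ a * (1 / 2) ^ r := by
    have : (2 : ℝ) ^ (a + b) * 2 ^ r = 2 ^ m * 4 ^ a := by
      rw [show (4 : ℝ) = 2 ^ 2 by norm_num, ← pow_mul, ← pow_add, ← pow_add]
      congr 1; omega
    rw [← this, mul_assoc, ← mul_pow]; norm_num
  -- Since `3a = 3(l + r - 1)/2`, division by `l + 1` leaves a factor linear in `r`, which `(1/2)^r`
  -- makes summable. This is why the discrepancy bound carries the factor `a + b + 2 - m` on its
  -- left.
  have hal : 2 * a + 1 = l + r := by omega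
  have hal' : (2 * a + 1 : ℝ) = l + r := by exact_mod_cast hal
  have hb1 : (3 * a : ℝ) / ((l + 1 : ℕ) : ℝ) ≤ 3 / 2 * (1 + r) := by
    rw [div_le_iff₀ (by positivity)]; push_cast
    have : (0 : ℝ) ≤ (l : ℝ) * r := by positivity
    nlinarith
  have hb2 : (1 : ℝ) / ((l + 1 : ℕ) : ℝ) ≤ 3 / 2 * (1 + r) := by
    rw [div_le_iff₀ (by positivity)]; push_cast
    have : (0 : ℝ) ≤ (l : ℝ) * r := by positivity
    have : (0 : ℝ) ≤ (r : ℝ) := by positivity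
    have : (0 : ℝ) ≤ (l : ℝ) := by positivity
    nlinarith
  have hx := exp_neg_three_mul_le a
  calc 2 ^ (a + b) / ((l + 1 : ℕ) : ℝ) * levelEntropy n a s
      = 2 ^ m * (1 / 2) ^ r * (3 * a / ((l + 1 : ℕ) : ℝ) * (s * 4 ^ a) +
          1 / ((l + 1 : ℕ) : ℝ) * (n * (Real.exp (-(3 * a)) * 4 ^ a))) := by
        rw [hpow]; unfold levelEntropy; ring
    _ ≤ 2 ^ m * (1 / 2) ^ r * (3 / 2 * (1 + r) * (s * 4 ^ a) +
          3 / 2 * (1 + r) * (n * (1 / 2) ^ a)) := by gcongr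
    _ = _ := by ring

/-- Contribution of one pair of dyadic levels. -/
theorem level_pair_le {n a b m : ℕ} (hn : 0 < n) {q s t e : ℝ} (hs : 0 ≤ s)
    (ht : 0 ≤ t) (he : 0 ≤ e) (hqD : q * n ≤ (2 ^ m) ^ 2) (h1 : m < a + b + 2) (h2 : b ≤ a + m)
    (h3 : a ≤ b + m)
    (key : ((a + b + 2 - m : ℕ) : ℝ) * Real.log 2 * e ≤ q * s * t * 2 ^ (a + b + 2 - m) +
      4 * (levelEntropy n a s + levelEntropy n b t)) :
    4 * 2 ^ (a + b) * e ≤ 24 * 2 ^ m * (n : ℝ)⁻¹ * ((s * 4 ^ a) * (t * 4 ^ b)) +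
        36 * 2 ^ m * (((1 + ((a + m - b : ℕ) : ℝ)) * (1 / 2) ^ (a + m - b)) *
          (s * 4 ^ a + n * (1 / 2) ^ a)) +
        36 * 2 ^ m * (((1 + ((b + m - a : ℕ) : ℝ)) * (1 / 2) ^ (b + m - a)) *
          (t * 4 ^ b + n * (1 / 2) ^ b)) := by
  have hn : (0 : ℝ) < n := by exact_mod_cast hn
  have E1 := entropy_term_le (n := n) h1 h2 hs
  have E2 := entropy_term_le (n := n) (a := b) (b := a) (m := m) (by omega) h3 ht
  obtain ⟨l, hl⟩ : ∃ l, a + b + 2 = m + l := ⟨a + b + 2 - m, by omega⟩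
  have e1 : a + b + 2 - m = l := by omega
  have e2 : b + a + 2 - m = l := by omega
  have hl1 : (1 : ℝ) ≤ l := by exact_mod_cast (by omega : 1 ≤ l)
  rw [e1] at key E1
  rw [e2, add_comm b a] at E2
  have hpow : (2 : ℝ) ^ l * 2 ^ m = 4 * 2 ^ (a + b) := by
    rw [← pow_add, add_comm l m, ← hl]; ring
  have hlog : (2 / 3 : ℝ) ≤ Real.log 2 := by linarith [Real.log_two_gt_d9]
  have key2 : (l : ℝ) * (2 / 3) * e ≤ q * s * t * 2 ^ l +
      4 * (levelEntropy n a s + levelEntropy n b t) := by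
    refine le_trans ?_ key
    have : (l : ℝ) * (2 / 3) ≤ l * Real.log 2 := by gcongr
    exact mul_le_mul_of_nonneg_right this he
  -- The mean term: `2^l = 4 · 2^(a+b) / 2^m` and `q n ≤ 4^m`, while `1/l` is simply dropped.
  have first : 2 ^ (a + b) / (l : ℝ) * (q * s * t * 2 ^ l) ≤
      4 * 2 ^ m * (n : ℝ)⁻¹ * ((s * 4 ^ a) * (t * 4 ^ b)) := by
    have hv4 : (s * 4 ^ a) * (t * 4 ^ b) = s * t * (2 ^ (a + b)) ^ 2 := by
      rw [← pow_mul, mul_comm (a + b) 2, pow_mul, show (2 : ℝ) ^ 2 = 4 by norm_num, pow_add]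
      ring
    have hl' : (2 : ℝ) ^ l = 4 * 2 ^ (a + b) / 2 ^ m := by
      rw [← hpow, mul_div_cancel_right₀ _ (by positivity)]
    have hqn : q ≤ (2 ^ m) ^ 2 * (n : ℝ)⁻¹ := by
      rw [← div_eq_mul_inv, le_div_iff₀ hn]; exact hqD
    calc 2 ^ (a + b) / (l : ℝ) * (q * s * t * 2 ^ l)
        ≤ 2 ^ (a + b) / (l : ℝ) * (((2 ^ m) ^ 2 * (n : ℝ)⁻¹) * s * t * 2 ^ l) := by gcongr
      _ ≤ 2 ^ (a + b) / 1 * (((2 ^ m) ^ 2 * (n : ℝ)⁻¹) * s * t * 2 ^ l) := by gcongr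
      _ = 4 * 2 ^ m * (n : ℝ)⁻¹ * ((s * 4 ^ a) * (t * 4 ^ b)) := by
          rw [hv4, hl', div_one]
          generalize (2 : ℝ) ^ (a + b) = x
          have : (2 : ℝ) ^ m ≠ 0 := by positivity
          generalize (2 : ℝ) ^ m = z at *
          field_simp
  have hmain : 4 * 2 ^ (a + b) * e ≤ 6 * (2 ^ (a + b) / (l : ℝ) * (q * s * t * 2 ^ l +
      4 * (levelEntropy n a s + levelEntropy n b t))) := by
    have : 4 * 2 ^ (a + b) * e = 6 * (2 ^ (a + b) / (l : ℝ) * (l * (2 / 3) * e)) := by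
      generalize (2 : ℝ) ^ (a + b) = x
      field_simp
      ring
    rw [this]
    gcongr
  linarith [hmain, first, E1, E2]

variable {n : ℕ}

/-- The level sets of a nonnegative vector. -/
noncomputable def levelSet (y : Fin n → ℝ) (a : ℕ) : Finset (Fin n) :=
  Finset.univ.filter fun i => 1 ≤ y i ∧ Nat.log 2 ⌊y i⌋₊ = a

theorem level_bounds {y : Fin n → ℝ} {a : ℕ} {i : Fin n} (hi : i ∈ levelSet y a) :
    2 ^ a ≤ y i ∧ y i < 2 ^ (a + 1) := by
  simp only [levelSet, Finset.mem_filter, Finset.mem_univ, true_and] at hi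
  obtain ⟨h1, rfl⟩ := hi
  have hf : ⌊y i⌋₊ ≠ 0 := (Nat.floor_pos.2 h1).ne'
  constructor
  · refine le_trans ?_ (Nat.floor_le (by linarith))
    exact_mod_cast Nat.pow_log_le_self 2 hf
  · refine (Nat.lt_floor_add_one _).trans_le ?_
    have := Nat.lt_pow_succ_log_self (b := 2) (by norm_num) ⌊y i⌋₊
    exact_mod_cast this

theorem sum_level_sq_le (y : Fin n → ℝ) :
    ∑ a ∈ Finset.range n, ((levelSet y a).card : ℝ) * 4 ^ a ≤ ∑ i, y i ^ 2 := by
  have h1 : ∀ a, ((levelSet y a).card : ℝ) * 4 ^ a ≤ ∑ i ∈ levelSet y a, y i ^ 2 := by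
    intro a
    rw [← nsmul_eq_mul, ← Finset.sum_const]
    refine Finset.sum_le_sum fun i hi => ?_
    have h := (level_bounds hi).1
    calc (4 : ℝ) ^ a = (2 ^ a) ^ 2 := by rw [← pow_mul, mul_comm, pow_mul]; norm_num
      _ ≤ _ := pow_le_pow_left₀ (by positivity) h 2
  refine (Finset.sum_le_sum fun a _ => h1 a).trans ?_
  rw [← Finset.sum_biUnion]
  · exact Finset.sum_le_sum_of_subset_of_nonneg (Finset.subset_univ _) fun i _ _ => sq_nonneg _
  · intro a _ b _ hab
    rw [Function.onFun, Finset.disjoint_left]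
    intro i hi hj
    simp only [levelSet, Finset.mem_filter] at hi hj
    exact hab (hi.2.2.symm.trans hj.2.2)

/-- From `4^a ≤ y_i² ≤ 2n`. The bound is crude, but it leaves only `n²` pairs of levels for the
union bound on discrepancy. -/
theorem level_lt {y : Fin n → ℝ} {a : ℕ} {i : Fin n} (hy : ∑ i, y i ^ 2 ≤ 2 * n)
    (hi : i ∈ levelSet y a) : a < n := by
  have h1 : y i ^ 2 ≤ 2 * n :=
    (Finset.single_le_sum (fun i _ => sq_nonneg (y i)) (Finset.mem_univ i)).trans hy
  have h2 : (2 : ℝ) ^ (2 * a) ≤ 2 * n := by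
    refine le_trans ?_ h1
    rw [mul_comm, pow_mul]
    exact pow_le_pow_left₀ (by positivity) (level_bounds hi).1 2
  have h3 : 2 ^ (2 * a) ≤ 2 * n := by exact_mod_cast h2
  have h4 : n < 2 ^ n := Nat.lt_two_pow_self
  by_contra! hcon
  rcases Nat.eq_zero_or_pos n with h0 | h0
  · exact absurd i.2 (by omega)
  have h5 : 2 ^ (n + 1) ≤ 2 ^ (2 * a) := Nat.pow_le_pow_right (by norm_num) (by omega)
  rw [pow_succ] at h5
  omega

/-- Contribution of the pairs of comparable magnitude. -/
theorem sum_comparable_le {B : Fin n → Fin n → ℝ} (hB : ∀ i j, 0 ≤ B i j) {y : Fin n → ℝ}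
    (hy0 : ∀ i, 0 ≤ y i) (hy : ∑ i, y i ^ 2 ≤ 2 * n) {m : ℕ} {q : ℝ}
    (hqD : q * n ≤ (2 ^ m) ^ 2)
    (hdisc : ∀ a b : ℕ, a < n → b < n → ∀ S T : Finset (Fin n),
      ((a + b + 2 - m : ℕ) : ℝ) * Real.log 2 * ∑ i ∈ S, ∑ j ∈ T, B i j ≤
        q * S.card * T.card * 2 ^ (a + b + 2 - m) +
          4 * (levelEntropy n a S.card + levelEntropy n b T.card)) :
    ∑ i, ∑ j, (if 2 ^ m < y i * y j ∧ y i ≤ 2 ^ m * y j ∧ y j ≤ 2 ^ m * y i then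
      B i j * (y i * y j) else 0) ≤ 1248 * n * 2 ^ m := by
  classical
  set s : ℕ → ℝ := fun a => ((levelSet y a).card : ℝ)
  have hs0 : ∀ a, 0 ≤ s a := fun a => by positivity
  set v : ℕ → ℝ := fun a => s a * 4 ^ a
  have hv0 : ∀ a, 0 ≤ v a := fun a => by positivity
  have hv : ∑ a ∈ Finset.range n, v a ≤ 2 * n := (sum_level_sq_le y).trans hy
  have hD : (1 : ℝ) ≤ 2 ^ m := one_le_pow₀ (by norm_num)
  set e : ℕ → ℕ → ℝ := fun a b => ∑ i ∈ levelSet y a, ∑ j ∈ levelSet y b, B i j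
  have he0 : ∀ a b, 0 ≤ e a b := fun a b =>
    Finset.sum_nonneg fun i _ => Finset.sum_nonneg fun j _ => hB i j
  set adm : ℕ → ℕ → Prop := fun a b => m < a + b + 2 ∧ b ≤ a + m ∧ a ≤ b + m
  -- pass to levels
  have step1 : ∀ i j, (if 2 ^ m < y i * y j ∧ y i ≤ 2 ^ m * y j ∧ y j ≤ 2 ^ m * y i then
      B i j * (y i * y j) else 0) ≤ ∑ a ∈ Finset.range n, ∑ b ∈ Finset.range n,
        (if adm a b then (if i ∈ levelSet y a then (if j ∈ levelSet y b then
          4 * 2 ^ (a + b) * B i j else 0) else 0) else 0) := by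
    intro i j
    have hnn : ∀ a b, (0 : ℝ) ≤ (if adm a b then (if i ∈ levelSet y a then
        (if j ∈ levelSet y b then 4 * 2 ^ (a + b) * B i j else 0) else 0) else 0) := by
      intro a b
      have := hB i j
      split_ifs <;> positivity
    split_ifs with h
    · obtain ⟨h1, h2, h3⟩ := h
      -- If `y i < 1`, then `y i * y j ≤ 2^m (y i)² < 2^m` and the pair would not be heavy. Hence
      -- entries below `1` need no level.
      have hi1 : 1 ≤ y i := by
        by_contra! hc
        have : y i * y j ≤ y i * (2 ^ m * y i) := mul_le_mul_of_nonneg_left h3 (hy0 i)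
        have h5 : y i * y i < 1 := by nlinarith [hy0 i]
        nlinarith
      have hj1 : 1 ≤ y j := by
        by_contra! hc
        have : y i * y j ≤ 2 ^ m * y j * y j := mul_le_mul_of_nonneg_right h2 (hy0 j)
        have h5 : y j * y j < 1 := by nlinarith [hy0 j]
        nlinarith
      obtain ⟨a, hia⟩ : ∃ a, i ∈ levelSet y a := ⟨Nat.log 2 ⌊y i⌋₊, by simp [levelSet, hi1]⟩
      obtain ⟨b, hjb⟩ : ∃ b, j ∈ levelSet y b := ⟨Nat.log 2 ⌊y j⌋₊, by simp [levelSet, hj1]⟩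
      obtain ⟨la, ua⟩ := level_bounds hia
      obtain ⟨lb, ub⟩ := level_bounds hjb
      have hadm : adm a b := by
        refine ⟨?_, ?_, ?_⟩
        · have : (2 : ℝ) ^ m < 2 ^ (a + b + 2) := by
            refine h1.trans_le ((mul_le_mul ua.le ub.le (hy0 j) (by positivity)).trans
              (le_of_eq ?_))
            rw [← pow_add]; congr 1; omega
          exact (pow_lt_pow_iff_right₀ (by norm_num)).1 this
        · have : (2 : ℝ) ^ b < 2 ^ (a + m + 1) := by
            refine lb.trans_lt (h3.trans_lt ?_)
            rw [show a + m + 1 = m + (a + 1) by omega, pow_add]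
            exact mul_lt_mul_of_pos_left ua (by positivity)
          have := (pow_lt_pow_iff_right₀ (by norm_num : (1 : ℝ) < 2)).1 this
          omega
        · have : (2 : ℝ) ^ a < 2 ^ (b + m + 1) := by
            refine la.trans_lt (h2.trans_lt ?_)
            rw [show b + m + 1 = m + (b + 1) by omega, pow_add]
            exact mul_lt_mul_of_pos_left ub (by positivity)
          have := (pow_lt_pow_iff_right₀ (by norm_num : (1 : ℝ) < 2)).1 this
          omega
      have han := level_lt hy hia
      have hbn := level_lt hy hjb
      refine le_trans ?_ (Finset.single_le_sum (f := fun a => ∑ b ∈ Finset.range n,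
        (if adm a b then (if i ∈ levelSet y a then (if j ∈ levelSet y b then
          4 * 2 ^ (a + b) * B i j else 0) else 0) else 0))
        (fun a _ => Finset.sum_nonneg fun b _ => hnn a b) (Finset.mem_range.2 han))
      refine le_trans ?_ (Finset.single_le_sum (fun b _ => hnn a b) (Finset.mem_range.2 hbn))
      rw [if_pos hadm, if_pos hia, if_pos hjb]
      have : y i * y j ≤ 4 * 2 ^ (a + b) :=
        (mul_le_mul ua.le ub.le (hy0 j) (by positivity)).trans (le_of_eq (by ring))
      nlinarith [hB i j]
    · exact Finset.sum_nonneg fun a _ => Finset.sum_nonneg fun b _ => hnn a b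
  have step2 : ∑ i, ∑ j, (if 2 ^ m < y i * y j ∧ y i ≤ 2 ^ m * y j ∧ y j ≤ 2 ^ m * y i then
      B i j * (y i * y j) else 0) ≤ ∑ a ∈ Finset.range n, ∑ b ∈ Finset.range n,
        (if adm a b then 4 * 2 ^ (a + b) * e a b else 0) := by
    refine (Finset.sum_le_sum fun i _ => Finset.sum_le_sum fun j _ => step1 i j).trans
      (le_of_eq ?_)
    calc _ = ∑ i, ∑ a ∈ Finset.range n, ∑ j, ∑ b ∈ Finset.range n, _ :=
          Finset.sum_congr rfl fun i _ => Finset.sum_comm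
      _ = ∑ a ∈ Finset.range n, ∑ i, ∑ j, ∑ b ∈ Finset.range n, _ := Finset.sum_comm
      _ = ∑ a ∈ Finset.range n, ∑ i, ∑ b ∈ Finset.range n, ∑ j, _ :=
          Finset.sum_congr rfl fun a _ => Finset.sum_congr rfl fun i _ => Finset.sum_comm
      _ = ∑ a ∈ Finset.range n, ∑ b ∈ Finset.range n, ∑ i, ∑ j, _ :=
          Finset.sum_congr rfl fun a _ => Finset.sum_comm
      _ = _ := ?_
    refine Finset.sum_congr rfl fun a _ => Finset.sum_congr rfl fun b _ => ?_
    split_ifs with h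
    · simp only [e, Finset.mul_sum]
      rw [← Finset.sum_filter_add_sum_filter_not Finset.univ (· ∈ levelSet y a)]
      rw [Finset.filter_univ_mem]
      have hz : ∑ x ∈ Finset.univ.filter (· ∉ levelSet y a), ∑ j,
          (if x ∈ levelSet y a then (if j ∈ levelSet y b then 4 * 2 ^ (a + b) * B x j else 0)
            else 0) = 0 := by
        refine Finset.sum_eq_zero fun i hi => ?_
        simp [(Finset.mem_filter.1 hi).2]
      rw [hz, add_zero]
      refine Finset.sum_congr rfl fun i hi => ?_
      simp [hi]
    · simp
  have step3 : ∀ a ∈ Finset.range n, ∀ b ∈ Finset.range n,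
      (if adm a b then 4 * 2 ^ (a + b) * e a b else 0) ≤ 24 * 2 ^ m * (n : ℝ)⁻¹ * (v a * v b) +
        36 * 2 ^ m * ((if b ≤ a + m then (1 + ((a + m - b : ℕ) : ℝ)) * (1 / 2) ^ (a + m - b)
          else 0) * (v a + n * (1 / 2) ^ a)) +
        36 * 2 ^ m * ((if a ≤ b + m then (1 + ((b + m - a : ℕ) : ℝ)) * (1 / 2) ^ (b + m - a)
          else 0) * (v b + n * (1 / 2) ^ b)) := by
    intro a ha b hb
    have ha := Finset.mem_range.1 ha
    have hb := Finset.mem_range.1 hb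
    by_cases h : adm a b
    · rw [if_pos h, if_pos h.2.1, if_pos h.2.2]
      exact level_pair_le (by omega) (hs0 a) (hs0 b) (he0 a b) hqD h.1 h.2.1 h.2.2
        (hdisc a b ha hb _ _)
    · rw [if_neg h]
      have hif : ∀ c d : ℕ, (0 : ℝ) ≤
          if c ≤ d then (1 + ((d - c : ℕ) : ℝ)) * (1 / 2) ^ (d - c) else 0 := by
        intro c d
        split_ifs <;> positivity
      have hw : ∀ a, 0 ≤ v a + n * (1 / 2) ^ a := fun a => add_nonneg (hv0 a) (by positivity)
      refine add_nonneg (add_nonneg (mul_nonneg (by positivity) (mul_nonneg (hv0 a) (hv0 b))) ?_) ?_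
      · exact mul_nonneg (by positivity) (mul_nonneg (hif _ _) (hw a))
      · exact mul_nonneg (by positivity) (mul_nonneg (hif _ _) (hw b))
  refine step2.trans ((Finset.sum_le_sum fun a ha => Finset.sum_le_sum fun b hb =>
    step3 a ha b hb).trans ?_)
  simp only [Finset.sum_add_distrib, ← Finset.mul_sum, ← Finset.sum_mul]
  set V := ∑ a ∈ Finset.range n, v a
  have hV0 : 0 ≤ V := Finset.sum_nonneg fun a _ => hv0 a
  have hS : ∑ a ∈ Finset.range n, (v a + n * (1 / 2) ^ a) ≤ 4 * n := by
    rw [Finset.sum_add_distrib, ← Finset.mul_sum]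
    have := sum_halves n
    have hn : (0 : ℝ) ≤ n := by positivity
    nlinarith
  -- In units of `n 2^m` the three sums contribute `96`, `36 · 16` and `36 · 16`, in total `1248`.
  have t1 : 24 * 2 ^ m * (n : ℝ)⁻¹ * (V * V) ≤ 96 * n * 2 ^ m := by
    rcases Nat.eq_zero_or_pos n with h0 | h0
    · subst h0; simp
    have hn : (0 : ℝ) < n := by exact_mod_cast h0
    have : V * V ≤ (2 * n) * (2 * n) := mul_le_mul hv hv hV0 (by positivity)
    calc 24 * 2 ^ m * (n : ℝ)⁻¹ * (V * V) ≤ 24 * 2 ^ m * (n : ℝ)⁻¹ * ((2 * n) * (2 * n)) := by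
          gcongr
      _ = _ := by field_simp; norm_num
  have t2 : ∑ a ∈ Finset.range n, (∑ b ∈ Finset.range n,
      (if b ≤ a + m then (1 + ((a + m - b : ℕ) : ℝ)) * (1 / 2) ^ (a + m - b) else 0)) *
      (v a + n * (1 / 2) ^ a) ≤ 16 * n := by
    calc _ ≤ ∑ a ∈ Finset.range n, 4 * (v a + n * (1 / 2) ^ a) := by
          refine Finset.sum_le_sum fun a _ => ?_
          have := hv0 a
          exact mul_le_mul_of_nonneg_right (sum_weight_shift _ _) (by positivity)
      _ ≤ _ := by rw [← Finset.mul_sum]; linarith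
  have t3 : ∑ a ∈ Finset.range n, ∑ b ∈ Finset.range n,
      (if a ≤ b + m then (1 + ((b + m - a : ℕ) : ℝ)) * (1 / 2) ^ (b + m - a) else 0) *
      (v b + n * (1 / 2) ^ b) ≤ 16 * n := by
    rw [Finset.sum_comm]
    simp only [← Finset.sum_mul]
    exact t2
  nlinarith

/-- Contribution of all heavy pairs. -/
theorem sum_heavy_le {B : Fin n → Fin n → ℝ} (hB : ∀ i j, 0 ≤ B i j) {y : Fin n → ℝ}
    (hy0 : ∀ i, 0 ≤ y i) (hy : ∑ i, y i ^ 2 ≤ 2 * n) {m : ℕ} {q : ℝ}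
    (hqD : q * n ≤ (2 ^ m) ^ 2)
    (hdeg : ∀ i, ∑ j, (B i j + B j i) ≤ 14 * (2 ^ m) ^ 2)
    (hdisc : ∀ a b : ℕ, a < n → b < n → ∀ S T : Finset (Fin n),
      ((a + b + 2 - m : ℕ) : ℝ) * Real.log 2 * ∑ i ∈ S, ∑ j ∈ T, B i j ≤
        q * S.card * T.card * 2 ^ (a + b + 2 - m) +
          4 * (levelEntropy n a S.card + levelEntropy n b T.card)) :
    ∑ i, ∑ j, (if 2 ^ m < y i * y j then B i j * (y i * y j) else 0) ≤ 1276 * n * 2 ^ m := by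
  have h1 := sum_comparable_le hB hy0 hy hqD hdisc
  have h2 : ∑ i, ∑ j, B i j * (y i ^ 2 + y j ^ 2) / 2 ^ m ≤ (28 * n * 2 ^ m : ℝ) := by
    have e : ∑ i, ∑ j, B i j * (y i ^ 2 + y j ^ 2) / 2 ^ m =
        ∑ i, y i ^ 2 / 2 ^ m * ∑ j, (B i j + B j i) := by
      have e1 : ∀ i j, B i j * (y i ^ 2 + y j ^ 2) / 2 ^ m =
          y i ^ 2 / 2 ^ m * B i j + y j ^ 2 / 2 ^ m * B i j := fun i j => by ring
      rw [Finset.sum_congr rfl fun i _ => Finset.sum_congr rfl fun j _ => e1 i j]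
      simp only [Finset.sum_add_distrib, mul_add, Finset.mul_sum]
      congr 1
      rw [Finset.sum_comm]
    rw [e]
    calc _ ≤ ∑ i, y i ^ 2 / 2 ^ m * (14 * (2 ^ m) ^ 2) :=
          Finset.sum_le_sum fun i _ => mul_le_mul_of_nonneg_left (hdeg i) (by positivity)
      _ = (∑ i, y i ^ 2) * (14 * 2 ^ m) := by
          rw [Finset.sum_mul]
          refine Finset.sum_congr rfl fun i _ => ?_
          field_simp
      _ ≤ (2 * n) * (14 * 2 ^ m) := by gcongr
      _ = _ := by ring
  have h3 : ∀ i j, (if 2 ^ m < y i * y j then B i j * (y i * y j) else 0) ≤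
      (if 2 ^ m < y i * y j ∧ y i ≤ 2 ^ m * y j ∧ y j ≤ 2 ^ m * y i then
      B i j * (y i * y j) else 0) + B i j * (y i ^ 2 + y j ^ 2) / 2 ^ m := by
    intro i j
    have hb := hB i j
    have hpos : 0 ≤ B i j * (y i ^ 2 + y j ^ 2) / 2 ^ m := by positivity
    split_ifs with c1 c2 c2
    · linarith
    -- For heavy pairs of incomparable size the product is at most the larger square divided by
    -- `2^m`, and the degree bound suffices for the sum of squares.
    · have : y i * y j ≤ (y i ^ 2 + y j ^ 2) / 2 ^ m := by
        rw [le_div_iff₀ (by positivity)]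
        by_cases c3 : y i ≤ 2 ^ m * y j
        · have c4 : 2 ^ m * y i < y j := by
            by_contra! c4
            exact c2 ⟨c1, c3, c4⟩
          nlinarith [hy0 i, hy0 j, sq_nonneg (y i)]
        · push Not at c3
          nlinarith [hy0 i, hy0 j, sq_nonneg (y j)]
      rw [mul_div_assoc]
      nlinarith
    · exact absurd c2.1 c1
    · linarith
  refine (Finset.sum_le_sum fun i _ => Finset.sum_le_sum fun j _ => h3 i j).trans ?_
  simp only [Finset.sum_add_distrib]
  linarith

end Discrepancy

open scoped Matrix

/-! ### Quadratic forms, polarization and the net argument -/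

section QuadraticForm

variable {n : ℕ}

theorem dotProduct_self_nonneg' {m : Type*} [Fintype m] (x : m → ℝ) : 0 ≤ x ⬝ᵥ x :=
  Finset.sum_nonneg fun _ _ => mul_self_nonneg _

theorem dotProduct_self_eq_zero' {m : Type*} [Fintype m] {x : m → ℝ} (h : x ⬝ᵥ x = 0) : x = 0 :=
  dotProduct_self_eq_zero.1 h

theorem abs_dotProduct_le {m : Type*} [Fintype m] (x y : m → ℝ) :
    |x ⬝ᵥ y| ≤ √(x ⬝ᵥ x) * √(y ⬝ᵥ y) := by
  rw [← Real.sqrt_mul (dotProduct_self_nonneg' x)]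
  refine Real.abs_le_sqrt ?_
  have := Finset.sum_mul_sq_le_sq_mul_sq Finset.univ x y
  simpa [dotProduct, sq] using this

theorem dotProduct_mulVec_symm {S : Matrix (Fin n) (Fin n) ℝ} (hS : S.IsSymm) (x y : Fin n → ℝ) :
    x ⬝ᵥ S *ᵥ y = y ⬝ᵥ S *ᵥ x := by
  rw [Matrix.dotProduct_mulVec, ← Matrix.mulVec_transpose, hS.eq, dotProduct_comm]

/-- Polarization: a bound for the quadratic form of a symmetric matrix bounds its bilinear form. -/
theorem abs_bilin_le_of_quad {S : Matrix (Fin n) (Fin n) ℝ} (hS : S.IsSymm) {N : ℝ}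
    (h : ∀ x, |x ⬝ᵥ S *ᵥ x| ≤ N * (x ⬝ᵥ x)) (x y : Fin n → ℝ) :
    |x ⬝ᵥ S *ᵥ y| ≤ N * (√(x ⬝ᵥ x) * √(y ⬝ᵥ y)) := by
  have key : ∀ u v : Fin n → ℝ, |u ⬝ᵥ S *ᵥ v| ≤ N / 2 * (u ⬝ᵥ u + v ⬝ᵥ v) := by
    intro u v
    have h1 := h (u + v)
    have h2 := h (u - v)
    have e1 : (u + v) ⬝ᵥ S *ᵥ (u + v) - (u - v) ⬝ᵥ S *ᵥ (u - v) = 4 * (u ⬝ᵥ S *ᵥ v) := by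
      simp only [Matrix.mulVec_add, Matrix.mulVec_sub, dotProduct_add, dotProduct_sub,
        add_dotProduct, sub_dotProduct, dotProduct_mulVec_symm hS v u]
      ring
    have e2 : (u + v) ⬝ᵥ (u + v) + (u - v) ⬝ᵥ (u - v) = 2 * (u ⬝ᵥ u + v ⬝ᵥ v) := by
      simp only [dotProduct_add, dotProduct_sub, add_dotProduct, sub_dotProduct,
        dotProduct_comm v u]
      ring
    have e3 : N * ((u + v) ⬝ᵥ (u + v)) + N * ((u - v) ⬝ᵥ (u - v)) =
        4 * (N / 2 * (u ⬝ᵥ u + v ⬝ᵥ v)) := by rw [← mul_add, e2]; ring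
    rw [abs_le] at h1 h2 ⊢
    constructor <;> linarith [h1.1, h1.2, h2.1, h2.2]
  rcases (dotProduct_self_nonneg' x).eq_or_lt with hx | hx
  · rw [dotProduct_self_eq_zero' hx.symm]; simp
  rcases (dotProduct_self_nonneg' y).eq_or_lt with hy | hy
  · rw [dotProduct_self_eq_zero' hy.symm]; simp
  set a := √(x ⬝ᵥ x)
  set b := √(y ⬝ᵥ y)
  have ha : 0 < a := Real.sqrt_pos.2 hx
  have hb : 0 < b := Real.sqrt_pos.2 hy
  have ha2 : x ⬝ᵥ x = a ^ 2 := (Real.sq_sqrt hx.le).symm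
  have hb2 : y ⬝ᵥ y = b ^ 2 := (Real.sq_sqrt hy.le).symm
  have hk := key (a⁻¹ • x) (b⁻¹ • y)
  simp only [Matrix.mulVec_smul, dotProduct_smul, smul_dotProduct, smul_eq_mul, ha2, hb2] at hk
  have e : N / 2 * (a⁻¹ * (a⁻¹ * a ^ 2) + b⁻¹ * (b⁻¹ * b ^ 2)) = N := by
    field_simp; ring
  rw [e, ← mul_assoc, abs_mul, abs_of_pos (by positivity : 0 < b⁻¹ * a⁻¹)] at hk
  calc |x ⬝ᵥ S *ᵥ y| = (b⁻¹ * a⁻¹ * |x ⬝ᵥ S *ᵥ y|) * (a * b) := by field_simp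
    _ ≤ N * (a * b) := mul_le_mul_of_nonneg_right hk (by positivity)

/-- The net argument for quadratic forms. -/
theorem abs_quad_le_of_net {S : Matrix (Fin n) (Fin n) ℝ} (hS : S.IsSymm) {c : ℝ}
    (h : ∀ x, x ⬝ᵥ x = 1 → ∃ z, (x - z) ⬝ᵥ (x - z) ≤ 1 / 16 ∧ |z ⬝ᵥ S *ᵥ z| ≤ c)
    (x : Fin n → ℝ) : |x ⬝ᵥ S *ᵥ x| ≤ 16 / 7 * c * (x ⬝ᵥ x) := by
  rcases Nat.eq_zero_or_pos n with h0 | h0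
  · subst h0; simp
  set K : Set (Fin n → ℝ) := {x | x ⬝ᵥ x = 1}
  have hcont : Continuous fun x : Fin n → ℝ => x ⬝ᵥ x := by fun_prop
  have hK : IsCompact K := by
    refine Metric.isCompact_of_isClosed_isBounded (isClosed_eq hcont continuous_const) ?_
    refine (Metric.isBounded_closedBall (x := (0 : Fin n → ℝ)) (r := 1)).subset ?_
    intro x hx
    rw [mem_closedBall_zero_iff, pi_norm_le_iff_of_nonneg zero_le_one]
    intro i
    have h1 : x i * x i ≤ x ⬝ᵥ x :=
      Finset.single_le_sum (f := fun i => x i * x i) (fun i _ => mul_self_nonneg _)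
        (Finset.mem_univ i)
    have h2 : x ⬝ᵥ x = 1 := hx
    rw [Real.norm_eq_abs]
    exact abs_le_of_sq_le_sq (by nlinarith) zero_le_one
  have hne : K.Nonempty := ⟨Pi.single ⟨0, h0⟩ 1, by simp [K]⟩
  obtain ⟨x0, hx0, hmax⟩ := hK.exists_isMaxOn hne
    (f := fun x : Fin n → ℝ => |x ⬝ᵥ S *ᵥ x|) (by fun_prop)
  set N := |x0 ⬝ᵥ S *ᵥ x0| with hN
  have hN0 : 0 ≤ N := abs_nonneg _
  have hquad : ∀ x, |x ⬝ᵥ S *ᵥ x| ≤ N * (x ⬝ᵥ x) := by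
    intro x
    rcases (dotProduct_self_nonneg' x).eq_or_lt with hx | hx
    · rw [dotProduct_self_eq_zero' hx.symm]; simp
    set a := √(x ⬝ᵥ x)
    have ha : 0 < a := Real.sqrt_pos.2 hx
    have ha2 : x ⬝ᵥ x = a ^ 2 := (Real.sq_sqrt hx.le).symm
    have hmem : a⁻¹ • x ∈ K := by
      change (a⁻¹ • x) ⬝ᵥ (a⁻¹ • x) = 1
      simp only [dotProduct_smul, smul_dotProduct, smul_eq_mul, ha2]
      field_simp
    have hm : |(a⁻¹ • x) ⬝ᵥ S *ᵥ (a⁻¹ • x)| ≤ N := hmax hmem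
    simp only [Matrix.mulVec_smul, dotProduct_smul, smul_dotProduct, smul_eq_mul] at hm
    rw [← mul_assoc, abs_mul, abs_of_pos (by positivity : 0 < a⁻¹ * a⁻¹)] at hm
    rw [ha2]
    calc |x ⬝ᵥ S *ᵥ x| = (a⁻¹ * a⁻¹ * |x ⬝ᵥ S *ᵥ x|) * a ^ 2 := by field_simp
      _ ≤ N * a ^ 2 := mul_le_mul_of_nonneg_right hm (by positivity)
  -- The forms at the maximizer `x0` and at the net point `z` differ by the bilinear form at `x0 -
  -- z` and `x0 + z`, whose norms are at most `1/4` and `9/4`. Hence `N - c ≤ 9/16 N`.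
  have hbound : N ≤ 16 / 7 * c := by
    have hx1 : x0 ⬝ᵥ x0 = 1 := hx0
    obtain ⟨z, hz1, hz2⟩ := h x0 hx1
    have hb := abs_bilin_le_of_quad hS hquad (x0 - z) (x0 + z)
    have e : (x0 - z) ⬝ᵥ S *ᵥ (x0 + z) = x0 ⬝ᵥ S *ᵥ x0 - z ⬝ᵥ S *ᵥ z := by
      simp only [Matrix.mulVec_add, dotProduct_add, sub_dotProduct, dotProduct_mulVec_symm hS z x0]
      ring
    have s1 : √((x0 - z) ⬝ᵥ (x0 - z)) ≤ 1 / 4 := by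
      rw [Real.sqrt_le_left (by norm_num)]; linarith
    have s2 : √((x0 + z) ⬝ᵥ (x0 + z)) ≤ 9 / 4 := by
      rw [Real.sqrt_le_left (by norm_num)]
      have h3 := abs_dotProduct_le x0 (x0 - z)
      rw [hx1, Real.sqrt_one, one_mul] at h3
      have h4 := (abs_le.1 (h3.trans s1)).1
      have e2 : (x0 + z) ⬝ᵥ (x0 + z) = 4 * (x0 ⬝ᵥ x0) - 4 * (x0 ⬝ᵥ (x0 - z)) +
          (x0 - z) ⬝ᵥ (x0 - z) := by
        simp only [dotProduct_add, dotProduct_sub, add_dotProduct, sub_dotProduct,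
          dotProduct_comm z x0]
        ring
      rw [e2, hx1]
      linarith
    have s3 : √((x0 - z) ⬝ᵥ (x0 - z)) * √((x0 + z) ⬝ᵥ (x0 + z)) ≤ 1 / 4 * (9 / 4) :=
      mul_le_mul s1 s2 (Real.sqrt_nonneg _) (by norm_num)
    rw [e] at hb
    have h5 : N - |z ⬝ᵥ S *ᵥ z| ≤ |x0 ⬝ᵥ S *ᵥ x0 - z ⬝ᵥ S *ᵥ z| := abs_sub_abs_le_abs_sub _ _
    nlinarith
  exact (hquad x).trans (mul_le_mul_of_nonneg_right hbound (dotProduct_self_nonneg' x))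

end QuadraticForm

/-! ### From light and heavy pairs to a spectral norm bound -/

section Spectral

variable {n : ℕ}

/-- The strictly upper triangular part. -/
noncomputable def upper (A : Matrix (Fin n) (Fin n) ℝ) (i j : Fin n) : ℝ := if i < j then A i j else 0

/-- The off-diagonal part. -/
noncomputable def offDiag (A : Matrix (Fin n) (Fin n) ℝ) : Matrix (Fin n) (Fin n) ℝ :=
  Matrix.of fun i j => if i = j then 0 else A i j

theorem quad_offDiag {A : Matrix (Fin n) (Fin n) ℝ} (hA : A.IsSymm) (x : Fin n → ℝ) :
    x ⬝ᵥ offDiag A *ᵥ x = 2 * ∑ i, ∑ j, upper A i j * (x i * x j) := by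
  have h1 : x ⬝ᵥ offDiag A *ᵥ x = ∑ i, ∑ j, upper A i j * (x i * x j) +
      ∑ i, ∑ j, upper A j i * (x j * x i) := by
    rw [← Finset.sum_add_distrib]
    refine Finset.sum_congr rfl fun i _ => ?_
    rw [Matrix.mulVec, dotProduct, Finset.mul_sum, ← Finset.sum_add_distrib]
    refine Finset.sum_congr rfl fun j _ => ?_
    rcases lt_trichotomy i j with h | h | h
    · simp [offDiag, upper, h, h.ne, h.not_gt]; ring
    · simp [offDiag, upper, h]
    · simp [offDiag, upper, h, h.ne', h.not_gt, hA.apply i j]; ring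
  rw [h1, two_mul]
  congr 1
  rw [Finset.sum_comm]

theorem offDiag_symm {A : Matrix (Fin n) (Fin n) ℝ} (hA : A.IsSymm) : (offDiag A).IsSymm := by
  ext i j
  by_cases h : i = j
  · simp [offDiag, h]
  · simp [offDiag, h, Ne.symm h, hA.apply i j]

/-- Rounding `2√n x` to integers moves each coordinate of `x` by at most `1/(4√n)`. Integer
coordinates make the union bound a product over coordinates, so no covering number is needed. -/
theorem exists_lattice_approx (hn : 0 < n) {x : Fin n → ℝ} (hx : x ⬝ᵥ x = 1) :
    ∃ w : Fin n → ℤ, (x - fun i => (w i : ℝ) / (2 * √n)) ⬝ᵥ (x - fun i => (w i : ℝ) / (2 * √n)) ≤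
      1 / 16 ∧ ∑ i, (w i : ℝ) ^ 2 ≤ 25 * n / 4 := by
  have hn' : (0 : ℝ) < n := by exact_mod_cast hn
  have hs : 0 < √(n : ℝ) := Real.sqrt_pos.2 hn'
  have hs2 : √(n : ℝ) ^ 2 = n := Real.sq_sqrt hn'.le
  set z : Fin n → ℝ := fun i => (round (2 * √n * x i) : ℝ) / (2 * √n) with hz
  have hdiff : (x - z) ⬝ᵥ (x - z) ≤ 1 / 16 := by
    have h1 : ∀ i, (x - z) i * (x - z) i ≤ 1 / (16 * n) := by
      intro i
      have h2 : (x - z) i = (2 * √n * x i - round (2 * √n * x i)) / (2 * √n) := by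
        simp only [Pi.sub_apply, hz]; field_simp
      have h3 := abs_sub_round (2 * √n * x i)
      have h4 : (2 * √n * x i - round (2 * √n * x i)) ^ 2 ≤ (1 / 2) ^ 2 :=
        sq_le_sq' (abs_le.1 h3).1 (abs_le.1 h3).2
      rw [h2, ← sq, div_pow, mul_pow, hs2, div_le_div_iff₀ (by positivity) (by positivity)]
      nlinarith
    calc (x - z) ⬝ᵥ (x - z) ≤ ∑ _i : Fin n, (1 / (16 * n) : ℝ) :=
          Finset.sum_le_sum fun i _ => h1 i
      _ = 1 / 16 := by simp; field_simp
  refine ⟨fun i => round (2 * √n * x i), hdiff, ?_⟩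
  have h3 := abs_dotProduct_le x (x - z)
  have s1 : √((x - z) ⬝ᵥ (x - z)) ≤ 1 / 4 := by
    rw [Real.sqrt_le_left (by norm_num)]; linarith
  rw [hx, Real.sqrt_one, one_mul] at h3
  have h4 := (abs_le.1 (h3.trans s1)).1
  have e2 : z ⬝ᵥ z = x ⬝ᵥ x - 2 * (x ⬝ᵥ (x - z)) + (x - z) ⬝ᵥ (x - z) := by
    simp only [dotProduct_sub, sub_dotProduct, dotProduct_comm z x]
    ring
  have h5 : z ⬝ᵥ z ≤ 25 / 16 := by rw [e2, hx]; linarith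
  have h6 : ∑ i, ((round (2 * √n * x i) : ℤ) : ℝ) ^ 2 = 4 * n * (z ⬝ᵥ z) := by
    have hdiv : ∀ a b : ℝ, a / (2 * √n) * (b / (2 * √n)) = 1 / (4 * n) * (a * b) := by
      intro a b
      rw [div_mul_div_comm, show 2 * √(n : ℝ) * (2 * √n) = 4 * √(n : ℝ) ^ 2 by ring, hs2]
      ring
    rw [dotProduct, Finset.mul_sum]
    refine Finset.sum_congr rfl fun i _ => ?_
    simp only [hz, hdiv]
    field_simp
  rw [h6]
  nlinarith

/-- The spectral norm bound for a matrix satisfying the degree, discrepancy and light pair bounds. -/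
theorem abs_quad_offDiag_le (hn : 0 < n) {A P : Matrix (Fin n) (Fin n) ℝ} {q : ℝ} {m : ℕ}
    (hA0 : ∀ i j, 0 ≤ A i j) (hA : A.IsSymm) (hP : P.IsSymm)
    (hP0 : ∀ i j, 0 ≤ upper P i j) (hPq : ∀ i j, upper P i j ≤ q)
    (hqD : q * n ≤ (2 ^ m) ^ 2)
    (hdeg : ∀ i, ∑ j, (upper A i j + upper A j i) ≤ 14 * (2 ^ m) ^ 2)
    (hdisc : ∀ a b : ℕ, a < n → b < n → ∀ S T : Finset (Fin n),
      ((a + b + 2 - m : ℕ) : ℝ) * Real.log 2 * ∑ i ∈ S, ∑ j ∈ T, upper A i j ≤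
        q * S.card * T.card * 2 ^ (a + b + 2 - m) +
          4 * (levelEntropy n a S.card + levelEntropy n b T.card))
    (hlight : ∀ w : Fin n → ℤ, ∑ i, (w i : ℝ) ^ 2 ≤ 25 * n / 4 →
      |∑ i, ∑ j, (if |(w i : ℝ) * w j| ≤ 4 * 2 ^ m then (w i : ℝ) * w j else 0) *
        (upper A i j - upper P i j)| ≤ 14 * n * (4 * 2 ^ m)) (x : Fin n → ℝ) :
    |x ⬝ᵥ offDiag (A - P) *ᵥ x| ≤ 6000 * 2 ^ m * (x ⬝ᵥ x) := by
  have hn' : (0 : ℝ) < n := by exact_mod_cast hn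
  have hD : (0 : ℝ) < 2 ^ m := by positivity
  have hup : ∀ i j, upper (A - P) i j = upper A i j - upper P i j := by
    intro i j; unfold upper; split_ifs <;> simp
  have hA0' : ∀ i j, 0 ≤ upper A i j := by
    intro i j; unfold upper; split_ifs; exacts [hA0 i j, le_rfl]
  have hAP : (A - P).IsSymm := hA.sub hP
  have key : ∀ w : Fin n → ℤ, ∑ i, (w i : ℝ) ^ 2 ≤ 25 * n / 4 →
      |∑ i, ∑ j, upper (A - P) i j * ((w i : ℝ) * w j)| ≤ 5170 * n * 2 ^ m := by
    intro w hw
    have h1 := hlight w hw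
    -- With this scaling `∑ y² ≤ 25n/16 ≤ 2n`, and the light threshold `|w_i w_j| ≤ 4 · 2^m` becomes
    -- `y_i y_j ≤ 2^m`.
    set y : Fin n → ℝ := fun i => |(w i : ℝ)| / 2 with hy
    have hyy : ∑ i, y i ^ 2 ≤ 2 * n := by
      have : ∑ i, y i ^ 2 = (∑ i, (w i : ℝ) ^ 2) / 4 := by
        rw [Finset.sum_div]
        refine Finset.sum_congr rfl fun i _ => ?_
        simp only [hy, div_pow, sq_abs]; norm_num
      rw [this]; linarith
    have h2 := sum_heavy_le hA0' (fun i => by positivity) hyy hqD hdeg hdisc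
    have habs : ∀ i j, |(w i : ℝ) * w j| = 4 * (y i * y j) := by
      intro i j; simp only [hy, abs_mul]; ring
    have h3 : |∑ i, ∑ j, (if |(w i : ℝ) * w j| ≤ 4 * 2 ^ m then 0 else (w i : ℝ) * w j) *
        (upper A i j - upper P i j)| ≤ 5114 * n * 2 ^ m := by
      have h4 : ∀ i j, |(if |(w i : ℝ) * w j| ≤ 4 * 2 ^ m then 0 else (w i : ℝ) * w j) *
          (upper A i j - upper P i j)| ≤
          4 * (if 2 ^ m < y i * y j then upper A i j * (y i * y j) else 0) +
            q / (4 * 2 ^ m) * ((w i : ℝ) ^ 2 * (w j : ℝ) ^ 2) := by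
        intro i j
        have hq0 : 0 ≤ q := (hP0 i j).trans (hPq i j)
        by_cases hc : |(w i : ℝ) * w j| ≤ 4 * 2 ^ m
        · rw [if_pos hc, zero_mul, abs_zero]
          have := hA0' i j
          have : 0 ≤ y i := by positivity
          have : 0 ≤ y j := by positivity
          split_ifs <;> positivity
        · have hc' := hc
          rw [habs] at hc'
          rw [if_neg hc, if_pos (by linarith), abs_mul]
          have h5 : |upper A i j - upper P i j| ≤ upper A i j + q := by
            rw [abs_le]
            constructor <;> linarith [hA0' i j, hP0 i j, hPq i j]
          -- The expected part of a heavy pair needs no probability: `|w_i w_j|` exceeds `4 · 2^m`,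
          -- so it is at most its own square over `4 · 2^m`.
          have h6 : q * |(w i : ℝ) * w j| ≤ q / (4 * 2 ^ m) * ((w i : ℝ) ^ 2 * (w j : ℝ) ^ 2) := by
            rw [← mul_pow, ← sq_abs ((w i : ℝ) * w j), div_mul_eq_mul_div,
              le_div_iff₀ (by positivity)]
            push Not at hc
            have : |(w i : ℝ) * w j| * (4 * 2 ^ m) ≤ |(w i : ℝ) * w j| ^ 2 := by
              rw [sq]; exact mul_le_mul_of_nonneg_left hc.le (abs_nonneg _)
            nlinarith
          calc |(w i : ℝ) * w j| * |upper A i j - upper P i j|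
              ≤ |(w i : ℝ) * w j| * (upper A i j + q) :=
                mul_le_mul_of_nonneg_left h5 (abs_nonneg _)
            _ = 4 * (upper A i j * (y i * y j)) + q * |(w i : ℝ) * w j| := by
                rw [mul_add, habs]; ring
            _ ≤ _ := by linarith
      refine (Finset.abs_sum_le_sum_abs _ _).trans ((Finset.sum_le_sum fun i _ =>
        (Finset.abs_sum_le_sum_abs _ _).trans (Finset.sum_le_sum fun j _ => h4 i j)).trans ?_)
      simp only [Finset.sum_add_distrib, ← Finset.mul_sum, ← Finset.sum_mul]
      set W := ∑ i, (w i : ℝ) ^ 2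
      have hW0 : 0 ≤ W := Finset.sum_nonneg fun i _ => sq_nonneg _
      have h7 : W * W ≤ (25 * n / 4) * (25 * n / 4) := mul_le_mul hw hw hW0 (by positivity)
      have hq0 : 0 ≤ q := (hP0 ⟨0, hn⟩ ⟨0, hn⟩).trans (hPq _ _)
      have h8 : q / (4 * 2 ^ m) * (W * W) ≤ 10 * n * 2 ^ m := by
        rw [div_mul_eq_mul_div, div_le_iff₀ (by positivity)]
        calc q * (W * W) ≤ q * ((25 * n / 4) * (25 * n / 4)) := by gcongr
          _ = (q * n) * (625 / 16 * n) := by ring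
          _ ≤ (2 ^ m) ^ 2 * (625 / 16 * n) := by gcongr
          _ ≤ _ := by nlinarith [sq_nonneg ((2 : ℝ) ^ m), mul_nonneg hn'.le (sq_nonneg ((2 : ℝ) ^ m))]
      linarith
    have h9 : ∑ i, ∑ j, upper (A - P) i j * ((w i : ℝ) * w j) =
        ∑ i, ∑ j, (if |(w i : ℝ) * w j| ≤ 4 * 2 ^ m then (w i : ℝ) * w j else 0) *
        (upper A i j - upper P i j) +
        ∑ i, ∑ j, (if |(w i : ℝ) * w j| ≤ 4 * 2 ^ m then 0 else (w i : ℝ) * w j) *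
        (upper A i j - upper P i j) := by
      simp only [← Finset.sum_add_distrib]
      refine Finset.sum_congr rfl fun i _ => Finset.sum_congr rfl fun j _ => ?_
      rw [hup]
      split_ifs <;> ring
    rw [h9]
    refine (abs_add_le _ _).trans ?_
    linarith
  refine (abs_quad_le_of_net (offDiag_symm hAP) (c := 2585 * 2 ^ m) ?_ x).trans ?_
  · intro x hx
    obtain ⟨w, hw1, hw2⟩ := exists_lattice_approx hn hx
    refine ⟨_, hw1, ?_⟩
    have h1 := key w hw2
    have hs2 : √(n : ℝ) ^ 2 = n := Real.sq_sqrt hn'.le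
    have hs : 0 < √(n : ℝ) := Real.sqrt_pos.2 hn'
    have hdiv : ∀ a b : ℝ, a / (2 * √n) * (b / (2 * √n)) = 1 / (4 * n) * (a * b) := by
      intro a b
      rw [div_mul_div_comm, show 2 * √(n : ℝ) * (2 * √n) = 4 * √(n : ℝ) ^ 2 by ring, hs2]
      ring
    have h2 : ∑ i, ∑ j, upper (A - P) i j * ((w i : ℝ) / (2 * √n) * ((w j : ℝ) / (2 * √n))) =
        1 / (4 * n) * ∑ i, ∑ j, upper (A - P) i j * ((w i : ℝ) * w j) := by
      simp only [Finset.mul_sum]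
      refine Finset.sum_congr rfl fun i _ => Finset.sum_congr rfl fun j _ => ?_
      rw [hdiv]
      ring
    rw [quad_offDiag hAP, h2, abs_mul, abs_mul, abs_of_pos (by positivity : (0 : ℝ) < 1 / (4 * n)),
      abs_two]
    calc 2 * (1 / (4 * n) * |∑ i, ∑ j, upper (A - P) i j * ((w i : ℝ) * w j)|)
        ≤ 2 * (1 / (4 * n) * (5170 * n * 2 ^ m)) := by gcongr
      -- The net lemma then gives `16/7 · 2585 < 6000`.
      _ = 2585 * 2 ^ m := by field_simp; norm_num
  · have := dotProduct_self_nonneg' x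
    have : 0 ≤ 2 ^ m * (x ⬝ᵥ x) := by positivity
    nlinarith

end Spectral

/-! ### The random events: degrees, discrepancy, light pairs, covariate -/

section Events

variable {n : ℕ} {Ω : Type*} [MeasurableSpace Ω] {μ : Measure Ω}
  {Θ : Matrix (Fin n) (Fin n) ℝ} {A : Ω → Matrix (Fin n) (Fin n) ℝ}

theorem sum_pairs (f : Fin n → Fin n → ℝ) :
    ∑ p : {p : Fin n × Fin n // p.1 < p.2}, f p.1.1 p.1.2 =
      ∑ i, ∑ j, if i < j then f i j else 0 := by
  rw [← Fintype.sum_prod_type' (f := fun i j => if i < j then f i j else 0), ← Finset.sum_filter]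
  exact (Finset.sum_subtype (p := fun p : Fin n × Fin n => p.1 < p.2) _ (by simp)
    (fun p : Fin n × Fin n => f p.1 p.2)).symm

theorem sum_block (M : Matrix (Fin n) (Fin n) ℝ) (S T : Finset (Fin n)) :
    ∑ p ∈ Finset.univ.filter
      (fun p : {p : Fin n × Fin n // p.1 < p.2} => p.1.1 ∈ S ∧ p.1.2 ∈ T), M p.1.1 p.1.2 =
      ∑ i ∈ S, ∑ j ∈ T, upper M i j := by
  rw [Finset.sum_filter, sum_pairs (fun i j => if i ∈ S ∧ j ∈ T then M i j else 0),
    ← Finset.sum_filter_add_sum_filter_not Finset.univ (· ∈ S), Finset.filter_univ_mem,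
    Finset.sum_eq_zero (s := Finset.univ.filter (· ∉ S)), add_zero]
  · refine Finset.sum_congr rfl fun i hi => ?_
    rw [← Finset.sum_filter_add_sum_filter_not Finset.univ (· ∈ T), Finset.filter_univ_mem,
      Finset.sum_eq_zero (s := Finset.univ.filter (· ∉ T)), add_zero]
    · refine Finset.sum_congr rfl fun j hj => ?_
      simp [upper, hi, hj]
    · intro j hj
      simp [(Finset.mem_filter.1 hj).2]
  · intro i hi
    simp [(Finset.mem_filter.1 hi).2]

theorem card_block_le (S T : Finset (Fin n)) :
    ((Finset.univ.filter
      (fun p : {p : Fin n × Fin n // p.1 < p.2} => p.1.1 ∈ S ∧ p.1.2 ∈ T)).card : ℝ) ≤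
      S.card * T.card := by
  rw [← Nat.cast_mul, ← Finset.card_product]
  exact_mod_cast Finset.card_le_card_of_injOn
    (fun p : {p : Fin n × Fin n // p.1 < p.2} => p.1)
    (fun p hp => by simpa using hp) (fun p _ q _ h => Subtype.ext h)

theorem IsNetwork.prob_eq (h : IsNetwork μ Θ A) (p : {p : Fin n × Fin n // p.1 < p.2}) :
    μ.real {ω | A ω p.1.1 p.1.2 = 1} = Real.sigmoid (Θ p.1.1 p.1.2) :=
  h.bernoulli _ _ p.2

theorem IsNetwork.sum_centered (h : IsNetwork μ Θ A) (c : Fin n → Fin n → ℝ) (ω : Ω) :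
    ∑ p : {p : Fin n × Fin n // p.1 < p.2}, c p.1.1 p.1.2 *
        (A ω p.1.1 p.1.2 - μ.real {ω | A ω p.1.1 p.1.2 = 1}) =
      ∑ i, ∑ j, c i j * (upper (A ω) i j - upper (sigm Θ) i j) := by
  have h1 : ∀ p : {p : Fin n × Fin n // p.1 < p.2}, c p.1.1 p.1.2 *
        (A ω p.1.1 p.1.2 - μ.real {ω | A ω p.1.1 p.1.2 = 1}) =
      c p.1.1 p.1.2 * (A ω p.1.1 p.1.2 - sigm Θ p.1.1 p.1.2) := by
    intro p; rw [h.prob_eq p]; rfl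
  rw [Finset.sum_congr rfl fun p _ => h1 p, sum_pairs fun i j => c i j * (A ω i j - sigm Θ i j)]
  refine Finset.sum_congr rfl fun i _ => Finset.sum_congr rfl fun j _ => ?_
  unfold upper
  split_ifs <;> simp

variable [IsProbabilityMeasure μ] {q : ℝ}

theorem prob_block_le (h : IsNetwork μ Θ A) (hq0 : 0 ≤ q)
    (hq : ∀ i j, i ≠ j → Real.sigmoid (Θ i j) ≤ q)
    (S T : Finset (Fin n)) {t : ℝ} (ht : 0 ≤ t) (s : ℝ) :
    μ.real {ω | s ≤ t * ∑ i ∈ S, ∑ j ∈ T, upper (A ω) i j} ≤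
      Real.exp (-s + q * (S.card * T.card) * (Real.exp t - 1)) := by
  have h1 := chernoff_indicator h.indep (fun p => h.measurable _ _)
    (fun p ω => h.zero_or_one ω _ _) (q := q)
    (fun p => (h.prob_eq p).le.trans (hq _ _ p.2.ne))
    (Finset.univ.filter (fun p => p.1.1 ∈ S ∧ p.1.2 ∈ T)) ht s
  simp only [sum_block] at h1
  refine h1.trans (Real.exp_le_exp.2 ?_)
  have h2 : 0 ≤ Real.exp t - 1 := by linarith [Real.one_le_exp ht]
  have h3 := mul_le_mul_of_nonneg_left (card_block_le S T) hq0
  nlinarith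

theorem exp_one_sub_one_le : Real.exp 1 - 1 ≤ 2 := by linarith [Real.exp_one_lt_d9]

/-- The degree of a vertex splits into its row and its column in the upper triangle, each with mean
at most `d`. Chernoff with `t = 1` at level `7d` has exponent at most `-7d + 2d ≤ -5 log n`, and
`2n` such events are united. -/
theorem prob_degree (h : IsNetwork μ Θ A) (hn : 2 ≤ n) (hq0 : 0 ≤ q)
    (hq : ∀ i j, i ≠ j → Real.sigmoid (Θ i j) ≤ q) (hlog : Real.log n ≤ q * n)
    {d : ℝ} (hd : q * n ≤ d) :
    μ.real {ω | ∃ i, 14 * d < ∑ j, (upper (A ω) i j + upper (A ω) j i)} ≤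
      Real.exp (-3 * Real.log n) := by
  have hn' : (0 : ℝ) < n := by exact_mod_cast (by omega : 0 < n)
  have hb : ∀ S T : Finset (Fin n), (S.card * T.card : ℝ) = n →
      μ.real {ω | 7 * d ≤ 1 * ∑ i ∈ S, ∑ j ∈ T, upper (A ω) i j} ≤
        Real.exp (-5 * Real.log n) := by
    intro S T hST
    refine (prob_block_le h hq0 hq S T zero_le_one _).trans (Real.exp_le_exp.2 ?_)
    rw [hST]
    have : q * n * (Real.exp 1 - 1) ≤ q * n * 2 :=
      mul_le_mul_of_nonneg_left exp_one_sub_one_le (by positivity)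
    linarith
  have hsub : {ω | ∃ i, 14 * d < ∑ j, (upper (A ω) i j + upper (A ω) j i)} ⊆
      ⋃ i ∈ (Finset.univ : Finset (Fin n)),
        ({ω | 7 * d ≤ 1 * ∑ k ∈ {i}, ∑ j ∈ Finset.univ, upper (A ω) k j} ∪
        {ω | 7 * d ≤ 1 * ∑ k ∈ Finset.univ, ∑ j ∈ {i}, upper (A ω) k j}) := by
    rintro ω ⟨i, hi⟩
    rw [Finset.sum_add_distrib] at hi
    simp only [Set.mem_iUnion, Finset.mem_univ, exists_true_left, Set.mem_union,
      Set.mem_ofPred_eq, Finset.sum_singleton, one_mul]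
    refine ⟨i, ?_⟩
    by_contra! hc
    linarith [hc.1, hc.2]
  refine (measureReal_mono hsub (measure_ne_top _ _)).trans ((measureReal_biUnion_finset_le _ _).trans ?_)
  have h1 : ∀ i ∈ (Finset.univ : Finset (Fin n)),
      μ.real ({ω | 7 * d ≤ 1 * ∑ k ∈ {i}, ∑ j ∈ Finset.univ, upper (A ω) k j} ∪
        {ω | 7 * d ≤ 1 * ∑ k ∈ Finset.univ, ∑ j ∈ {i}, upper (A ω) k j}) ≤
        2 * Real.exp (-5 * Real.log n) := by
    intro i _
    refine (measureReal_union_le _ _).trans ?_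
    have h1 := hb {i} Finset.univ (by simp)
    have h2 := hb Finset.univ {i} (by simp)
    linarith
  refine (Finset.sum_le_sum h1).trans ?_
  simp only [Finset.sum_const, Finset.card_univ, Fintype.card_fin, nsmul_eq_mul]
  have h2 : Real.exp (-5 * Real.log n) =
      Real.exp (-3 * Real.log n) * (Real.exp (-Real.log n) * Real.exp (-Real.log n)) := by
    rw [← Real.exp_add, ← Real.exp_add]; ring_nf
  rw [h2, Real.exp_neg (Real.log n), Real.exp_log hn']
  have h3 : (n : ℝ) * (2 * (Real.exp (-3 * Real.log n) * ((n : ℝ)⁻¹ * (n : ℝ)⁻¹))) =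
      Real.exp (-3 * Real.log n) * (2 / n) := by field_simp
  rw [h3]
  have h4 : (2 : ℝ) / n ≤ 1 := by
    rw [div_le_one hn']; exact_mod_cast hn
  nlinarith [Real.exp_pos (-3 * Real.log n)]

/-- This is `log x ≤ x - 1` at `x = n e^{-3a}`. It extracts powers of `n` from the entropy of a
nonempty set. -/
theorem one_add_log_le_levelEntropy (hn : 0 < n) (a : ℕ) {s : ℝ} (hs : 1 ≤ s) :
    1 + Real.log n ≤ levelEntropy n a s := by
  have hn' : (0 : ℝ) < n := by exact_mod_cast hn
  have h1 := Real.log_le_sub_one_of_pos (by positivity : 0 < n * Real.exp (-(3 * a)))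
  rw [Real.log_mul hn'.ne' (Real.exp_pos _).ne', Real.log_exp] at h1
  unfold levelEntropy
  have h2 : (3 * a : ℝ) * 1 ≤ 3 * a * s := mul_le_mul_of_nonneg_left hs (by positivity)
  linarith

/-- By the binomial expansion the sum is `(1 + e^{-3a})^n exp(-n e^{-3a})`. The second summand of
`levelEntropy` is there to make this a sub-probability on vertex sets. -/
theorem sum_exp_neg_levelEntropy_le (n a : ℕ) :
    ∑ S : Finset (Fin n), Real.exp (-levelEntropy n a S.card) ≤ 1 := by
  have h1 : ∀ S : Finset (Fin n), Real.exp (-levelEntropy n a S.card) =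
      Real.exp (-(n * Real.exp (-(3 * a)))) * ∏ _i ∈ S, Real.exp (-(3 * a)) := by
    intro S
    rw [Finset.prod_const, ← Real.exp_nat_mul, ← Real.exp_add]
    unfold levelEntropy
    congr 1; ring
  simp only [h1, ← Finset.mul_sum]
  have h2 := Finset.prod_one_add (f := fun _ : Fin n => Real.exp (-(3 * a))) Finset.univ
  rw [Finset.powerset_univ] at h2
  rw [← h2, Finset.prod_const, Finset.card_univ, Fintype.card_fin]
  calc _ ≤ Real.exp (-(n * Real.exp (-(3 * a)))) * Real.exp (Real.exp (-(3 * a))) ^ n := by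
        gcongr
        linarith [Real.add_one_le_exp (Real.exp (-(3 * (a : ℝ))))]
    _ = 1 := by
        rw [← Real.exp_nat_mul, ← Real.exp_add]; simp

/-- Chernoff with `e^t = 2^(a+b+2-m)`. Of the four copies of the entropies, one pays for the union
over `S` and `T`; the other three yield `e^{-6(1 + log n)}`, which absorbs the `n²` pairs of levels.
-/
theorem prob_discrepancy (h : IsNetwork μ Θ A) (hn : 2 ≤ n) (hq0 : 0 ≤ q)
    (hq : ∀ i j, i ≠ j → Real.sigmoid (Θ i j) ≤ q) (m : ℕ) :
    μ.real {ω | ¬ ∀ a b : ℕ, a < n → b < n → ∀ S T : Finset (Fin n),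
      ((a + b + 2 - m : ℕ) : ℝ) * Real.log 2 * ∑ i ∈ S, ∑ j ∈ T, upper (A ω) i j ≤
        q * S.card * T.card * 2 ^ (a + b + 2 - m) +
          4 * (levelEntropy n a S.card + levelEntropy n b T.card)} ≤
      Real.exp (-3 * Real.log n) := by
  have hn' : (0 : ℝ) < n := by exact_mod_cast (by omega : 0 < n)
  set bad : ℕ → ℕ → Finset (Fin n) → Finset (Fin n) → Set Ω := fun a b S T =>
    {ω | q * S.card * T.card * 2 ^ (a + b + 2 - m) +
          4 * (levelEntropy n a S.card + levelEntropy n b T.card) <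
      ((a + b + 2 - m : ℕ) : ℝ) * Real.log 2 * ∑ i ∈ S, ∑ j ∈ T, upper (A ω) i j}
  have hsub : {ω | ¬ ∀ a b : ℕ, a < n → b < n → ∀ S T : Finset (Fin n),
      ((a + b + 2 - m : ℕ) : ℝ) * Real.log 2 * ∑ i ∈ S, ∑ j ∈ T, upper (A ω) i j ≤
        q * S.card * T.card * 2 ^ (a + b + 2 - m) +
          4 * (levelEntropy n a S.card + levelEntropy n b T.card)} ⊆
      ⋃ a ∈ Finset.range n, ⋃ b ∈ Finset.range n, ⋃ S ∈ (Finset.univ : Finset (Finset (Fin n))),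
        ⋃ T ∈ (Finset.univ : Finset (Finset (Fin n))), bad a b S T := by
    intro ω hω
    simp only [Set.mem_ofPred_eq] at hω
    push Not at hω
    obtain ⟨a, b, ha, hb, S, T, hST⟩ := hω
    simp only [Set.mem_iUnion, Finset.mem_univ, exists_true_left, Finset.mem_range]
    exact ⟨a, ha, b, hb, S, T, hST⟩
  have hbad : ∀ a b S T, μ.real (bad a b S T) ≤ Real.exp (-6 * (1 + Real.log n)) *
      (Real.exp (-levelEntropy n a S.card) * Real.exp (-levelEntropy n b T.card)) := by
    intro a b S T
    have hH1 := levelEntropy_nonneg n a (s := S.card) (by positivity)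
    have hH2 := levelEntropy_nonneg n b (s := T.card) (by positivity)
    -- Empty sets are treated apart: the logarithmic lower bound for the entropy needs at least one
    -- vertex, but an empty block has no edges.
    rcases S.eq_empty_or_nonempty with hS | hS
    · have : bad a b S T = ∅ := by
        ext ω
        simp only [bad, hS, Set.mem_ofPred_eq, Set.mem_empty_iff_false, iff_false, not_lt,
          Finset.sum_empty, mul_zero]
        rw [hS] at hH1
        positivity
      rw [this, measureReal_empty]; positivity
    rcases T.eq_empty_or_nonempty with hT | hT
    · have : bad a b S T = ∅ := by
        ext ω
        simp only [bad, hT, Set.mem_ofPred_eq, Set.mem_empty_iff_false, iff_false, not_lt,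
          Finset.sum_empty, Finset.sum_const_zero, mul_zero]
        rw [hT] at hH2
        positivity
      rw [this, measureReal_empty]; positivity
    have hl : (0 : ℝ) ≤ ((a + b + 2 - m : ℕ) : ℝ) * Real.log 2 := by positivity
    have h1 := prob_block_le h hq0 hq S T hl (q * S.card * T.card * 2 ^ (a + b + 2 - m) +
          4 * (levelEntropy n a S.card + levelEntropy n b T.card))
    refine le_trans (measureReal_mono (fun ω hω => ?_) (measure_ne_top _ _)) (h1.trans ?_)
    · simp only [bad, Set.mem_ofPred_eq] at hω ⊢
      exact hω.le
    rw [← Real.exp_add, ← Real.exp_add]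
    refine Real.exp_le_exp.2 ?_
    rw [Real.exp_nat_mul, Real.exp_log two_pos]
    have h2 := one_add_log_le_levelEntropy (n := n) (by omega) a (s := S.card)
      (by exact_mod_cast hS.card_pos)
    have h3 := one_add_log_le_levelEntropy (n := n) (by omega) b (s := T.card)
      (by exact_mod_cast hT.card_pos)
    have h4 : 0 ≤ q * (S.card * T.card) := by positivity
    nlinarith
  refine (measureReal_mono hsub (measure_ne_top _ _)).trans ?_
  have hab : ∀ a ∈ Finset.range n, ∀ b ∈ Finset.range n,
      μ.real (⋃ S ∈ (Finset.univ : Finset (Finset (Fin n))),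
        ⋃ T ∈ (Finset.univ : Finset (Finset (Fin n))), bad a b S T) ≤
        Real.exp (-6 * (1 + Real.log n)) := by
    intro a _ b _
    refine (measureReal_biUnion_finset_le _ _).trans ((Finset.sum_le_sum fun S _ =>
      (measureReal_biUnion_finset_le _ _).trans (Finset.sum_le_sum fun T _ =>
        hbad a b S T)).trans ?_)
    simp only [← Finset.mul_sum, ← Finset.sum_mul]
    have h1 := sum_exp_neg_levelEntropy_le n a
    have h2 := sum_exp_neg_levelEntropy_le n b
    have h0 : 0 ≤ ∑ S : Finset (Fin n), Real.exp (-levelEntropy n b S.card) := by positivity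
    have h3 := mul_le_one₀ h1 h0 h2
    have h4 := (Real.exp_pos (-6 * (1 + Real.log n))).le
    exact mul_le_of_le_one_right h4 h3
  refine (measureReal_biUnion_finset_le _ _).trans ((Finset.sum_le_sum fun a ha =>
    (measureReal_biUnion_finset_le _ _).trans (Finset.sum_le_sum fun b hb => hab a ha b hb)).trans ?_)
  simp only [Finset.sum_const, Finset.card_range, nsmul_eq_mul]
  have h1 : (n : ℝ) = Real.exp (Real.log n) := (Real.exp_log hn').symm
  have h2 : 0 ≤ Real.log n := Real.log_natCast_nonneg n
  calc (n : ℝ) * (n * Real.exp (-6 * (1 + Real.log n)))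
      = Real.exp (Real.log n + (Real.log n + -6 * (1 + Real.log n))) := by
        rw [Real.exp_add, Real.exp_add, ← h1]
    _ ≤ _ := Real.exp_le_exp.2 (by linarith)

theorem sum_exp_neg_sq_le (N : ℕ) :
    ∑ k ∈ Finset.Icc (-(N : ℤ)) N, Real.exp (-(k : ℝ) ^ 2) ≤ 3 := by
  have h1 : ∀ k : ℤ, Real.exp (-(k : ℝ) ^ 2) ≤ (1 / 2) ^ k.natAbs := by
    intro k
    have h2 : (k.natAbs : ℝ) ≤ (k : ℝ) ^ 2 := by
      have h3 : (k.natAbs : ℝ) ≤ (k.natAbs : ℝ) ^ 2 := by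
        exact_mod_cast Nat.le_self_pow two_ne_zero k.natAbs
      have h4 : (k.natAbs : ℝ) = |(k : ℝ)| := by rw [Nat.cast_natAbs, Int.cast_abs]
      rw [← sq_abs, ← h4]
      exact h3
    calc Real.exp (-(k : ℝ) ^ 2) ≤ Real.exp (k.natAbs * (-1)) := Real.exp_le_exp.2 (by linarith)
      _ = Real.exp (-1) ^ k.natAbs := Real.exp_nat_mul _ _
      _ ≤ _ := by
        refine pow_le_pow_left₀ (Real.exp_pos _).le ?_ _
        rw [Real.exp_neg, one_div]
        exact inv_anti₀ two_pos (by linarith [Real.add_one_le_exp (1 : ℝ)])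
  refine (Finset.sum_le_sum fun k _ => h1 k).trans ?_
  have h3 : ∀ N : ℕ, ∑ k ∈ Finset.Icc (-(N : ℤ)) N, ((1 : ℝ) / 2) ^ k.natAbs =
      3 - 2 * (1 / 2) ^ N := by
    intro N
    induction N with
    | zero => norm_num
    | succ N ih =>
      have e : Finset.Icc (-((N + 1 : ℕ) : ℤ)) ((N + 1 : ℕ) : ℤ) =
          insert ((N + 1 : ℕ) : ℤ) (insert (-((N + 1 : ℕ) : ℤ)) (Finset.Icc (-(N : ℤ)) N)) := by
        ext k; simp only [Finset.mem_Icc, Finset.mem_insert]; omega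
      rw [e, Finset.sum_insert, Finset.sum_insert, ih]
      · simp only [Int.natAbs_neg, Int.natAbs_natCast, pow_succ]; ring
      · simp only [Finset.mem_Icc]; omega
      · simp only [Finset.mem_Icc, Finset.mem_insert]; omega
  rw [h3]
  have : (0 : ℝ) ≤ 2 * (1 / 2) ^ N := by positivity
  linarith

/-- Scaled by `4 · 2^m`, the coefficients are at most `1` and `q ∑ c² ≤ 3n`, so one lattice point
fails with probability at most `2 e^{-11n}`. Since `∑ w² ≤ 25n/4`, this is at most `2 e^{-11n +
25n/4} ∏ e^{-w_i²}`, and the sum over all `w` factorizes into `n` sums that are at most `3 ≤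
e^{5/4}`. -/
theorem prob_light (h : IsNetwork μ Θ A) (hn : 2 ≤ n) (hq0 : 0 ≤ q)
    (hq : ∀ i j, i ≠ j → Real.sigmoid (Θ i j) ≤ q) {m : ℕ} (hqD : q * n ≤ (2 ^ m) ^ 2) :
    μ.real {ω | ¬ ∀ w : Fin n → ℤ, ∑ i, (w i : ℝ) ^ 2 ≤ 25 * n / 4 →
      |∑ i, ∑ j, (if |(w i : ℝ) * w j| ≤ 4 * 2 ^ m then (w i : ℝ) * w j else 0) *
        (upper (A ω) i j - upper (sigm Θ) i j)| ≤ 14 * n * (4 * 2 ^ m)} ≤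
      Real.exp (-3 * Real.log n) := by
  have hn' : (2 : ℝ) ≤ n := by exact_mod_cast hn
  have hD : (0 : ℝ) < 4 * 2 ^ m := by positivity
  -- The box of side `3n` only makes the union finite; it contains every `w` with `∑ w² ≤ 25n/4`.
  set F : Finset (Fin n → ℤ) := Fintype.piFinset fun _ => Finset.Icc (-((3 * n : ℕ) : ℤ)) (3 * n : ℕ)
  set bad : (Fin n → ℤ) → Set Ω := fun w => {ω | ∑ i, (w i : ℝ) ^ 2 ≤ 25 * n / 4 ∧
    14 * n * (4 * 2 ^ m) < |∑ i, ∑ j, (if |(w i : ℝ) * w j| ≤ 4 * 2 ^ m then (w i : ℝ) * w j else 0) *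
        (upper (A ω) i j - upper (sigm Θ) i j)|} with hbad
  have hsub : {ω | ¬ ∀ w : Fin n → ℤ, ∑ i, (w i : ℝ) ^ 2 ≤ 25 * n / 4 →
      |∑ i, ∑ j, (if |(w i : ℝ) * w j| ≤ 4 * 2 ^ m then (w i : ℝ) * w j else 0) *
        (upper (A ω) i j - upper (sigm Θ) i j)| ≤ 14 * n * (4 * 2 ^ m)} ⊆ ⋃ w ∈ F, bad w := by
    intro ω hω
    simp only [Set.mem_ofPred_eq] at hω
    push Not at hω
    obtain ⟨w, hw1, hw2⟩ := hω
    simp only [Set.mem_iUnion]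
    refine ⟨w, ?_, hw1, hw2⟩
    rw [Fintype.mem_piFinset]
    intro i
    have h1 : (w i : ℝ) ^ 2 ≤ 25 * n / 4 :=
      (Finset.single_le_sum (fun i _ => sq_nonneg ((w i : ℝ))) (Finset.mem_univ i)).trans hw1
    have h2 : |(w i : ℝ)| ≤ 3 * n := abs_le_of_sq_le_sq (by nlinarith) (by positivity)
    have h3 := abs_le.1 h2
    rw [Finset.mem_Icc]
    constructor
    · have := h3.1; push_cast; exact_mod_cast this
    · have := h3.2; push_cast; exact_mod_cast this
  have hprob : ∀ w, μ.real (bad w) ≤ 2 * Real.exp (-11 * n + 25 * n / 4) *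
      ∏ i, Real.exp (-(w i : ℝ) ^ 2) := by
    intro w
    by_cases hw : ∑ i, (w i : ℝ) ^ 2 ≤ 25 * n / 4
    · set c : Fin n → Fin n → ℝ := fun i j =>
        (if |(w i : ℝ) * w j| ≤ 4 * 2 ^ m then (w i : ℝ) * w j else 0) / (4 * 2 ^ m)
      have hc : ∀ i j, |c i j| ≤ 1 := by
        intro i j
        simp only [c]
        rw [abs_div, abs_of_pos hD, div_le_one hD]
        split_ifs with hh
        · exact hh
        · simp
      have h1 := chernoff_centered_abs h.indep (fun p => h.measurable _ _)
        (fun p ω => h.zero_or_one ω _ _) (q := q)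
        (fun p => (h.prob_eq p).le.trans (hq _ _ p.2.ne))
        (fun p => c p.1.1 p.1.2) (fun p => hc _ _) (14 * n)
      simp only [h.sum_centered c] at h1
      have hsub2 : bad w ⊆ {ω | 14 * n ≤ |∑ i, ∑ j, c i j *
          (upper (A ω) i j - upper (sigm Θ) i j)|} := by
        rintro ω ⟨_, hω⟩
        have e : ∑ i, ∑ j, c i j * (upper (A ω) i j - upper (sigm Θ) i j) =
            (∑ i, ∑ j, (if |(w i : ℝ) * w j| ≤ 4 * 2 ^ m then (w i : ℝ) * w j else 0) *
              (upper (A ω) i j - upper (sigm Θ) i j)) / (4 * 2 ^ m) := by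
          simp only [Finset.sum_div, c]
          refine Finset.sum_congr rfl fun i _ => Finset.sum_congr rfl fun j _ => ?_
          ring
        rw [Set.mem_ofPred_eq, e, abs_div, abs_of_pos hD, le_div_iff₀ hD]
        exact hω.le
      refine (measureReal_mono hsub2 (measure_ne_top _ _)).trans (h1.trans ?_)
      have h2 : q * ∑ p : {p : Fin n × Fin n // p.1 < p.2}, c p.1.1 p.1.2 ^ 2 ≤ 3 * n := by
        have h3 : ∑ p : {p : Fin n × Fin n // p.1 < p.2}, c p.1.1 p.1.2 ^ 2 ≤
            (25 * n / 4) ^ 2 / (4 * 2 ^ m) ^ 2 := by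
          rw [sum_pairs fun i j => c i j ^ 2]
          have h4 : ∀ i j, (if i < j then c i j ^ 2 else 0) ≤
              (w i : ℝ) ^ 2 * (w j : ℝ) ^ 2 / (4 * 2 ^ m) ^ 2 := by
            intro i j
            simp only [c]
            split_ifs
            · rw [div_pow, mul_pow]
            · simp only [zero_div, ne_eq, OfNat.ofNat_ne_zero, not_false_eq_true, zero_pow]
              positivity
            · positivity
          refine (Finset.sum_le_sum fun i _ => Finset.sum_le_sum fun j _ => h4 i j).trans ?_
          simp only [← Finset.sum_div, ← Finset.mul_sum, ← Finset.sum_mul]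
          have h5 : 0 ≤ ∑ i, (w i : ℝ) ^ 2 := Finset.sum_nonneg fun i _ => sq_nonneg _
          gcongr
          rw [sq]
          exact mul_le_mul hw hw h5 (by positivity)
        calc q * ∑ p : {p : Fin n × Fin n // p.1 < p.2}, c p.1.1 p.1.2 ^ 2
            ≤ q * ((25 * n / 4) ^ 2 / (4 * 2 ^ m) ^ 2) := mul_le_mul_of_nonneg_left h3 hq0
          _ = (q * n) * (625 / 256 * n) / (2 ^ m) ^ 2 := by rw [mul_pow 4]; ring
          _ ≤ (2 ^ m) ^ 2 * (625 / 256 * n) / (2 ^ m) ^ 2 := by gcongr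
          _ = 625 / 256 * n := by field_simp
          _ ≤ 3 * n := by nlinarith
      rw [← Real.exp_sum, mul_assoc, ← Real.exp_add]
      refine mul_le_mul_of_nonneg_left (Real.exp_le_exp.2 ?_) two_pos.le
      rw [Finset.sum_neg_distrib]
      linarith
    · have : bad w = ∅ := by
        ext ω
        simp only [hbad, Set.mem_ofPred_eq, Set.mem_empty_iff_false, iff_false]
        exact fun hh => hw hh.1
      rw [this, measureReal_empty]; positivity
  refine (measureReal_mono hsub (measure_ne_top _ _)).trans
    ((measureReal_biUnion_finset_le _ _).trans ((Finset.sum_le_sum fun w _ => hprob w).trans ?_))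
  rw [← Finset.mul_sum, ← Finset.prod_univ_sum
    (fun _ : Fin n => Finset.Icc (-((3 * n : ℕ) : ℤ)) (3 * n : ℕ)) fun _ k => Real.exp (-(k : ℝ) ^ 2),
    Finset.prod_const, Finset.card_univ, Fintype.card_fin]
  have h3 : (∑ k ∈ Finset.Icc (-((3 * n : ℕ) : ℤ)) (3 * n : ℕ), Real.exp (-(k : ℝ) ^ 2)) ≤
      Real.exp (5 / 4) := by
    refine (sum_exp_neg_sq_le _).trans ?_
    have := Real.quadratic_le_exp_of_nonneg (by norm_num : (0 : ℝ) ≤ 5 / 4)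
    norm_num at this ⊢
    linarith
  have h0 : 0 ≤ ∑ k ∈ Finset.Icc (-((3 * n : ℕ) : ℤ)) (3 * n : ℕ), Real.exp (-(k : ℝ) ^ 2) := by
    positivity
  have h2 : (2 : ℝ) ≤ Real.exp 1 := by linarith [Real.add_one_le_exp (1 : ℝ)]
  calc _ ≤ Real.exp 1 * Real.exp (-11 * n + 25 * n / 4) * Real.exp (5 / 4) ^ n := by gcongr
    _ = Real.exp (1 + (-11 * n + 25 * n / 4) + n * (5 / 4)) := by
        rw [← Real.exp_nat_mul, ← Real.exp_add, ← Real.exp_add]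
    _ ≤ _ := Real.exp_le_exp.2 (by
        have := Real.log_le_self (by positivity : (0 : ℝ) ≤ n)
        linarith)

theorem trInner_eq_pairs {M X : Matrix (Fin n) (Fin n) ℝ} (hM : M.IsSymm) (hX : IsCovariate X) :
    trInner M X = ∑ i, ∑ j, 2 * X i j * upper M i j := by
  have h1 : trInner M X = ∑ i, ∑ j, X i j * upper M i j + ∑ i, ∑ j, X j i * upper M j i := by
    simp only [trInner, ← Finset.sum_add_distrib]
    refine Finset.sum_congr rfl fun i _ => Finset.sum_congr rfl fun j _ => ?_
    rcases lt_trichotomy i j with h | h | h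
    · simp [upper, h, h.not_gt]; ring
    · simp [upper, h, hX.diag]
    · simp [upper, h, h.not_gt, hM.apply i j, hX.symm.apply i j]; ring
  have h2 : ∑ i, ∑ j, X j i * upper M j i = ∑ i, ∑ j, X i j * upper M i j := Finset.sum_comm
  rw [h1, h2, ← Finset.sum_add_distrib]
  refine Finset.sum_congr rfl fun i _ => ?_
  rw [← Finset.sum_add_distrib]
  exact Finset.sum_congr rfl fun j _ => by ring

theorem frob_sq {m k : Type*} [Fintype m] [Fintype k] (M : Matrix m k ℝ) :
    frob M ^ 2 = ∑ i, ∑ j, M i j ^ 2 :=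
  Real.sq_sqrt (Finset.sum_nonneg fun _ _ => Finset.sum_nonneg fun _ _ => sq_nonneg _)

theorem frob_nonneg {m k : Type*} [Fintype m] [Fintype k] (M : Matrix m k ℝ) : 0 ≤ frob M :=
  Real.sqrt_nonneg _

theorem frob_pos {m k : Type*} [Fintype m] [Fintype k] {M : Matrix m k ℝ} (h : M ≠ 0) :
    0 < frob M := by
  refine Real.sqrt_pos.2 ?_
  obtain ⟨i, j, hij⟩ : ∃ i j, M i j ≠ 0 := by
    by_contra! hc
    exact h (by ext i j; exact hc i j)
  refine Finset.sum_pos' (fun i _ => Finset.sum_nonneg fun j _ => sq_nonneg _)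
    ⟨i, Finset.mem_univ _, Finset.sum_pos' (fun j _ => sq_nonneg _) ⟨j, Finset.mem_univ _, ?_⟩⟩
  positivity

/-- Hoeffding is used here because the entries of `X` have no uniform bound relative to `‖X‖_F`. The
weights `2 X_ij` on pairs have square sum `2 ‖X‖_F²`, so the exponent is `-4 log n` for each sign.
-/
theorem prob_covariate (h : IsNetwork μ Θ A) (hn : 2 ≤ n) (hΘ : Θ.IsSymm)
    {X : Matrix (Fin n) (Fin n) ℝ} (hX : IsCovariate X) (hX0 : X ≠ 0) :
    μ.real {ω | 2 * frob X * √(Real.log n) ≤ |trInner (A ω - sigm Θ) X|} ≤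
      Real.exp (-3 * Real.log n) := by
  have hn' : (2 : ℝ) ≤ n := by exact_mod_cast hn
  have hF := frob_pos hX0
  have hsig : (sigm Θ).IsSymm := by
    ext i j; simp [sigm, hΘ.apply i j]
  have hlog : 0 ≤ Real.log n := Real.log_natCast_nonneg n
  have hsq : ∑ p : {p : Fin n × Fin n // p.1 < p.2}, (2 * X p.1.1 p.1.2) ^ 2 = 2 * frob X ^ 2 := by
    have h1 := trInner_eq_pairs hX.symm hX
    rw [sum_pairs fun i j => (2 * X i j) ^ 2, frob_sq]
    have h2 : ∑ i, ∑ j, X i j ^ 2 = trInner X X := by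
      simp only [trInner, sq]
    rw [h2, h1, Finset.mul_sum]
    refine Finset.sum_congr rfl fun i _ => ?_
    rw [Finset.mul_sum]
    refine Finset.sum_congr rfl fun j _ => ?_
    unfold upper
    split_ifs <;> ring
  have key : ∀ ε : ℝ, ε ^ 2 = 1 → μ.real {ω | 2 * frob X * √(Real.log n) ≤
      ε * trInner (A ω - sigm Θ) X} ≤ Real.exp (-4 * Real.log n) := by
    intro ε hε
    have hsq' : ∑ p : {p : Fin n × Fin n // p.1 < p.2}, (ε * (2 * X p.1.1 p.1.2)) ^ 2 =
        2 * frob X ^ 2 := by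
      rw [← hsq]
      exact Finset.sum_congr rfl fun p _ => by rw [mul_pow, hε, one_mul]
    have h1 := hoeffding_bernoulli h.indep (fun p => h.measurable _ _)
      (fun p ω => h.zero_or_one ω _ _) (fun p => ε * (2 * X p.1.1 p.1.2))
      (s := 2 * frob X * √(Real.log n)) (by positivity) (by rw [hsq']; positivity)
    simp only [h.sum_centered fun i j => ε * (2 * X i j)] at h1
    rw [hsq', mul_pow, Real.sq_sqrt hlog] at h1
    have e : ∀ ω, ∑ i, ∑ j, ε * (2 * X i j) * (upper (A ω) i j - upper (sigm Θ) i j) =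
        ε * trInner (A ω - sigm Θ) X := by
      intro ω
      rw [trInner_eq_pairs ((h.symm ω).sub hsig) hX, Finset.mul_sum]
      refine Finset.sum_congr rfl fun i _ => ?_
      rw [Finset.mul_sum]
      refine Finset.sum_congr rfl fun j _ => ?_
      unfold upper
      split_ifs
      · simp only [Matrix.sub_apply]; ring
      · ring
    simp only [e] at h1
    refine h1.trans (Real.exp_le_exp.2 (le_of_eq ?_))
    field_simp
    ring
  have hsub : {ω | 2 * frob X * √(Real.log n) ≤ |trInner (A ω - sigm Θ) X|} ⊆
      {ω | 2 * frob X * √(Real.log n) ≤ 1 * trInner (A ω - sigm Θ) X} ∪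
      {ω | 2 * frob X * √(Real.log n) ≤ (-1) * trInner (A ω - sigm Θ) X} := by
    intro ω hω
    simpa [le_abs] using hω
  refine (measureReal_mono hsub (measure_ne_top _ _)).trans ((measureReal_union_le _ _).trans ?_)
  have h1 := key 1 (by norm_num)
  have h2 := key (-1) (by norm_num)
  have h3 : Real.exp (-4 * Real.log n) = Real.exp (-3 * Real.log n) * (n : ℝ)⁻¹ := by
    rw [← Real.exp_log (by positivity : (0 : ℝ) < (n : ℝ)⁻¹), Real.log_inv, ← Real.exp_add]
    ring_nf
  have h4 : (n : ℝ)⁻¹ ≤ 1 / 2 := by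
    rw [inv_eq_one_div]; exact one_div_le_one_div_of_le two_pos hn'
  nlinarith [Real.exp_pos (-3 * Real.log n)]

/-- Replaces `√(qn)` by a power of two, so that the heavy threshold aligns with the dyadic levels.
-/
theorem exists_dyadic_sqrt {d : ℝ} (hd : 1 / 4 ≤ d) :
    ∃ m : ℕ, d ≤ ((2 : ℝ) ^ m) ^ 2 ∧ ((2 : ℝ) ^ m) ^ 2 ≤ 4 * d := by
  rcases le_total d 1 with h | h
  · exact ⟨0, by simpa using h, by norm_num; linarith⟩
  · obtain ⟨k, hk1, hk2⟩ := exists_nat_pow_near h (by norm_num : (1 : ℝ) < 4)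
    have e : ((2 : ℝ) ^ (k + 1)) ^ 2 = 4 ^ (k + 1) := by
      rw [← pow_mul, mul_comm, pow_mul]; norm_num
    refine ⟨k + 1, ?_, ?_⟩
    · rw [e]; exact hk2.le
    · rw [e, pow_succ]; linarith

/-- With high probability, the noise matrix has small spectral norm and is nearly orthogonal to the
covariate. -/
theorem prob_noise (h : IsNetwork μ Θ A) (hn : 2 ≤ n) (hΘ : Θ.IsSymm)
    {X : Matrix (Fin n) (Fin n) ℝ} (hX : IsCovariate X)
    (hq : ∀ i j, i ≠ j → Real.sigmoid (Θ i j) ≤ q) (hlog : Real.log n ≤ q * n) :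
    μ.real {ω | ¬ ((∀ x, |x ⬝ᵥ (A ω - sigm Θ) *ᵥ x| ≤ 12002 * √(q * n) * (x ⬝ᵥ x)) ∧
      |trInner (A ω - sigm Θ) X| ≤ 12002 * √(q * n) * frob X)} ≤ (n : ℝ)⁻¹ := by
  have hn' : (2 : ℝ) ≤ n := by exact_mod_cast hn
  have hd : 1 / 4 ≤ q * n := by
    refine le_trans ?_ hlog
    have := Real.log_le_log two_pos hn'
    linarith [Real.log_two_gt_d9]
  have hq0 : 0 ≤ q := by
    by_contra! hc
    nlinarith
  obtain ⟨m, hm1, hm2⟩ := exists_dyadic_sqrt hd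
  have hsig : (sigm Θ).IsSymm := by
    ext i j; simp [sigm, hΘ.apply i j]
  have hD : (2 : ℝ) ^ m ≤ 2 * √(q * n) := by
    refine (sq_le_sq₀ (by positivity) (by positivity)).1 ?_
    rw [mul_pow, Real.sq_sqrt (by positivity)]
    linarith
  have hone : 1 ≤ 2 * √(q * n) := by
    have : (1 / 2 : ℝ) ≤ √(q * n) := Real.le_sqrt_of_sq_le (by linarith)
    linarith
  set E1 : Set Ω := {ω | ∃ i, 14 * (2 ^ m) ^ 2 < ∑ j, (upper (A ω) i j + upper (A ω) j i)}
  set E2 : Set Ω := {ω | ¬ ∀ a b : ℕ, a < n → b < n → ∀ S T : Finset (Fin n),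
      ((a + b + 2 - m : ℕ) : ℝ) * Real.log 2 * ∑ i ∈ S, ∑ j ∈ T, upper (A ω) i j ≤
        q * S.card * T.card * 2 ^ (a + b + 2 - m) +
          4 * (levelEntropy n a S.card + levelEntropy n b T.card)}
  set E3 : Set Ω := {ω | ¬ ∀ w : Fin n → ℤ, ∑ i, (w i : ℝ) ^ 2 ≤ 25 * n / 4 →
      |∑ i, ∑ j, (if |(w i : ℝ) * w j| ≤ 4 * 2 ^ m then (w i : ℝ) * w j else 0) *
        (upper (A ω) i j - upper (sigm Θ) i j)| ≤ 14 * n * (4 * 2 ^ m)}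
  set E4 : Set Ω := {ω | X ≠ 0 ∧ 2 * frob X * √(Real.log n) ≤ |trInner (A ω - sigm Θ) X|}
  have p1 : μ.real E1 ≤ Real.exp (-3 * Real.log n) := prob_degree h hn hq0 hq hlog hm1
  have p2 : μ.real E2 ≤ Real.exp (-3 * Real.log n) := prob_discrepancy h hn hq0 hq m
  have p3 : μ.real E3 ≤ Real.exp (-3 * Real.log n) := prob_light h hn hq0 hq hm1
  have p4 : μ.real E4 ≤ Real.exp (-3 * Real.log n) := by
    by_cases hX0 : X = 0
    · simp [E4, hX0]; positivity
    · simpa [E4, hX0] using prob_covariate h hn hΘ hX hX0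
  have hsub : {ω | ¬ ((∀ x, |x ⬝ᵥ (A ω - sigm Θ) *ᵥ x| ≤ 12002 * √(q * n) * (x ⬝ᵥ x)) ∧
      |trInner (A ω - sigm Θ) X| ≤ 12002 * √(q * n) * frob X)} ⊆ (E1 ∪ E2) ∪ (E3 ∪ E4) := by
    intro ω hω
    by_contra hc
    simp only [Set.mem_union, not_or] at hc
    obtain ⟨⟨c1, c2⟩, c3, c4⟩ := hc
    refine hω ⟨?_, ?_⟩
    · intro x
      simp only [E1, E2, E3, Set.mem_ofPred_eq, not_exists, not_lt, not_not] at c1 c2 c3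
      have hP : ∀ i j, 0 ≤ upper (sigm Θ) i j ∧ upper (sigm Θ) i j ≤ q := by
        intro i j
        unfold upper
        split_ifs with hij
        · exact ⟨Real.sigmoid_nonneg _, hq i j hij.ne⟩
        · exact ⟨le_rfl, hq0⟩
      have k1 := abs_quad_offDiag_le (by omega)
        (fun i j => by rcases h.zero_or_one ω i j with hh | hh <;> simp [hh]) (h.symm ω) hsig
        (fun i j => (hP i j).1) (fun i j => (hP i j).2) hm1 c1 c2 c3 x
      -- The diagonal must be restored: `A` vanishes there while `sigm Θ` does not. It changes the
      -- form by at most `x ⬝ᵥ x`, which explains `12002 = 6000 · 2 + 2`.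
      have e : x ⬝ᵥ (A ω - sigm Θ) *ᵥ x = x ⬝ᵥ offDiag (A ω - sigm Θ) *ᵥ x -
          ∑ i, Real.sigmoid (Θ i i) * (x i * x i) := by
        have e1 : A ω - sigm Θ = offDiag (A ω - sigm Θ) -
            Matrix.diagonal fun i => Real.sigmoid (Θ i i) := by
          ext i j
          by_cases hij : i = j
          · subst hij; simp [offDiag, sigm, h.diag]
          · simp [offDiag, hij]
        conv_lhs => rw [e1]
        rw [Matrix.sub_mulVec, dotProduct_sub]
        congr 1
        refine Finset.sum_congr rfl fun i _ => ?_
        rw [Matrix.mulVec_diagonal]; ring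
      have k2 : |∑ i, Real.sigmoid (Θ i i) * (x i * x i)| ≤ x ⬝ᵥ x := by
        rw [abs_of_nonneg (Finset.sum_nonneg fun i _ =>
          mul_nonneg (Real.sigmoid_nonneg _) (mul_self_nonneg _))]
        exact Finset.sum_le_sum fun i _ =>
          mul_le_of_le_one_left (mul_self_nonneg _) (Real.sigmoid_le_one _)
      rw [e]
      have hx := dotProduct_self_nonneg' x
      calc _ ≤ |x ⬝ᵥ offDiag (A ω - sigm Θ) *ᵥ x| + |∑ i, Real.sigmoid (Θ i i) * (x i * x i)| :=
            abs_sub _ _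
        _ ≤ 6000 * 2 ^ m * (x ⬝ᵥ x) + 1 * (x ⬝ᵥ x) := by linarith
        _ ≤ 6000 * (2 * √(q * n)) * (x ⬝ᵥ x) + (2 * √(q * n)) * (x ⬝ᵥ x) := by gcongr
        _ = _ := by ring
    · by_cases hX0 : X = 0
      · simp [hX0, trInner, frob]
      · simp only [E4, Set.mem_ofPred_eq, not_and, not_le] at c4
        refine (c4 hX0).le.trans ?_
        have := Real.sqrt_le_sqrt hlog
        have hF := frob_nonneg X
        nlinarith [mul_le_mul_of_nonneg_left this hF, mul_nonneg hF (Real.sqrt_nonneg (q * n))]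
  refine (measureReal_mono hsub (measure_ne_top _ _)).trans ?_
  -- Four events of probability at most `n⁻³` each, and `4 n⁻³ ≤ n⁻¹` for `n ≥ 2`.
  have u1 := measureReal_union_le (μ := μ) (E1 ∪ E2) (E3 ∪ E4)
  have u2 := measureReal_union_le (μ := μ) E1 E2
  have u3 := measureReal_union_le (μ := μ) E3 E4
  have e : Real.exp (-3 * Real.log n) = (n : ℝ)⁻¹ * ((n : ℝ)⁻¹ * (n : ℝ)⁻¹) := by
    rw [← Real.exp_log (by positivity : (0 : ℝ) < (n : ℝ)⁻¹), Real.log_inv, ← Real.exp_add,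
      ← Real.exp_add]
    ring_nf
  have h4 : (n : ℝ)⁻¹ ≤ 1 / 2 := by
    rw [inv_eq_one_div]; exact one_div_le_one_div_of_le two_pos hn'
  have h5 : 0 ≤ (n : ℝ)⁻¹ := by positivity
  have h6 : (n : ℝ)⁻¹ * (n : ℝ)⁻¹ ≤ 1 / 4 := by nlinarith
  have h7 : (n : ℝ)⁻¹ * ((n : ℝ)⁻¹ * (n : ℝ)⁻¹) ≤ (n : ℝ)⁻¹ * (1 / 4) :=
    mul_le_mul_of_nonneg_left h6 h5
  linarith

end Events

/-! ### The Frobenius norm and the trace inner product -/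

section Frobenius

variable {m k l : Type*} [Fintype m] [Fintype k] [Fintype l]

theorem trInner_self (M : Matrix m k ℝ) : trInner M M = frob M ^ 2 := by
  rw [frob_sq]; simp only [trInner, sq]

theorem trInner_comm (M N : Matrix m k ℝ) : trInner M N = trInner N M := by
  simp only [trInner, mul_comm]

theorem trInner_add_right (M N P : Matrix m k ℝ) :
    trInner M (N + P) = trInner M N + trInner M P := by
  simp only [trInner, Matrix.add_apply, mul_add, Finset.sum_add_distrib]

theorem trInner_sub_right (M N P : Matrix m k ℝ) :
    trInner M (N - P) = trInner M N - trInner M P := by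
  simp only [trInner, Matrix.sub_apply, mul_sub, Finset.sum_sub_distrib]

theorem trInner_smul_right (c : ℝ) (M N : Matrix m k ℝ) :
    trInner M (c • N) = c * trInner M N := by
  simp only [trInner, Matrix.smul_apply, smul_eq_mul, Finset.mul_sum]
  exact Finset.sum_congr rfl fun i _ => Finset.sum_congr rfl fun j _ => by ring

theorem trInner_add_left (M N P : Matrix m k ℝ) :
    trInner (M + N) P = trInner M P + trInner N P := by
  rw [trInner_comm, trInner_add_right, trInner_comm P M, trInner_comm P N]

theorem trInner_sub_left (M N P : Matrix m k ℝ) :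
    trInner (M - N) P = trInner M P - trInner N P := by
  rw [trInner_comm, trInner_sub_right, trInner_comm P M, trInner_comm P N]

theorem trInner_smul_left (c : ℝ) (M N : Matrix m k ℝ) :
    trInner (c • M) N = c * trInner M N := by
  rw [trInner_comm, trInner_smul_right, trInner_comm]

theorem trInner_eq_trace (M N : Matrix m k ℝ) : trInner M N = (Mᵀ * N).trace := by
  simp only [trInner, Matrix.trace, Matrix.diag, Matrix.mul_apply, Matrix.transpose_apply]
  exact Finset.sum_comm

theorem abs_sum_mul_le (f g : m → k → ℝ) :
    |∑ i, ∑ j, f i j * g i j| ≤ √(∑ i, ∑ j, f i j ^ 2) * √(∑ i, ∑ j, g i j ^ 2) := by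
  simp only [← Fintype.sum_prod_type']
  rw [← Real.sqrt_mul (Finset.sum_nonneg fun _ _ => sq_nonneg _)]
  exact Real.abs_le_sqrt (Finset.sum_mul_sq_le_sq_mul_sq _ _ _)

theorem abs_trInner_le (M N : Matrix m k ℝ) : |trInner M N| ≤ frob M * frob N :=
  abs_sum_mul_le M N

theorem frob_add_sq (M N : Matrix m k ℝ) :
    frob (M + N) ^ 2 = frob M ^ 2 + 2 * trInner M N + frob N ^ 2 := by
  rw [← trInner_self, trInner_add_left, trInner_add_right, trInner_add_right, trInner_self,
    trInner_self, trInner_comm N M]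
  ring

theorem frob_add_le (M N : Matrix m k ℝ) : frob (M + N) ≤ frob M + frob N := by
  refine abs_le_of_sq_le_sq' ?_ (add_nonneg (frob_nonneg _) (frob_nonneg _)) |>.2
  rw [frob_add_sq]
  nlinarith [(abs_le.1 (abs_trInner_le M N)).2]

theorem frob_smul (c : ℝ) (M : Matrix m k ℝ) : frob (c • M) = |c| * frob M := by
  unfold frob
  simp only [Matrix.smul_apply, smul_eq_mul, mul_pow, ← Finset.mul_sum]
  rw [Real.sqrt_mul (sq_nonneg c), Real.sqrt_sq_eq_abs]

theorem frob_neg (M : Matrix m k ℝ) : frob (-M) = frob M := by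
  unfold frob; simp

theorem frob_sub_comm (M N : Matrix m k ℝ) : frob (M - N) = frob (N - M) := by
  rw [← frob_neg, neg_sub]

theorem frob_sub_le (M N P : Matrix m k ℝ) : frob (M - P) ≤ frob (M - N) + frob (N - P) := by
  have := frob_add_le (M - N) (N - P)
  rwa [sub_add_sub_cancel] at this

theorem frob_zero : frob (0 : Matrix m k ℝ) = 0 := by simp [frob]

theorem trInner_mul_left_orthogonal [DecidableEq m] {V : Matrix m m ℝ} (hV : Vᵀ * V = 1)
    (M N : Matrix m k ℝ) : trInner (V * M) (V * N) = trInner M N := by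
  rw [trInner_eq_trace, trInner_eq_trace, Matrix.transpose_mul, Matrix.mul_assoc,
    ← Matrix.mul_assoc Vᵀ, hV, Matrix.one_mul]

theorem trInner_mul_right_orthogonal [DecidableEq k] {V : Matrix k k ℝ} (hV : V * Vᵀ = 1)
    (M N : Matrix m k ℝ) : trInner (M * V) (N * V) = trInner M N := by
  rw [trInner_eq_trace, trInner_eq_trace, Matrix.transpose_mul, Matrix.trace_mul_comm,
    Matrix.mul_assoc, ← Matrix.mul_assoc V, hV, Matrix.one_mul, Matrix.trace_mul_comm]

theorem trInner_conj_orthogonal [DecidableEq m] {V : Matrix m m ℝ} (hV : V * Vᵀ = 1)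
    (M N : Matrix m m ℝ) : trInner (Vᵀ * M * V) (Vᵀ * N * V) = trInner M N := by
  rw [trInner_mul_right_orthogonal hV, trInner_mul_left_orthogonal]
  rwa [Matrix.transpose_transpose]

theorem frob_conj_orthogonal [DecidableEq m] {V : Matrix m m ℝ} (hV : V * Vᵀ = 1)
    (M : Matrix m m ℝ) : frob (Vᵀ * M * V) = frob M := by
  have := trInner_conj_orthogonal hV M M
  rw [trInner_self, trInner_self] at this
  exact (sq_eq_sq₀ (frob_nonneg _) (frob_nonneg _)).1 this

end Frobenius

/-! ### Operator norm bounds against positive semidefinite matrices -/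

section Bilinear

/-- The bilinear form of `W` is bounded by `w`. -/
def BilinBound {m : Type*} [Fintype m] (W : Matrix m m ℝ) (w : ℝ) : Prop :=
  ∀ x y, |x ⬝ᵥ W *ᵥ y| ≤ w * (√(x ⬝ᵥ x) * √(y ⬝ᵥ y))

variable {m k : Type*} [Fintype m] [Fintype k]

theorem opNorm_nonneg [DecidableEq k] (M : Matrix m k ℝ) : 0 ≤ opNorm M := by
  exact @norm_nonneg _ Matrix.instL2OpNormedAddCommGroup.toSeminormedAddCommGroup.toSeminormedAddGroup M

theorem sqrt_mulVec_le [DecidableEq k] (M : Matrix m k ℝ) (x : k → ℝ) :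
    √((M *ᵥ x) ⬝ᵥ (M *ᵥ x)) ≤ opNorm M * √(x ⬝ᵥ x) := by
  have h := Matrix.l2_opNorm_mulVec M (WithLp.toLp 2 x)
  simp only [EuclideanSpace.norm_eq] at h
  have e1 : (M *ᵥ x) ⬝ᵥ (M *ᵥ x) = ∑ i, ‖(M *ᵥ x) i‖ ^ 2 := by simp [dotProduct, sq]
  have e2 : x ⬝ᵥ x = ∑ i, ‖x i‖ ^ 2 := by simp [dotProduct, sq]
  rw [e1, e2]
  exact h

theorem bilinBound_opNorm [DecidableEq m] (M : Matrix m m ℝ) : BilinBound M (opNorm M) := by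
  intro x y
  refine (abs_dotProduct_le _ _).trans ?_
  have := mul_le_mul_of_nonneg_left (sqrt_mulVec_le M y) (Real.sqrt_nonneg (x ⬝ᵥ x))
  linarith

theorem dotProduct_mulVec_orthogonal [DecidableEq k] {V : Matrix m k ℝ} (hV : Vᵀ * V = 1)
    (x : k → ℝ) : (V *ᵥ x) ⬝ᵥ (V *ᵥ x) = x ⬝ᵥ x := by
  rw [Matrix.dotProduct_mulVec, Matrix.vecMul_mulVec, hV, Matrix.vecMul_one]

theorem BilinBound.conj [DecidableEq m] {W : Matrix m m ℝ} {w : ℝ} (h : BilinBound W w)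
    {V : Matrix m m ℝ} (hV : Vᵀ * V = 1) : BilinBound (Vᵀ * W * V) w := by
  intro x y
  have := h (V *ᵥ x) (V *ᵥ y)
  rw [dotProduct_mulVec_orthogonal hV, dotProduct_mulVec_orthogonal hV] at this
  have e : x ⬝ᵥ (Vᵀ * W * V) *ᵥ y = (V *ᵥ x) ⬝ᵥ W *ᵥ (V *ᵥ y) := by
    rw [← Matrix.mulVec_mulVec, ← Matrix.mulVec_mulVec, Matrix.dotProduct_mulVec,
      Matrix.vecMul_transpose]
  rwa [e]

theorem BilinBound.quad {W : Matrix m m ℝ} {w : ℝ} (h : BilinBound W w) (x : m → ℝ) :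
    |x ⬝ᵥ W *ᵥ x| ≤ w * (x ⬝ᵥ x) := by
  have := h x x
  rwa [Real.mul_self_sqrt (dotProduct_self_nonneg' x)] at this

theorem BilinBound.transpose {W : Matrix m m ℝ} {w : ℝ} (h : BilinBound W w) :
    BilinBound Wᵀ w := by
  intro x y
  have := h y x
  rw [Matrix.mulVec_transpose, dotProduct_comm, ← Matrix.dotProduct_mulVec, mul_comm (√(x ⬝ᵥ x))]
  exact this

theorem BilinBound.apply_self [DecidableEq m] {W : Matrix m m ℝ} {w : ℝ} (h : BilinBound W w)
    (i : m) : |W i i| ≤ w := by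
  have := h.quad (Pi.single i 1)
  simpa using this

/-- Tests the form on a coordinate vector and on the row itself. -/
theorem BilinBound.row [DecidableEq m] {W : Matrix m m ℝ} {w : ℝ} (h : BilinBound W w)
    (i : m) : ∑ j, W i j ^ 2 ≤ w ^ 2 := by
  have h1 := h (Pi.single i 1) (W i)
  have e1 : (Pi.single i 1 : m → ℝ) ⬝ᵥ W *ᵥ (W i) = W i ⬝ᵥ W i := by
    rw [single_one_dotProduct]; rfl
  have e2 : (Pi.single i 1 : m → ℝ) ⬝ᵥ Pi.single i 1 = 1 := by simp
  rw [e1, e2, Real.sqrt_one, one_mul, abs_of_nonneg (dotProduct_self_nonneg' _)] at h1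
  have e3 : ∑ j, W i j ^ 2 = W i ⬝ᵥ W i := by simp only [dotProduct, sq]
  rw [e3]
  set a := √(W i ⬝ᵥ W i)
  have ha : W i ⬝ᵥ W i = a ^ 2 := (Real.sq_sqrt (dotProduct_self_nonneg' _)).symm
  have ha0 : 0 ≤ a := Real.sqrt_nonneg _
  rw [ha] at h1 ⊢
  rcases ha0.eq_or_lt with h0 | h0
  · rw [← h0]; nlinarith [sq_nonneg w]
  · have : a ≤ w := by nlinarith
    exact pow_le_pow_left₀ ha0 this 2

open scoped MatrixOrder in
theorem exists_gram_of_posSemidef [DecidableEq m] {H : Matrix m m ℝ} (hH : H.PosSemidef) :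
    ∃ B : Matrix m m ℝ, H = Bᵀ * B := by
  obtain ⟨B, hB⟩ := CStarAlgebra.nonneg_iff_eq_star_mul_self.mp hH.nonneg
  exact ⟨B, by rw [hB, Matrix.star_eq_conjTranspose, Matrix.conjTranspose_eq_transpose_of_trivial]⟩

/-- With `H = BᵀB` the inner product is a sum of quadratic forms of `W` at the rows of `B`. This is
the duality of operator and nuclear norm where the latter is the trace. -/
theorem abs_trInner_posSemidef_le {W H : Matrix m m ℝ} {w : ℝ}
    (hW : ∀ x, |x ⬝ᵥ W *ᵥ x| ≤ w * (x ⬝ᵥ x)) (hH : H.PosSemidef) :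
    |trInner W H| ≤ w * H.trace := by
  classical
  obtain ⟨B, rfl⟩ := exists_gram_of_posSemidef hH
  have e1 : trInner W (Bᵀ * B) = ∑ r, B r ⬝ᵥ W *ᵥ B r := by
    simp only [trInner, Matrix.mul_apply, Matrix.transpose_apply, dotProduct, Matrix.mulVec,
      Finset.mul_sum]
    calc _ = ∑ i, ∑ r, ∑ j, W i j * (B r i * B r j) :=
          Finset.sum_congr rfl fun i _ => Finset.sum_comm
      _ = ∑ r, ∑ i, ∑ j, W i j * (B r i * B r j) := Finset.sum_comm
      _ = _ := Finset.sum_congr rfl fun r _ => Finset.sum_congr rfl fun i _ =>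
          Finset.sum_congr rfl fun j _ => by ring
  have e2 : (Bᵀ * B).trace = ∑ r, B r ⬝ᵥ B r := by
    simp only [Matrix.trace, Matrix.diag, Matrix.mul_apply, Matrix.transpose_apply, dotProduct]
    exact Finset.sum_comm
  rw [e1, e2, Finset.mul_sum]
  exact (Finset.abs_sum_le_sum_abs _ _).trans (Finset.sum_le_sum fun r _ => hW _)

theorem card_filter_lt_le (n k : ℕ) :
    (((Finset.univ : Finset (Fin n)).filter fun i : Fin n => (i : ℕ) < k).card : ℝ) ≤ k := by
  have := Finset.card_le_card_of_injOn (s := (Finset.univ : Finset (Fin n)).filter fun i : Fin n => (i : ℕ) < k)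
    (t := Finset.range k) (fun i : Fin n => (i : ℕ)) (fun i hi => by simpa using hi)
    (fun i _ j _ h => Fin.ext h)
  rw [Finset.card_range] at this
  exact_mod_cast this

/-- The inner product of a matrix with bounded bilinear form and the difference of a positive
semidefinite matrix and a nonnegative diagonal matrix, up to rank `k`. -/
theorem abs_trInner_sub_diagonal_le {n : ℕ} (k : ℕ) {W H : Matrix (Fin n) (Fin n) ℝ} {w : ℝ}
    (hw0 : 0 ≤ w) (hW : BilinBound W w) (hH : H.PosSemidef) {d : Fin n → ℝ} (hd : ∀ i, 0 ≤ d i) :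
    |trInner W (H - Matrix.diagonal d)| ≤ w * (2 * √k * frob (H - Matrix.diagonal d) +
      ∑ i : Fin n, (if (i : ℕ) < k then 0 else H i i) +
      ∑ i : Fin n, (if (i : ℕ) < k then 0 else d i)) := by
  set Δ := H - Matrix.diagonal d with hΔ
  set E : Matrix (Fin n) (Fin n) ℝ := Matrix.diagonal fun i => if (i : ℕ) < k then 0 else 1 with hE
  have hETE : Eᴴ * H * E = E * H * E := by
    rw [hE, Matrix.diagonal_conjTranspose]; rfl
  have hEH : (E * H * E).PosSemidef := hETE ▸ hH.conjTranspose_mul_mul_same E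
  have hEHij : ∀ i j, (E * H * E) i j = if (i : ℕ) < k ∨ (j : ℕ) < k then 0 else H i j := by
    intro i j
    rw [hE, Matrix.mul_diagonal, Matrix.diagonal_mul]
    by_cases h1 : (i : ℕ) < k <;> by_cases h2 : (j : ℕ) < k <;> simp [h1, h2]
  -- The first `k` rows and columns of `W` have squared Frobenius norm at most `2k w²`, so
  -- Cauchy–Schwarz handles them. The remaining corner of `H - diag d` is a difference of two
  -- positive semidefinite matrices, each of which costs its trace.
  have split : trInner W Δ = ∑ i : Fin n, ∑ j : Fin n, (if (i : ℕ) < k ∨ (j : ℕ) < k then W i j else 0) * Δ i j +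
      (trInner W (E * H * E) - ∑ i : Fin n, (if (i : ℕ) < k then 0 else W i i * d i)) := by
    have h3 : ∑ i : Fin n, (if (i : ℕ) < k then 0 else W i i * d i) =
        ∑ i : Fin n, ∑ j : Fin n, (if (i : ℕ) < k ∨ (j : ℕ) < k then 0 else W i j * Matrix.diagonal d i j) := by
      refine Finset.sum_congr rfl fun i _ => ?_
      rw [Finset.sum_eq_single i]
      · simp
      · intro j _ hj
        rw [Matrix.diagonal_apply_ne _ hj.symm]; simp
      · simp
    rw [h3]
    simp only [trInner, ← Finset.sum_sub_distrib, ← Finset.sum_add_distrib, hEHij]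
    refine Finset.sum_congr rfl fun i _ => Finset.sum_congr rfl fun j _ => ?_
    split_ifs
    · ring
    · rw [hΔ, Matrix.sub_apply]; ring
  have b1 : |∑ i : Fin n, ∑ j : Fin n, (if (i : ℕ) < k ∨ (j : ℕ) < k then W i j else 0) * Δ i j| ≤
      w * (2 * √k * frob Δ) := by
    refine (abs_sum_mul_le _ _).trans ?_
    have h4 : ∑ i : Fin n, ∑ j : Fin n, (if (i : ℕ) < k ∨ (j : ℕ) < k then W i j else 0) ^ 2 ≤ (2 * √k * w) ^ 2 := by
      have h5 : ∀ i j : Fin n, (if (i : ℕ) < k ∨ (j : ℕ) < k then W i j else 0) ^ 2 ≤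
          (if (i : ℕ) < k then W i j ^ 2 else 0) + (if (j : ℕ) < k then Wᵀ j i ^ 2 else 0) := by
        intro i j
        have := sq_nonneg (W i j)
        rw [Matrix.transpose_apply]
        by_cases h1 : (i : ℕ) < k <;> by_cases h2 : (j : ℕ) < k <;> simp [h1, h2]
        linarith
      have h6 : ∀ {M : Matrix (Fin n) (Fin n) ℝ}, BilinBound M w →
          ∑ i : Fin n, ∑ j, (if (i : ℕ) < k then M i j ^ 2 else 0) ≤ k * w ^ 2 := by
        intro M hM
        calc ∑ i : Fin n, ∑ j, (if (i : ℕ) < k then M i j ^ 2 else 0)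
            = ∑ i : Fin n, (if (i : ℕ) < k then ∑ j, M i j ^ 2 else 0) :=
              Finset.sum_congr rfl fun i _ => by split_ifs <;> simp
          _ ≤ ∑ i : Fin n, (if (i : ℕ) < k then w ^ 2 else 0) :=
              Finset.sum_le_sum fun i _ => by split_ifs; exacts [hM.row i, le_rfl]
          _ = ((Finset.univ : Finset (Fin n)).filter fun i : Fin n => (i : ℕ) < k).card * w ^ 2 := by
              rw [← Finset.sum_filter, Finset.sum_const, nsmul_eq_mul]
          _ ≤ k * w ^ 2 := mul_le_mul_of_nonneg_right (card_filter_lt_le n k) (sq_nonneg w)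
      refine (Finset.sum_le_sum fun i _ => Finset.sum_le_sum fun j _ => h5 i j).trans ?_
      simp only [Finset.sum_add_distrib]
      have h7 := h6 hW
      have h8 := h6 hW.transpose
      rw [Finset.sum_comm] at h8
      rw [mul_pow, mul_pow, Real.sq_sqrt (Nat.cast_nonneg k)]
      nlinarith [mul_nonneg (Nat.cast_nonneg (α := ℝ) k) (sq_nonneg w)]
    have h9 : √(∑ i : Fin n, ∑ j : Fin n, (if (i : ℕ) < k ∨ (j : ℕ) < k then W i j else 0) ^ 2) ≤ 2 * √k * w :=
      Real.sqrt_le_iff.2 ⟨by positivity, h4⟩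
    calc _ ≤ (2 * √k * w) * frob Δ := mul_le_mul_of_nonneg_right h9 (frob_nonneg _)
      _ = _ := by ring
  have b2 : |trInner W (E * H * E)| ≤ w * ∑ i : Fin n, (if (i : ℕ) < k then 0 else H i i) := by
    refine (abs_trInner_posSemidef_le hW.quad hEH).trans (le_of_eq ?_)
    congr 1
    refine Finset.sum_congr rfl fun i _ => ?_
    rw [Matrix.diag_apply, hEHij]; simp
  have b3 : |∑ i : Fin n, (if (i : ℕ) < k then 0 else W i i * d i)| ≤
      w * ∑ i : Fin n, (if (i : ℕ) < k then 0 else d i) := by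
    rw [Finset.mul_sum]
    refine (Finset.abs_sum_le_sum_abs _ _).trans (Finset.sum_le_sum fun i _ => ?_)
    split_ifs
    · simp
    · rw [abs_mul, abs_of_nonneg (hd i)]
      exact mul_le_mul_of_nonneg_right (hW.apply_self i) (hd i)
  rw [split]
  refine (abs_add_le _ _).trans ?_
  have := abs_sub (trInner W (E * H * E)) (∑ i : Fin n, (if (i : ℕ) < k then 0 else W i i * d i))
  linarith

/-- The trace of `H - diag d` is bounded below up to rank `k`. -/
theorem trace_sub_diagonal_ge {n : ℕ} (k : ℕ) (H : Matrix (Fin n) (Fin n) ℝ) (d : Fin n → ℝ) :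
    -(√k * frob (H - Matrix.diagonal d)) + ∑ i : Fin n, (if (i : ℕ) < k then 0 else H i i) -
      ∑ i : Fin n, (if (i : ℕ) < k then 0 else d i) ≤ (H - Matrix.diagonal d).trace := by
  set Δ := H - Matrix.diagonal d with hΔ
  have e : Δ.trace = ∑ i : Fin n, (if (i : ℕ) < k then 1 else 0) * Δ i i +
      (∑ i : Fin n, (if (i : ℕ) < k then 0 else H i i) -
      ∑ i : Fin n, (if (i : ℕ) < k then 0 else d i)) := by
    rw [← Finset.sum_sub_distrib, ← Finset.sum_add_distrib]
    refine Finset.sum_congr rfl fun i _ => ?_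
    rw [Matrix.diag_apply]
    split_ifs
    · ring
    · rw [hΔ, Matrix.sub_apply, Matrix.diagonal_apply_eq]; ring
  have h1 : (∑ i : Fin n, (if (i : ℕ) < k then 1 else 0) * Δ i i) ^ 2 ≤ (√k * frob Δ) ^ 2 := by
    refine (Finset.sum_mul_sq_le_sq_mul_sq _ _ _).trans ?_
    rw [mul_pow, Real.sq_sqrt (Nat.cast_nonneg k), frob_sq]
    have h2 : ∑ i : Fin n, (if (i : ℕ) < k then (1 : ℝ) else 0) ^ 2 ≤ k := by
      simp only [ite_pow, one_pow, ne_eq, OfNat.ofNat_ne_zero, not_false_eq_true, zero_pow]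
      rw [← Finset.sum_filter, Finset.sum_const, nsmul_eq_mul, mul_one]
      exact card_filter_lt_le n k
    have h3 : ∑ i, Δ i i ^ 2 ≤ ∑ i : Fin n, ∑ j : Fin n, Δ i j ^ 2 :=
      Finset.sum_le_sum fun i _ =>
        Finset.single_le_sum (f := fun j => Δ i j ^ 2) (fun j _ => sq_nonneg _) (Finset.mem_univ i)
    exact mul_le_mul h2 h3 (Finset.sum_nonneg fun i _ => sq_nonneg _) (Nat.cast_nonneg k)
  have h4 := abs_le.1 (abs_le_of_sq_le_sq h1 (mul_nonneg (Real.sqrt_nonneg _) (frob_nonneg _)))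
  rw [e]
  linarith [h4.1]

end Bilinear

/-! ### Polar decomposition and the Procrustes distance -/

section Procrustes

variable {k : ℕ}

theorem isCompact_orthogonal : IsCompact {R : Matrix (Fin k) (Fin k) ℝ | Rᵀ * R = 1} := by
  have h1 : IsCompact (Set.univ.pi fun _ : Fin k => Set.univ.pi fun _ : Fin k =>
      Set.Icc (-1 : ℝ) 1) :=
    isCompact_univ_pi fun _ => isCompact_univ_pi fun _ => isCompact_Icc
  refine IsCompact.of_isClosed_subset h1 ?_ ?_
  · exact isClosed_eq (by fun_prop) continuous_const
  · intro R hR i _ j _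
    have h2 : ∑ i, R i j * R i j = 1 := by
      have := congrFun (congrFun hR j) j
      simpa [Matrix.mul_apply] using this
    have h3 : R i j * R i j ≤ 1 := by
      rw [← h2]
      exact Finset.single_le_sum (f := fun i => R i j * R i j) (fun i _ => mul_self_nonneg _)
        (Finset.mem_univ i)
    exact abs_le.1 (abs_le_of_sq_le_sq (by nlinarith) zero_le_one)

/-- The Householder reflection along `v`. -/
noncomputable def householder (v : Fin k → ℝ) : Matrix (Fin k) (Fin k) ℝ :=
  1 - (2 : ℝ) • Matrix.vecMulVec v v

theorem householder_transpose (v : Fin k → ℝ) : (householder v)ᵀ = householder v := by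
  simp [householder, Matrix.transpose_vecMulVec]

theorem householder_mul_self {v : Fin k → ℝ} (hv : v ⬝ᵥ v = 1) :
    householder v * householder v = 1 := by
  have : Matrix.vecMulVec v v * Matrix.vecMulVec v v = Matrix.vecMulVec v v := by
    rw [Matrix.vecMulVec_mul_vecMulVec, hv]; simp
  simp only [householder, mul_sub, sub_mul, mul_one, one_mul, Matrix.smul_mul, Matrix.mul_smul, this]
  module

theorem trace_mul_vecMulVec (S : Matrix (Fin k) (Fin k) ℝ) (u v : Fin k → ℝ) :
    (S * Matrix.vecMulVec u v).trace = v ⬝ᵥ S *ᵥ u := by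
  rw [Matrix.mul_vecMulVec, Matrix.trace_vecMulVec, dotProduct_comm]

/-- Polar decomposition: some orthogonal multiple of a square matrix is positive semidefinite. -/
theorem exists_orthogonal_mul_psd (M : Matrix (Fin k) (Fin k) ℝ) :
    ∃ R : Matrix (Fin k) (Fin k) ℝ, Rᵀ * R = 1 ∧ (M * R).IsSymm ∧ ∀ v, 0 ≤ v ⬝ᵥ (M * R) *ᵥ v := by
  -- `R` maximizes `tr (M R)` over the compact orthogonal group, so no orthogonal factor can
  -- increase the trace of `S = M R`. Reflections give nonnegativity of the form, rotations give
  -- symmetry.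
  obtain ⟨R, hR, hmax⟩ := isCompact_orthogonal.exists_isMaxOn ⟨1, by simp⟩
    (f := fun R : Matrix (Fin k) (Fin k) ℝ => (M * R).trace) (by fun_prop)
  have hR : Rᵀ * R = 1 := hR
  set S := M * R with hS
  have hO : ∀ O : Matrix (Fin k) (Fin k) ℝ, Oᵀ * O = 1 → (S * O).trace ≤ S.trace := by
    intro O hO
    have hmem : R * O ∈ {R : Matrix (Fin k) (Fin k) ℝ | Rᵀ * R = 1} := by
      change (R * O)ᵀ * (R * O) = 1
      rw [Matrix.transpose_mul, Matrix.mul_assoc, ← Matrix.mul_assoc Rᵀ, hR, Matrix.one_mul, hO]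
    have := hmax hmem
    simp only [Set.mem_ofPred_eq, ← Matrix.mul_assoc] at this
    exact this
  have h1 : ∀ v, v ⬝ᵥ v = 1 → 0 ≤ v ⬝ᵥ S *ᵥ v := by
    intro v hv
    have h2 := hO (householder v) (by rw [householder_transpose, householder_mul_self hv])
    simp only [householder, mul_sub, mul_one, Matrix.trace_sub, Matrix.mul_smul, Matrix.trace_smul,
      trace_mul_vecMulVec, smul_eq_mul] at h2
    linarith
  have h2 : ∀ i j, i ≠ j → S j i ≤ S i j := by
    intro i j hij
    -- The product of the reflections along `e_i` and along the normalized `e_i + t e_j` is a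
    -- rotation by an angle of order `t`. The first-order term in `t` of the maximality inequality
    -- compares `S j i` with `S i j`; exchanging `i` and `j` gives equality.
    have key : ∀ t : ℝ, 0 < t → S j i - S i j ≤ t * (S i i + S j j) := by
      intro t ht
      set r := √(1 + t ^ 2)
      have hr : r ^ 2 = 1 + t ^ 2 := Real.sq_sqrt (by positivity)
      have hr0 : 0 < r := Real.sqrt_pos.2 (by positivity)
      set u : Fin k → ℝ := Pi.single i 1
      set w : Fin k → ℝ := Pi.single j 1
      set v : Fin k → ℝ := r⁻¹ • (u + t • w)
      have huu : u ⬝ᵥ u = 1 := by simp [u]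
      have hww : w ⬝ᵥ w = 1 := by simp [w]
      have huw : u ⬝ᵥ w = 0 := by simp [u, w, hij]
      have hwu : w ⬝ᵥ u = 0 := by rw [dotProduct_comm, huw]
      have hvv : v ⬝ᵥ v = 1 := by
        simp only [v, smul_dotProduct, dotProduct_smul, add_dotProduct, dotProduct_add, huu, hww,
          huw, hwu, smul_eq_mul]
        field_simp
        linarith
      have huv : u ⬝ᵥ v = r⁻¹ := by
        simp only [v, dotProduct_smul, dotProduct_add, huu, huw, smul_eq_mul]
        ring
      have hSuu : u ⬝ᵥ S *ᵥ u = S i i := by simp [u]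
      have hSww : w ⬝ᵥ S *ᵥ w = S j j := by simp [w]
      have hSuw : u ⬝ᵥ S *ᵥ w = S i j := by simp [u, w]
      have hSwu : w ⬝ᵥ S *ᵥ u = S j i := by simp [u, w]
      have h3 := hO (householder u * householder v) (by
        rw [Matrix.transpose_mul, householder_transpose, householder_transpose, Matrix.mul_assoc,
          ← Matrix.mul_assoc (householder u), householder_mul_self huu, Matrix.one_mul,
          householder_mul_self hvv])
      have e : S * (householder u * householder v) = S - (2 : ℝ) • (S * Matrix.vecMulVec u u) -
          (2 : ℝ) • (S * Matrix.vecMulVec v v) + (4 * r⁻¹) • (S * Matrix.vecMulVec u v) := by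
        have : Matrix.vecMulVec u u * Matrix.vecMulVec v v = r⁻¹ • Matrix.vecMulVec u v := by
          rw [Matrix.vecMulVec_mul_vecMulVec, huv, Matrix.vecMulVec_smul]
        simp only [householder, mul_sub, sub_mul, mul_one, one_mul, Matrix.smul_mul,
          Matrix.mul_smul, this]
        module
      rw [e] at h3
      simp only [Matrix.trace_add, Matrix.trace_sub, Matrix.trace_smul, trace_mul_vecMulVec,
        smul_eq_mul] at h3
      simp only [v, smul_dotProduct, dotProduct_smul, add_dotProduct, dotProduct_add,
        Matrix.mulVec_smul, Matrix.mulVec_add, smul_eq_mul, hSuu, hSww, hSuw, hSwu] at h3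
      have h4 : (r⁻¹) ^ 2 * (1 + t ^ 2) = 1 := by rw [← hr]; field_simp
      have h5 : S.trace - 2 * S i i - 2 * (r⁻¹ * (r⁻¹ * (S i i + t * S j i + t * (S i j + t * S j j))))
          + 4 * r⁻¹ * (r⁻¹ * (S i i + t * S j i)) ≤ S.trace := by
        convert h3 using 2
        ring
      have h6 : (r⁻¹) ^ 2 * (t * (S j i - S i j - t * (S i i + S j j))) ≤ 0 := by
        have h7 : S i i = (r⁻¹) ^ 2 * (1 + t ^ 2) * S i i := by rw [h4, one_mul]
        nlinarith
      have h8 : t * (S j i - S i j - t * (S i i + S j j)) ≤ 0 := by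
        by_contra! hc
        have : 0 < (r⁻¹) ^ 2 * (t * (S j i - S i j - t * (S i i + S j j))) := by positivity
        linarith
      by_contra! hc
      have : 0 < t * (S j i - S i j - t * (S i i + S j j)) := mul_pos ht (by linarith)
      linarith
    refine le_of_forall_pos_le_add fun ε hε => ?_
    have h9 : 0 < |S i i + S j j| + 1 := by positivity
    have h3 := key (ε / (|S i i + S j j| + 1)) (by positivity)
    have h4 : ε / (|S i i + S j j| + 1) * (S i i + S j j) ≤ ε := by
      rw [div_mul_eq_mul_div, div_le_iff₀ h9]
      nlinarith [le_abs_self (S i i + S j j)]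
    linarith
  refine ⟨R, hR, ?_, ?_⟩
  · ext i j
    rw [Matrix.transpose_apply]
    by_cases hij : i = j
    · rw [hij]
    · exact le_antisymm (h2 i j hij) (h2 j i (Ne.symm hij))
  · intro v
    rcases (dotProduct_self_nonneg' v).eq_or_lt with hv | hv
    · rw [dotProduct_self_eq_zero' hv.symm]; simp
    set a := √(v ⬝ᵥ v)
    have ha : 0 < a := Real.sqrt_pos.2 hv
    have ha2 : v ⬝ᵥ v = a ^ 2 := (Real.sq_sqrt hv.le).symm
    have h3 := h1 (a⁻¹ • v) (by
      simp only [dotProduct_smul, smul_dotProduct, smul_eq_mul, ha2]; field_simp)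
    simp only [Matrix.mulVec_smul, dotProduct_smul, smul_dotProduct, smul_eq_mul] at h3
    have h4 : v ⬝ᵥ S *ᵥ v = a ^ 2 * (a⁻¹ * (a⁻¹ * (v ⬝ᵥ S *ᵥ v))) := by field_simp
    rw [h4]; positivity

variable {n : ℕ}

theorem trace_mul_gram (c : Matrix (Fin k) (Fin k) ℝ) (Δ : Matrix (Fin n) (Fin k) ℝ) :
    (c * (Δᵀ * Δ)).trace = ∑ r, Δ r ⬝ᵥ c *ᵥ Δ r := by
  rw [← Matrix.mul_assoc, Matrix.trace_mul_comm]
  refine Finset.sum_congr rfl fun r _ => ?_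
  rw [Matrix.diag_apply, Matrix.mul_apply]
  refine Finset.sum_congr rfl fun j _ => ?_
  rw [Matrix.mul_apply]
  simp [Matrix.mulVec, dotProduct]

/-- The Procrustes distance is bounded by the distance of the Gram matrices. -/
theorem exists_orthogonal_frob_le (Z₁ Z : Matrix (Fin n) (Fin k) ℝ) {s : ℝ}
    (hs : ∀ x, s ^ 2 * (x ⬝ᵥ x) ≤ (Z *ᵥ x) ⬝ᵥ (Z *ᵥ x)) :
    ∃ R : Matrix (Fin k) (Fin k) ℝ, Rᵀ * R = 1 ∧
      4 / 5 * s ^ 2 * frob (Z₁ - Z * R) ^ 2 ≤ frob (Z₁ * Z₁ᵀ - Z * Zᵀ) ^ 2 := by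
  obtain ⟨R, hR, hsym, hpsd⟩ := exists_orthogonal_mul_psd (Z₁ᵀ * Z)
  refine ⟨R, hR, ?_⟩
  have hR' : R * Rᵀ = 1 := mul_eq_one_comm.1 hR
  set U := Z * R with hU
  have hUU : U * Uᵀ = Z * Zᵀ := by
    rw [hU, Matrix.transpose_mul, Matrix.mul_assoc, ← Matrix.mul_assoc R, hR', Matrix.one_mul]
  have hsU : ∀ x, s ^ 2 * (x ⬝ᵥ x) ≤ x ⬝ᵥ (Uᵀ * U) *ᵥ x := by
    intro x
    have h1 := hs (R *ᵥ x)
    rw [dotProduct_mulVec_orthogonal hR, Matrix.mulVec_mulVec, ← hU] at h1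
    rwa [← Matrix.mulVec_mulVec, Matrix.dotProduct_mulVec, Matrix.vecMul_transpose]
  rw [Matrix.mul_assoc] at hsym hpsd
  change (Z₁ᵀ * U).IsSymm at hsym
  change ∀ v, 0 ≤ v ⬝ᵥ (Z₁ᵀ * U) *ᵥ v at hpsd
  rw [← hUU]
  set Δ := Z₁ - U with hΔ
  set a := Uᵀ * U with ha
  set c := Z₁ᵀ * U with hc
  set b := Z₁ᵀ * Z₁ with hb
  set x := c - a with hx
  set y := Δᵀ * Δ with hy
  have hc' : Uᵀ * Z₁ = c := by
    have h1 : (Z₁ᵀ * U)ᵀ = Z₁ᵀ * U := hsym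
    rw [Matrix.transpose_mul, Matrix.transpose_transpose] at h1
    exact h1
  have hyb : b = y + (2 : ℝ) • x + a := by
    rw [hy, hx, hΔ, Matrix.transpose_sub, Matrix.sub_mul, Matrix.mul_sub, Matrix.mul_sub, hc',
      ← ha, ← hc, ← hb]
    module
  have hca : c = x + a := by rw [hx]; abel
  have hxs : xᵀ = x := by
    rw [hx, Matrix.transpose_sub, hsym.eq, ha, Matrix.transpose_mul, Matrix.transpose_transpose]
  have hys : yᵀ = y := by rw [hy, Matrix.transpose_mul, Matrix.transpose_transpose]
  have e1 : frob (Z₁ * Z₁ᵀ - U * Uᵀ) ^ 2 = (b * b).trace - 2 * (c * c).trace + (a * a).trace := by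
    rw [← trInner_self, trInner_eq_trace]
    have t1 : (Z₁ * Z₁ᵀ - U * Uᵀ)ᵀ = Z₁ * Z₁ᵀ - U * Uᵀ := by
      simp [Matrix.transpose_mul]
    rw [t1, Matrix.sub_mul, Matrix.mul_sub, Matrix.mul_sub, Matrix.trace_sub, Matrix.trace_sub,
      Matrix.trace_sub]
    have s1 : (Z₁ * Z₁ᵀ * (Z₁ * Z₁ᵀ)).trace = (b * b).trace := by
      rw [Matrix.mul_assoc, Matrix.trace_mul_comm, hb]
      simp only [Matrix.mul_assoc]
    have s2 : (U * Uᵀ * (U * Uᵀ)).trace = (a * a).trace := by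
      rw [Matrix.mul_assoc, Matrix.trace_mul_comm, ha]
      simp only [Matrix.mul_assoc]
    have s3 : (Z₁ * Z₁ᵀ * (U * Uᵀ)).trace = (c * c).trace :=
      calc (Z₁ * Z₁ᵀ * (U * Uᵀ)).trace = (Z₁ * (Z₁ᵀ * U) * Uᵀ).trace := by
            simp only [Matrix.mul_assoc]
        _ = (Uᵀ * (Z₁ * (Z₁ᵀ * U))).trace := Matrix.trace_mul_comm _ _
        _ = (Uᵀ * Z₁ * (Z₁ᵀ * U)).trace := by rw [Matrix.mul_assoc]
        _ = (c * c).trace := by rw [hc', ← hc]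
    have s4 : (U * Uᵀ * (Z₁ * Z₁ᵀ)).trace = (c * c).trace := by
      rw [Matrix.trace_mul_comm, s3]
    rw [s1, s2, s3, s4]; ring
  -- Insert `b = y + 2x + a` and `c = x + a` and complete the square. The coefficients `7/5` and
  -- `6/5` leave a nonnegative multiple of every discarded term, and `4/5 tr (a y)` dominates the
  -- claimed distance.
  have e2 : (b * b).trace - 2 * (c * c).trace + (a * a).trace =
      frob (y + (7 / 5 : ℝ) • x) ^ 2 + 1 / 25 * frob x ^ 2 + 6 / 5 * (c * y).trace +
        4 / 5 * (a * y).trace := by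
    have t1 : frob (y + (7 / 5 : ℝ) • x) ^ 2 = ((y + (7 / 5 : ℝ) • x) * (y + (7 / 5 : ℝ) • x)).trace := by
      rw [← trInner_self, trInner_eq_trace, Matrix.transpose_add, Matrix.transpose_smul, hxs, hys]
    have t2 : frob x ^ 2 = (x * x).trace := by
      rw [← trInner_self, trInner_eq_trace, hxs]
    rw [t1, t2, hyb, hca]
    simp only [Matrix.add_mul, Matrix.mul_add, Matrix.smul_mul, Matrix.mul_smul, Matrix.trace_add,
      Matrix.trace_smul, smul_eq_mul, Matrix.trace_mul_comm y x, Matrix.trace_mul_comm y a,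
      Matrix.trace_mul_comm x a]
    ring
  have e3 : 0 ≤ (c * y).trace := by
    rw [hy, trace_mul_gram]
    exact Finset.sum_nonneg fun r _ => hpsd _
  have e4 : s ^ 2 * frob Δ ^ 2 ≤ (a * y).trace := by
    rw [hy, trace_mul_gram, frob_sq, Finset.mul_sum]
    refine Finset.sum_le_sum fun r _ => ?_
    have := hsU (Δ r)
    simpa only [dotProduct, ← sq] using this
  rw [e1, e2]
  nlinarith [sq_nonneg (frob (y + (7 / 5 : ℝ) • x)), sq_nonneg (frob x)]

end Procrustes

/-! ### Singular values, condition number, nuclear norm -/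

section Spectral

theorem exists_spectral {m : Type*} [Fintype m] [DecidableEq m] {H : Matrix m m ℝ}
    (hH : H.IsHermitian) :
    ∃ U : Matrix m m ℝ, Uᵀ * U = 1 ∧ U * Uᵀ = 1 ∧ H = U * Matrix.diagonal hH.eigenvalues * Uᵀ := by
  have h1 := hH.spectral_theorem
  rw [Unitary.conjStarAlgAut_apply] at h1
  refine ⟨hH.eigenvectorUnitary, ?_, ?_, ?_⟩
  · have := Unitary.coe_star_mul_self hH.eigenvectorUnitary
    rwa [Matrix.star_eq_conjTranspose, Matrix.conjTranspose_eq_transpose_of_trivial] at this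
  · have := Unitary.coe_mul_star_self hH.eigenvectorUnitary
    rwa [Unitary.coe_star, Matrix.star_eq_conjTranspose,
      Matrix.conjTranspose_eq_transpose_of_trivial] at this
  · conv_lhs => rw [h1]
    rw [Matrix.star_eq_conjTranspose, Matrix.conjTranspose_eq_transpose_of_trivial]
    rfl

variable {m k : Type*} [Fintype m] [Fintype k]

theorem opNorm_le_of [DecidableEq k] (M : Matrix m k ℝ) {c : ℝ} (hc : 0 ≤ c)
    (h : ∀ x, (M *ᵥ x) ⬝ᵥ (M *ᵥ x) ≤ c ^ 2 * (x ⬝ᵥ x)) : opNorm M ≤ c := by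
  unfold opNorm
  rw [Matrix.l2_opNorm_def]
  refine ContinuousLinearMap.opNorm_le_bound _ hc fun x => ?_
  have e2 : ‖x‖ = √(x.ofLp ⬝ᵥ x.ofLp) := by
    rw [EuclideanSpace.norm_eq]; simp [dotProduct, sq]
  have h1 : √((M *ᵥ x.ofLp) ⬝ᵥ (M *ᵥ x.ofLp)) ≤ c * √(x.ofLp ⬝ᵥ x.ofLp) := by
    refine Real.sqrt_le_iff.2 ⟨by positivity, ?_⟩
    rw [mul_pow, Real.sq_sqrt (dotProduct_self_nonneg' _)]
    exact h _
  rw [e2]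
  refine le_trans (le_of_eq ?_) h1
  rw [EuclideanSpace.norm_eq]
  simp [dotProduct, sq]

theorem mulVec_dotProduct_mulVec (M : Matrix m k ℝ) (x : k → ℝ) :
    (M *ᵥ x) ⬝ᵥ (M *ᵥ x) = x ⬝ᵥ (Mᵀ * M) *ᵥ x := by
  rw [← Matrix.mulVec_mulVec, Matrix.dotProduct_mulVec x, Matrix.vecMul_transpose]

theorem dotProduct_diagonal_conj [DecidableEq m] (U : Matrix m m ℝ) (d : m → ℝ) (x : m → ℝ) :
    x ⬝ᵥ (U * Matrix.diagonal d * Uᵀ) *ᵥ x = ∑ i, d i * (Uᵀ *ᵥ x) i ^ 2 := by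
  rw [← Matrix.mulVec_mulVec, ← Matrix.mulVec_mulVec, Matrix.dotProduct_mulVec,
    ← Matrix.mulVec_transpose, dotProduct]
  refine Finset.sum_congr rfl fun i _ => ?_
  rw [Matrix.mulVec_diagonal]; ring

theorem sq_singVal [DecidableEq k] (M : Matrix m k ℝ) (j : k) :
    singVal M j ^ 2 = (Matrix.isHermitian_conjTranspose_mul_self M).eigenvalues j :=
  Real.sq_sqrt ((Matrix.posSemidef_conjTranspose_mul_self M).eigenvalues_nonneg j)

theorem singVal_nonneg [DecidableEq k] (M : Matrix m k ℝ) (j : k) : 0 ≤ singVal M j :=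
  Real.sqrt_nonneg _

theorem exists_dotProduct_mulVec_eq [DecidableEq k] (M : Matrix m k ℝ) :
    ∃ U : Matrix k k ℝ, Uᵀ * U = 1 ∧ U * Uᵀ = 1 ∧
      ∀ x, (M *ᵥ x) ⬝ᵥ (M *ᵥ x) = ∑ i, singVal M i ^ 2 * (Uᵀ *ᵥ x) i ^ 2 := by
  obtain ⟨U, h1, h2, h3⟩ := exists_spectral (Matrix.isHermitian_conjTranspose_mul_self M)
  refine ⟨U, h1, h2, fun x => ?_⟩
  rw [mulVec_dotProduct_mulVec, ← Matrix.conjTranspose_eq_transpose_of_trivial]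
  simp only [sq_singVal]
  rw [← dotProduct_diagonal_conj, ← h3]

theorem sum_sq_transpose_mulVec [DecidableEq k] {U : Matrix k k ℝ} (h : U * Uᵀ = 1) (x : k → ℝ) :
    ∑ i, (Uᵀ *ᵥ x) i ^ 2 = x ⬝ᵥ x := by
  rw [← dotProduct_mulVec_orthogonal (V := Uᵀ) (by rwa [Matrix.transpose_transpose]) x]
  simp only [dotProduct, sq]

theorem mulVec_dotProduct_le_iSup [DecidableEq k] (M : Matrix m k ℝ) (x : k → ℝ) :
    (M *ᵥ x) ⬝ᵥ (M *ᵥ x) ≤ (⨆ j, singVal M j) ^ 2 * (x ⬝ᵥ x) := by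
  obtain ⟨U, h1, h2, h3⟩ := exists_dotProduct_mulVec_eq M
  rw [h3, ← sum_sq_transpose_mulVec h2, Finset.mul_sum]
  refine Finset.sum_le_sum fun i _ => mul_le_mul_of_nonneg_right ?_ (sq_nonneg _)
  exact pow_le_pow_left₀ (singVal_nonneg M i) (le_ciSup (Finite.bddAbove_range _) i) 2

theorem iInf_le_mulVec_dotProduct [DecidableEq k] (M : Matrix m k ℝ) (x : k → ℝ) :
    (⨅ j, singVal M j) ^ 2 * (x ⬝ᵥ x) ≤ (M *ᵥ x) ⬝ᵥ (M *ᵥ x) := by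
  obtain ⟨U, h1, h2, h3⟩ := exists_dotProduct_mulVec_eq M
  rw [h3, ← sum_sq_transpose_mulVec h2, Finset.mul_sum]
  refine Finset.sum_le_sum fun i _ => mul_le_mul_of_nonneg_right ?_ (sq_nonneg _)
  exact pow_le_pow_left₀ (Real.iInf_nonneg fun j => singVal_nonneg M j)
    (ciInf_le (Finite.bddBelow_range _) i) 2

theorem opNorm_le_iSup_singVal [DecidableEq k] (M : Matrix m k ℝ) :
    opNorm M ≤ ⨆ j, singVal M j :=
  opNorm_le_of M (Real.iSup_nonneg fun j => singVal_nonneg M j) (mulVec_dotProduct_le_iSup M)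

theorem iInf_singVal_pos [DecidableEq k] [Nonempty k] {M : Matrix m k ℝ}
    (h : ∀ j, 0 < singVal M j) : 0 < ⨅ j, singVal M j := by
  obtain ⟨j, hj⟩ := exists_eq_ciInf_of_finite (f := fun j => singVal M j)
  rw [← hj]; exact h j

theorem one_le_condNumber [DecidableEq k] [Nonempty k] {M : Matrix m k ℝ}
    (h : ∀ j, 0 < singVal M j) : 1 ≤ condNumber M := by
  unfold condNumber
  rw [one_le_div (iInf_singVal_pos h)]
  exact (ciInf_le (Finite.bddBelow_range _) (Classical.arbitrary k)).trans
    (le_ciSup (f := fun j => singVal M j) (Finite.bddAbove_range _) (Classical.arbitrary k))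

theorem opNorm_le_condNumber_mul [DecidableEq k] [Nonempty k] {M : Matrix m k ℝ}
    (h : ∀ j, 0 < singVal M j) : opNorm M ≤ condNumber M * ⨅ j, singVal M j := by
  unfold condNumber
  rw [div_mul_cancel₀ _ (iInf_singVal_pos h).ne']
  exact opNorm_le_iSup_singVal M

/-- Compute the trace in a basis of right singular vectors `u`: each term satisfies `⟨u, M u⟩ ≤ ‖M
u‖`, which is the singular value. -/
theorem trace_le_nuclearNorm [DecidableEq m] (M : Matrix m m ℝ) : M.trace ≤ nuclearNorm M := by
  obtain ⟨U, h1, h2, h3⟩ := exists_dotProduct_mulVec_eq M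
  have e1 : M.trace = (Uᵀ * M * U).trace := by
    rw [Matrix.trace_mul_comm, ← Matrix.mul_assoc, h2, Matrix.one_mul]
  rw [e1]
  refine Finset.sum_le_sum fun j _ => ?_
  set u : m → ℝ := U *ᵥ Pi.single j 1 with hu
  have e2 : (Uᵀ * M * U).diag j = u ⬝ᵥ M *ᵥ u := by
    have : (Uᵀ * M * U).diag j = (Pi.single j 1 : m → ℝ) ⬝ᵥ (Uᵀ * M * U) *ᵥ Pi.single j 1 := by simp
    rw [this, ← Matrix.mulVec_mulVec, ← Matrix.mulVec_mulVec, Matrix.dotProduct_mulVec,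
      Matrix.vecMul_transpose]
  have e3 : u ⬝ᵥ u = 1 := by rw [hu, dotProduct_mulVec_orthogonal h1]; simp
  have e4 : Uᵀ *ᵥ u = Pi.single j 1 := by rw [hu, Matrix.mulVec_mulVec, h1, Matrix.one_mulVec]
  have e5 : (M *ᵥ u) ⬝ᵥ (M *ᵥ u) = singVal M j ^ 2 := by
    rw [h3, e4, Finset.sum_eq_single j]
    · simp
    · intro i _ hi; simp [hi]
    · simp
  have h4 := (abs_le.1 (abs_dotProduct_le u (M *ᵥ u))).2
  rw [e3, e5, Real.sqrt_one, one_mul, Real.sqrt_sq (singVal_nonneg M j)] at h4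
  rw [e2]; exact h4

end Spectral

/-! ### Top factors, Eckart–Young, and the distance of factors -/

section TopFactor

variable {n k : ℕ}

theorem frob_diagonal_sq {n : ℕ} (d : Fin n → ℝ) :
    frob (Matrix.diagonal d) ^ 2 = ∑ i, d i ^ 2 := by
  rw [frob_sq]
  refine Finset.sum_congr rfl fun i _ => ?_
  rw [Finset.sum_eq_single i]
  · simp
  · intro j _ hj; rw [Matrix.diagonal_apply_ne _ hj.symm]; simp
  · simp

theorem frob_conj_diagonal_sq {V : Matrix (Fin n) (Fin n) ℝ} (h : Vᵀ * V = 1) (d : Fin n → ℝ) :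
    frob (V * Matrix.diagonal d * Vᵀ) ^ 2 = ∑ i, d i ^ 2 := by
  have h1 := frob_conj_orthogonal (V := Vᵀ) (by rwa [Matrix.transpose_transpose])
    (Matrix.diagonal d)
  rw [Matrix.transpose_transpose] at h1
  rw [h1, frob_diagonal_sq]

/-- An orthonormal eigenbasis whose first `k` vectors give the top factor `Z` of `G`. -/
structure IsTopBasis (G : Matrix (Fin n) (Fin n) ℝ) (Z : Matrix (Fin n) (Fin k) ℝ)
    (V : Matrix (Fin n) (Fin n) ℝ) (d : Fin n → ℝ) : Prop where
  le : k ≤ n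
  left : Vᵀ * V = 1
  right : V * Vᵀ = 1
  anti : Antitone d
  nonneg : ∀ i, 0 ≤ d i
  eq : G = V * Matrix.diagonal d * Vᵀ
  gram : Zᵀ * Z = Matrix.diagonal fun j => d (Fin.castLE le j)
  top : Z * Zᵀ = V * Matrix.diagonal (fun i : Fin n => if (i : ℕ) < k then d i else 0) * Vᵀ

theorem IsTopFactor.exists_basis {G : Matrix (Fin n) (Fin n) ℝ} {Z : Matrix (Fin n) (Fin k) ℝ}
    (hG : G.PosSemidef) (h : IsTopFactor G Z) : ∃ V d, IsTopBasis G Z V d := by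
  obtain ⟨hk, V, hV, d, hd, rfl, hZ⟩ := h
  have h1 : V * Vᵀ = 1 := Matrix.mem_orthogonalGroup_iff (Fin n) ℝ |>.1 hV
  have h2 : Vᵀ * V = 1 := mul_eq_one_comm.1 h1
  have hd0 : ∀ i, 0 ≤ d i := by
    intro i
    have h3 := (hG.conjTranspose_mul_mul_same V).diag_nonneg (i := i)
    have e : Vᴴ * (V * Matrix.diagonal d * Vᵀ) * V = Matrix.diagonal d := by
      rw [Matrix.conjTranspose_eq_transpose_of_trivial]
      calc Vᵀ * (V * Matrix.diagonal d * Vᵀ) * V = (Vᵀ * V) * Matrix.diagonal d * (Vᵀ * V) := by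
            simp only [Matrix.mul_assoc]
        _ = _ := by rw [h2]; simp
    rw [e] at h3
    simpa using h3
  set S : Matrix (Fin n) (Fin k) ℝ :=
    Matrix.of fun i j => if i = Fin.castLE hk j then √(d i) else 0 with hS
  have hZS : Z = V * S := by
    ext i j
    rw [hZ, Matrix.mul_apply, Finset.sum_eq_single (Fin.castLE hk j)]
    · simp [hS]
    · intro l _ hl; simp [hS, hl]
    · simp
  have hinj : Function.Injective (Fin.castLE hk) := Fin.castLE_injective hk
  have hSS : Sᵀ * S = Matrix.diagonal fun j => d (Fin.castLE hk j) := by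
    ext i j
    rw [Matrix.mul_apply, Finset.sum_eq_single (Fin.castLE hk i)]
    · by_cases hij : i = j
      · subst hij; simp [hS, Real.mul_self_sqrt (hd0 _)]
      · simp [hS, hij, hinj.eq_iff]
    · intro l _ hl; simp [hS, hl]
    · simp
  have hSS' : S * Sᵀ = Matrix.diagonal (fun i : Fin n => if (i : ℕ) < k then d i else 0) := by
    ext i j
    rw [Matrix.mul_apply]
    by_cases hi : (i : ℕ) < k
    · rw [Finset.sum_eq_single (⟨i, hi⟩ : Fin k)]
      · have e : Fin.castLE hk ⟨i, hi⟩ = i := rfl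
        by_cases hij : i = j
        · subst hij; simp [hS, e, hi, Real.mul_self_sqrt (hd0 _)]
        · simp [hS, e, hij, Ne.symm hij]
      · intro l _ hl
        have : i ≠ Fin.castLE hk l := by
          rintro h; apply hl; ext; simp [h]
        simp [hS, this]
      · simp
    · have e : ∀ l : Fin k, i ≠ Fin.castLE hk l := by
        rintro l h; apply hi; rw [h]; simp
      have e2 : (Matrix.diagonal (fun i : Fin n => if (i : ℕ) < k then d i else 0) : Matrix _ _ ℝ) i j = 0 := by
        by_cases hij : i = j
        · subst hij; simp [hi]
        · simp [hij]
      rw [e2]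
      exact Finset.sum_eq_zero fun l _ => by simp [hS, e l]
  refine ⟨V, d, hk, h2, h1, hd, hd0, rfl, ?_, ?_⟩
  · rw [hZS, Matrix.transpose_mul, Matrix.mul_assoc, ← Matrix.mul_assoc Vᵀ, h2, Matrix.one_mul, hSS]
  · rw [hZS, Matrix.transpose_mul, ← hSS']
    simp only [Matrix.mul_assoc]

variable {G V : Matrix (Fin n) (Fin n) ℝ} {Z : Matrix (Fin n) (Fin k) ℝ} {d : Fin n → ℝ}

theorem IsTopBasis.conj (h : IsTopBasis G Z V d) : Vᵀ * G * V = Matrix.diagonal d := by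
  rw [h.eq]
  calc Vᵀ * (V * Matrix.diagonal d * Vᵀ) * V = (Vᵀ * V) * Matrix.diagonal d * (Vᵀ * V) := by
        simp only [Matrix.mul_assoc]
    _ = _ := by rw [h.left]; simp

theorem IsTopBasis.sub (h : IsTopBasis G Z V d) : G - Z * Zᵀ =
    V * Matrix.diagonal (fun i : Fin n => if (i : ℕ) < k then 0 else d i) * Vᵀ := by
  rw [h.top]
  nth_rewrite 1 [h.eq]
  rw [← Matrix.sub_mul, ← Matrix.mul_sub, Matrix.diagonal_sub]
  congr 3
  ext i
  split_ifs <;> simp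

theorem IsTopBasis.frob_sub_sq (h : IsTopBasis G Z V d) :
    frob (G - Z * Zᵀ) ^ 2 = ∑ i : Fin n, if (i : ℕ) < k then 0 else d i ^ 2 := by
  rw [h.sub, frob_conj_diagonal_sq h.left]
  exact Finset.sum_congr rfl fun i _ => by split_ifs <;> simp

theorem IsTopBasis.tail_le (h : IsTopBasis G Z V d) :
    ∑ i : Fin n, (if (i : ℕ) < k then 0 else d i) ≤ nuclearNorm (G - Z * Zᵀ) := by
  refine le_trans (le_of_eq ?_) (trace_le_nuclearNorm _)
  rw [h.sub, Matrix.trace_mul_comm, ← Matrix.mul_assoc, h.left, Matrix.one_mul,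
    Matrix.trace_diagonal]

theorem IsTopBasis.le_opNorm (h : IsTopBasis G Z V d) (i : Fin n) : d i ≤ opNorm G := by
  have := ((bilinBound_opNorm G).conj h.left).apply_self i
  rw [h.conj, Matrix.diagonal_apply_eq] at this
  exact (le_abs_self _).trans this

/-- The largest eigenvalue links the two sides: it bounds `‖G‖` from above, and it is attained by
`ZᵀZ` at the first coordinate vector, which requires `k ≥ 1`. -/
theorem IsTopBasis.opNorm_le (h : IsTopBasis G Z V d) (hk : 1 ≤ k) : opNorm G ≤ opNorm Z ^ 2 := by
  have hn : 0 < n := by have := h.le; omega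
  set i₀ : Fin n := ⟨0, hn⟩
  have h1 : d i₀ ≤ opNorm Z ^ 2 := by
    have h2 := sqrt_mulVec_le Z (Pi.single (⟨0, hk⟩ : Fin k) 1)
    rw [mulVec_dotProduct_mulVec, h.gram] at h2
    have e : Fin.castLE h.le ⟨0, hk⟩ = i₀ := rfl
    simp [e] at h2
    exact (Real.sqrt_le_left (opNorm_nonneg Z)).1 h2
  refine le_trans (opNorm_le_of G (h.nonneg i₀) fun x => ?_) h1
  have hGG : Gᵀ * G = V * Matrix.diagonal (fun i => d i ^ 2) * Vᵀ := by
    have ht : Gᵀ = G := by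
      rw [h.eq, Matrix.transpose_mul, Matrix.transpose_mul, Matrix.transpose_transpose,
        Matrix.diagonal_transpose, Matrix.mul_assoc]
    rw [ht, h.eq]
    calc V * Matrix.diagonal d * Vᵀ * (V * Matrix.diagonal d * Vᵀ)
        = V * Matrix.diagonal d * (Vᵀ * V) * Matrix.diagonal d * Vᵀ := by
          simp only [Matrix.mul_assoc]
      _ = _ := by
        rw [h.left, Matrix.mul_one, Matrix.mul_assoc V, Matrix.diagonal_mul_diagonal]
        simp only [sq]
  rw [mulVec_dotProduct_mulVec, hGG, dotProduct_diagonal_conj, ← sum_sq_transpose_mulVec h.right,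
    Finset.mul_sum]
  refine Finset.sum_le_sum fun i _ => mul_le_mul_of_nonneg_right ?_ (sq_nonneg _)
  exact pow_le_pow_left₀ (h.nonneg i) (h.anti (Fin.mk_le_mk.2 (Nat.zero_le _))) 2

theorem IsTopBasis.frob_sq_le (h : IsTopBasis G Z V d) :
    frob G ^ 2 ≤ k * opNorm G ^ 2 + frob (G - Z * Zᵀ) ^ 2 := by
  rw [h.frob_sub_sq]
  have e : frob G ^ 2 = ∑ i, d i ^ 2 := by
    nth_rewrite 1 [h.eq]; rw [frob_conj_diagonal_sq h.left]
  rw [e]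
  have h1 : ∑ i : Fin n, (if (i : ℕ) < k then opNorm G ^ 2 else 0) ≤ k * opNorm G ^ 2 := by
    rw [← Finset.sum_filter, Finset.sum_const, nsmul_eq_mul]
    exact mul_le_mul_of_nonneg_right (card_filter_lt_le n k) (sq_nonneg _)
  refine le_trans ?_ (add_le_add_left h1 _)
  rw [← Finset.sum_add_distrib]
  refine Finset.sum_le_sum fun i _ => ?_
  split_ifs
  · rw [add_zero]; exact pow_le_pow_left₀ (h.nonneg i) (h.le_opNorm i) 2
  · rw [zero_add]

/-- Weighted sums of a non-increasing sequence with total weight equal to the length of the tail. -/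
theorem sum_tail_le_sum_mul (hk : 1 ≤ k) (hkn : k ≤ n) {e w : Fin n → ℝ} (he : Antitone e)
    (hw0 : ∀ j, 0 ≤ w j) (hw1 : ∀ j, w j ≤ 1)
    (hw : ∑ j, w j = ∑ j : Fin n, if (j : ℕ) < k then 0 else 1) :
    ∑ j : Fin n, (if (j : ℕ) < k then 0 else e j) ≤ ∑ j, e j * w j := by
  -- Comparison with the threshold `τ`: weight on `e ≥ τ` can only increase the sum, weight missing
  -- on `e ≤ τ` can only be replaced by something larger. Equal total weights cancel `τ`.
  set τ := e ⟨k - 1, by omega⟩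
  have h1 : ∑ j : Fin n, (if (j : ℕ) < k then 0 else e j) - τ * ∑ j : Fin n, (if (j : ℕ) < k then 0 else 1) ≤
      ∑ j, e j * w j - τ * ∑ j, w j := by
    rw [Finset.mul_sum, Finset.mul_sum, ← Finset.sum_sub_distrib, ← Finset.sum_sub_distrib]
    refine Finset.sum_le_sum fun j _ => ?_
    split_ifs with hj
    · have h2 : τ ≤ e j := he (Fin.mk_le_mk.2 (by omega))
      nlinarith [hw0 j]
    · have h2 : e j ≤ τ := he (Fin.mk_le_mk.2 (by omega))
      nlinarith [hw1 j]
  rw [hw] at h1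
  linarith

/-- Eckart-Young: the top factor gives the best rank `k` approximation. -/
theorem IsTopBasis.frob_sub_le {G₁ V₁ : Matrix (Fin n) (Fin n) ℝ} {Z₁ : Matrix (Fin n) (Fin k) ℝ}
    {d₁ : Fin n → ℝ} (hk : 1 ≤ k) (h₁ : IsTopBasis G₁ Z₁ V₁ d₁) (h : IsTopBasis G Z V d) :
    frob (G₁ - Z₁ * Z₁ᵀ) ≤ frob (G₁ - Z * Zᵀ) := by
  refine abs_le_of_sq_le_sq' ?_ (frob_nonneg _) |>.2
  rw [h₁.frob_sub_sq]
  obtain ⟨O, hO⟩ : ∃ O, O = Vᵀ * V₁ := ⟨_, rfl⟩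
  have hO1 : Oᵀ * O = 1 := by
    rw [hO, Matrix.transpose_mul, Matrix.transpose_transpose, Matrix.mul_assoc, ← Matrix.mul_assoc V,
      h.right, Matrix.one_mul, h₁.left]
  have hO2 : O * Oᵀ = 1 := mul_eq_one_comm.1 hO1
  have hcol : ∀ j, ∑ i, O i j ^ 2 = 1 := by
    intro j
    have := congrFun (congrFun hO1 j) j
    simpa [Matrix.mul_apply, sq] using this
  have hrow : ∀ i, ∑ j, O i j ^ 2 = 1 := by
    intro i
    have := congrFun (congrFun hO2 i) i
    simpa [Matrix.mul_apply, sq] using this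
  set H := Vᵀ * G₁ * V with hH
  have hHO : H = O * Matrix.diagonal d₁ * Oᵀ := by
    rw [hH, h₁.eq, hO, Matrix.transpose_mul, Matrix.transpose_transpose]
    simp only [Matrix.mul_assoc]
  have hHrow : ∀ i, ∑ j, H i j ^ 2 = ∑ j, d₁ j ^ 2 * O i j ^ 2 := by
    intro i
    have e1 : ∑ j, H i j ^ 2 = (H * Hᵀ) i i := by simp [Matrix.mul_apply, sq]
    have e2 : H * Hᵀ = O * Matrix.diagonal (fun j => d₁ j ^ 2) * Oᵀ := by
      rw [hHO, Matrix.transpose_mul, Matrix.transpose_mul, Matrix.transpose_transpose,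
        Matrix.diagonal_transpose]
      calc O * Matrix.diagonal d₁ * Oᵀ * (O * (Matrix.diagonal d₁ * Oᵀ))
          = O * Matrix.diagonal d₁ * (Oᵀ * O) * Matrix.diagonal d₁ * Oᵀ := by
            simp only [Matrix.mul_assoc]
        _ = _ := by
          rw [hO1, Matrix.mul_one, Matrix.mul_assoc O, Matrix.diagonal_mul_diagonal]
          simp only [sq]
    rw [e1, e2, Matrix.mul_apply]
    refine Finset.sum_congr rfl fun j _ => ?_
    rw [Matrix.mul_diagonal, Matrix.transpose_apply]; ring
  have hB : Vᵀ * (Z * Zᵀ) * V = Matrix.diagonal (fun i : Fin n => if (i : ℕ) < k then d i else 0) := by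
    rw [h.top]
    calc Vᵀ * (V * Matrix.diagonal (fun i : Fin n => if (i : ℕ) < k then d i else 0) * Vᵀ) * V
        = (Vᵀ * V) * Matrix.diagonal (fun i : Fin n => if (i : ℕ) < k then d i else 0) * (Vᵀ * V) := by
          simp only [Matrix.mul_assoc]
      _ = _ := by rw [h.left]; simp
  have e1 : frob (G₁ - Z * Zᵀ) ^ 2 = ∑ i, ∑ j, (H i j -
      (Matrix.diagonal (fun i : Fin n => if (i : ℕ) < k then d i else 0) : Matrix _ _ ℝ) i j) ^ 2 := by
    rw [← frob_conj_orthogonal h.right, Matrix.mul_sub, Matrix.sub_mul, hB, frob_sq]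
    rfl
  -- In the basis `V` the matrix `Z Zᵀ` vanishes on the rows `i ≥ k`, and only these rows are kept
  -- in the lower bound. Their squared norm is a weighted sum of `d₁ j ^ 2` with weights in `[0, 1]`
  -- of total `n - k`, hence at least the tail.
  have hw : ∀ j, ∑ i : Fin n, (if (i : ℕ) < k then 0 else O i j ^ 2) ≤ 1 := fun j => by
    rw [← hcol j]
    exact Finset.sum_le_sum fun i _ => by split_ifs; exacts [sq_nonneg _, le_rfl]
  have hw0 : ∀ j, 0 ≤ ∑ i : Fin n, (if (i : ℕ) < k then 0 else O i j ^ 2) := fun j =>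
    Finset.sum_nonneg fun i _ => by split_ifs; exacts [le_rfl, sq_nonneg _]
  have hanti : Antitone fun j => d₁ j ^ 2 := fun i j hij =>
    pow_le_pow_left₀ (h₁.nonneg j) (h₁.anti hij) 2
  refine (sum_tail_le_sum_mul hk h.le hanti hw0 hw ?_).trans ?_
  · rw [Finset.sum_comm]
    refine Finset.sum_congr rfl fun i _ => ?_
    split_ifs
    · simp
    · exact hrow i
  · rw [e1]
    simp only [Finset.mul_sum]
    rw [Finset.sum_comm]
    refine Finset.sum_le_sum fun i _ => ?_
    by_cases hi : (i : ℕ) < k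
    · simp only [hi, if_true, mul_zero, Finset.sum_const_zero]
      exact Finset.sum_nonneg fun j _ => sq_nonneg _
    · simp only [hi, if_false]
      rw [← hHrow]
      refine le_of_eq (Finset.sum_congr rfl fun j _ => ?_)
      by_cases hij : i = j
      · subst hij; simp [hi]
      · simp [hij]

theorem orthDist_nonneg (Z₁ Z₂ : Matrix (Fin n) (Fin k) ℝ) : 0 ≤ orthDist Z₁ Z₂ :=
  Real.iInf_nonneg fun _ => frob_nonneg _

theorem orthDist_le (Z₁ Z₂ : Matrix (Fin n) (Fin k) ℝ) {R : Matrix (Fin k) (Fin k) ℝ}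
    (hR : Rᵀ * R = 1) : orthDist Z₁ Z₂ ≤ frob (Z₁ - Z₂ * R) :=
  ciInf_le (f := fun R : Matrix.orthogonalGroup (Fin k) ℝ =>
      frob (Z₁ - Z₂ * (R : Matrix (Fin k) (Fin k) ℝ)))
    ⟨0, by rintro _ ⟨R, rfl⟩; exact frob_nonneg _⟩
    ⟨R, (Matrix.mem_orthogonalGroup_iff (Fin k) ℝ).2 (mul_eq_one_comm.1 hR)⟩

/-- The distance of the top factors of two matrices, scaled by the operator norm. -/
theorem opNorm_sq_mul_orthDist_sq_le {G₁ : Matrix (Fin n) (Fin n) ℝ}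
    {Z₁ : Matrix (Fin n) (Fin k) ℝ} (hk : 1 ≤ k) (hG₁ : G₁.PosSemidef) (hG : G.PosSemidef)
    (h₁ : IsTopFactor G₁ Z₁) (h : IsTopFactor G Z) (hZ : ∀ j, 0 < singVal Z j) :
    opNorm Z ^ 2 * orthDist Z₁ Z ^ 2 ≤
      5 * condNumber Z ^ 2 * (frob (G₁ - G) + frob (G - Z * Zᵀ)) ^ 2 := by
  have : Nonempty (Fin k) := ⟨⟨0, hk⟩⟩
  obtain ⟨V₁, d₁, hb₁⟩ := h₁.exists_basis hG₁
  obtain ⟨V, d, hb⟩ := h.exists_basis hG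
  obtain ⟨R, hR, hfr⟩ := exists_orthogonal_frob_le Z₁ Z (iInf_le_mulVec_dotProduct Z)
  have h1 : orthDist Z₁ Z ^ 2 ≤ frob (Z₁ - Z * R) ^ 2 :=
    pow_le_pow_left₀ (orthDist_nonneg _ _) (orthDist_le Z₁ Z hR) 2
  have h2 : opNorm Z ^ 2 ≤ (condNumber Z * ⨅ j, singVal Z j) ^ 2 :=
    pow_le_pow_left₀ (opNorm_nonneg _) (opNorm_le_condNumber_mul hZ) 2
  -- Eckart–Young bounds the truncation error of `G₁` by `‖G₁ - Z Zᵀ‖`, so no perturbation theory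
  -- for eigenspaces is needed.
  have h3 : frob (Z₁ * Z₁ᵀ - Z * Zᵀ) ≤ 2 * (frob (G₁ - G) + frob (G - Z * Zᵀ)) := by
    have a1 := LatentSpace.frob_sub_le (Z₁ * Z₁ᵀ) G₁ (Z * Zᵀ)
    rw [frob_sub_comm (Z₁ * Z₁ᵀ) G₁] at a1
    have a2 := hb₁.frob_sub_le hk hb
    have a3 := LatentSpace.frob_sub_le G₁ G (Z * Zᵀ)
    linarith
  have h4 := pow_le_pow_left₀ (frob_nonneg _) h3 2
  calc opNorm Z ^ 2 * orthDist Z₁ Z ^ 2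
      ≤ (condNumber Z * ⨅ j, singVal Z j) ^ 2 * frob (Z₁ - Z * R) ^ 2 :=
        mul_le_mul h2 h1 (sq_nonneg _) (sq_nonneg _)
    _ = condNumber Z ^ 2 * (5 / 4) * (4 / 5 * (⨅ j, singVal Z j) ^ 2 * frob (Z₁ - Z * R) ^ 2) := by
        ring
    _ ≤ condNumber Z ^ 2 * (5 / 4) * (2 * (frob (G₁ - G) + frob (G - Z * Zᵀ))) ^ 2 :=
        mul_le_mul_of_nonneg_left (hfr.trans h4) (by positivity)
    _ = _ := by ring

end TopFactor

/-! ### Curvature of the logistic loss -/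

section Softplus

/-- The softplus function, an antiderivative of the sigmoid function. -/
noncomputable def softplus (x : ℝ) : ℝ := Real.log (1 + Real.exp x)

theorem hasDerivAt_softplus (x : ℝ) : HasDerivAt softplus (Real.sigmoid x) x := by
  have h1 : HasDerivAt (fun y => 1 + Real.exp y) (Real.exp x) x :=
    (Real.hasDerivAt_exp x).const_add 1
  have h2 := h1.log (by positivity)
  refine HasDerivAt.congr_deriv (f := softplus) h2 ?_
  rw [Real.sigmoid_def, Real.exp_neg]
  have := Real.exp_pos x
  field_simp
  ring

theorem continuous_softplus : Continuous softplus :=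
  continuous_iff_continuousAt.2 fun x => (hasDerivAt_softplus x).continuousAt

/-- The tangent inequality for a function with monotone derivative. -/
theorem tangent_le_of_monotoneOn {f f' : ℝ → ℝ} {D : Set ℝ} (hD : D.OrdConnected)
    (hf : ∀ x, HasDerivAt f (f' x) x) (hm : MonotoneOn f' D) {a b : ℝ} (ha : a ∈ D) (hb : b ∈ D) :
    f' a * (b - a) ≤ f b - f a := by
  have hc : Continuous f := continuous_iff_continuousAt.2 fun x => (hf x).continuousAt
  rcases lt_trichotomy a b with h | h | h
  · obtain ⟨c, hc, hs⟩ := exists_hasDerivAt_eq_slope f f' h hc.continuousOn fun x _ => hf x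
    have h1 : f' a ≤ f' c := hm ha (hD.out ha hb ⟨hc.1.le, hc.2.le⟩) hc.1.le
    have h2 : 0 < b - a := sub_pos.2 h
    rw [eq_div_iff h2.ne'] at hs
    nlinarith
  · subst h; simp
  · obtain ⟨c, hc, hs⟩ := exists_hasDerivAt_eq_slope f f' h hc.continuousOn fun x _ => hf x
    have h1 : f' c ≤ f' a := hm (hD.out hb ha ⟨hc.1.le, hc.2.le⟩) ha hc.2.le
    have h2 : 0 < a - b := sub_pos.2 h
    rw [eq_div_iff h2.ne'] at hs
    nlinarith

theorem sigmoid_deriv_ge {M x : ℝ} (hx : |x| ≤ M) :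
    Real.exp (-M) / 4 ≤ Real.sigmoid x * (1 - Real.sigmoid x) := by
  have hM : 0 ≤ M := (abs_nonneg x).trans hx
  have h1 : Real.exp x ≤ Real.exp M := Real.exp_le_exp.2 ((le_abs_self x).trans hx)
  have h2 : Real.exp (-x) ≤ Real.exp M := Real.exp_le_exp.2 ((neg_le_abs x).trans hx)
  have h3 : 1 ≤ Real.exp M := Real.one_le_exp hM
  have h4 : Real.exp x * Real.exp (-x) = 1 := by rw [← Real.exp_add]; simp
  have h5 : Real.sigmoid x * (1 - Real.sigmoid x) = (2 + Real.exp x + Real.exp (-x))⁻¹ := by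
    rw [Real.sigmoid_def]
    have := Real.exp_pos (-x)
    have e : Real.exp x = (Real.exp (-x))⁻¹ := by rw [Real.exp_neg, inv_inv]
    rw [e]
    field_simp
    ring
  rw [h5, Real.exp_neg]
  have e : (Real.exp M)⁻¹ / 4 = (4 * Real.exp M)⁻¹ := by rw [mul_inv]; ring
  rw [e]
  exact inv_anti₀ (by positivity) (by linarith)

theorem sigmoid_deriv_le (x : ℝ) : Real.sigmoid x * (1 - Real.sigmoid x) ≤ 1 / 4 := by
  nlinarith [sq_nonneg (Real.sigmoid x - 1 / 2)]

/-- The Bregman divergence of the softplus function. -/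
noncomputable def bregman (a b : ℝ) : ℝ := softplus b - softplus a - Real.sigmoid a * (b - a)

/-- Tangent inequality for `x²/8 - softplus x`, which is convex because `σ' ≤ 1/4`. -/
theorem bregman_le (a b : ℝ) : bregman a b ≤ 1 / 8 * (b - a) ^ 2 := by
  have h1 : ∀ x, HasDerivAt (fun x => 1 / 8 * x ^ 2 - softplus x) (1 / 4 * x - Real.sigmoid x) x := by
    intro x
    have := ((hasDerivAt_pow 2 x).const_mul (1 / 8)).sub (hasDerivAt_softplus x)
    exact this.congr_deriv (by norm_num; ring)
  have h2 : MonotoneOn (fun x => 1 / 4 * x - Real.sigmoid x) Set.univ := by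
    rw [monotoneOn_univ]
    have h3 : ∀ x, HasDerivAt (fun x => 1 / 4 * x - Real.sigmoid x)
        (1 / 4 - Real.sigmoid x * (1 - Real.sigmoid x)) x := by
      intro x
      have := ((hasDerivAt_id x).const_mul (1 / 4)).sub (Real.hasDerivAt_sigmoid x)
      exact this.congr_deriv (by simp)
    refine monotone_of_deriv_nonneg (fun x => (h3 x).differentiableAt) fun x => ?_
    rw [(h3 x).deriv]
    linarith [sigmoid_deriv_le x]
  have h4 := tangent_le_of_monotoneOn Set.ordConnected_univ h1 h2 (Set.mem_univ a) (Set.mem_univ b)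
  unfold bregman
  nlinarith

/-- Tangent inequality for `softplus x - e^{-M} x²/8`, which is convex only on `[-M, M]`. This is
where boundedness of `Θ` enters. -/
theorem le_bregman {M a b : ℝ} (ha : |a| ≤ M) (hb : |b| ≤ M) :
    Real.exp (-M) / 8 * (b - a) ^ 2 ≤ bregman a b := by
  set m := Real.exp (-M)
  have h1 : ∀ x, HasDerivAt (fun x => softplus x - m / 8 * x ^ 2) (Real.sigmoid x - m / 4 * x) x := by
    intro x
    have := (hasDerivAt_softplus x).sub ((hasDerivAt_pow 2 x).const_mul (m / 8))
    exact this.congr_deriv (by norm_num; ring)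
  have h3 : ∀ x, HasDerivAt (fun x => Real.sigmoid x - m / 4 * x)
      (Real.sigmoid x * (1 - Real.sigmoid x) - m / 4) x := by
    intro x
    have := (Real.hasDerivAt_sigmoid x).sub ((hasDerivAt_id x).const_mul (m / 4))
    exact this.congr_deriv (by simp)
  have h2 : MonotoneOn (fun x => Real.sigmoid x - m / 4 * x) (Set.Icc (-M) M) := by
    refine monotoneOn_of_deriv_nonneg (convex_Icc _ _)
      (fun x _ => (h3 x).continuousAt.continuousWithinAt)
      (fun x _ => (h3 x).differentiableAt.differentiableWithinAt) fun x hx => ?_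
    rw [(h3 x).deriv]
    have h5 : x ∈ Set.Icc (-M) M := interior_subset hx
    linarith [sigmoid_deriv_ge (abs_le.2 h5)]
  have h4 := tangent_le_of_monotoneOn Set.ordConnected_Icc h1 h2 (abs_le.1 ha) (abs_le.1 hb)
  unfold bregman
  nlinarith

theorem bregman_nonneg (a b : ℝ) : 0 ≤ bregman a b :=
  le_trans (by positivity)
    (le_bregman (le_max_left |a| |b|) (le_max_right |a| |b|))

end Softplus

/-! ### Metric projections onto the constraint sets -/

section Projection

variable {n : ℕ}

/-- The first-order condition for a minimum at the end of a segment; all three projection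
inequalities below reduce to it. -/
theorem nonpos_of_forall_le_quadratic {a b c : ℝ}
    (h : ∀ t : ℝ, 0 ≤ t → t ≤ 1 → a ≤ a - 2 * t * b + t ^ 2 * c) : b ≤ 0 := by
  by_contra! hb
  have hc : 0 < |c| + b := by positivity
  have h1 := h (b / (|c| + b)) (by positivity) (by rw [div_le_one hc]; linarith [abs_nonneg c])
  have h2 : b / (|c| + b) * (|c| + b) = b := div_mul_cancel₀ _ hc.ne'
  have h3 : 0 < b / (|c| + b) := by positivity
  set t := b / (|c| + b)
  have h4 : t * c ≤ b := by nlinarith [le_abs_self c]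
  nlinarith

theorem nearest_spec {E : Type*} [AddGroup E] [TopologicalSpace E] {size : E → ℝ} {C : Set E}
    (hC : IsCompact C) (hne : C.Nonempty) (y : E) (hs : Continuous fun p => size (y - p)) :
    nearest size C y ∈ C ∧ ∀ q ∈ C, size (y - nearest size C y) ≤ size (y - q) := by
  obtain ⟨p, hp, hmin⟩ := hC.exists_isMinOn hne hs.continuousOn
  exact Classical.epsilon_spec (p := fun p => p ∈ C ∧ ∀ q ∈ C, size (y - p) ≤ size (y - q))
    ⟨p, hp, fun q hq => hmin hq⟩

theorem continuous_frob {m k : Type*} [Fintype m] [Fintype k] :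
    Continuous (frob : Matrix m k ℝ → ℝ) := by
  unfold frob; fun_prop

theorem isCompact_setG (n : ℕ) (rG : ℝ) : IsCompact (setG n rG) := by
  have h1 : IsCompact (Set.univ.pi fun _ : Fin n => Set.univ.pi fun _ : Fin n =>
      Set.Icc (-rG) rG) :=
    isCompact_univ_pi fun _ => isCompact_univ_pi fun _ => isCompact_Icc
  refine IsCompact.of_isClosed_subset h1 ?_ ?_
  · have h2 : setG n rG = {G : Matrix (Fin n) (Fin n) ℝ | Gᵀ = G} ∩ {G | ∀ x, 0 ≤ x ⬝ᵥ G *ᵥ x} ∩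
        {G | centering n * G = G} ∩ {G | ∀ i j, |G i j| ≤ rG} := by
      ext G
      simp only [setG, Set.mem_ofPred_eq, Set.mem_inter_iff, Matrix.posSemidef_iff_dotProduct_mulVec,
        star_trivial, Matrix.IsHermitian, Matrix.conjTranspose_eq_transpose_of_trivial, and_assoc]
    rw [h2]
    refine ((IsClosed.inter ?_ ?_).inter ?_).inter ?_
    · exact isClosed_eq (by fun_prop) continuous_id
    · simp only [Set.ofPred_forall]
      exact isClosed_iInter fun x => isClosed_le continuous_const (by fun_prop)
    · exact isClosed_eq (by fun_prop) continuous_id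
    · simp only [Set.ofPred_forall]
      exact isClosed_iInter fun i => isClosed_iInter fun j =>
        isClosed_le (by fun_prop) continuous_const
  · intro G hG i _ j _
    exact abs_le.1 (hG.2.2 i j)

theorem isCompact_setα (n : ℕ) (rα : ℝ) : IsCompact (setα n rα) := by
  have h1 : IsCompact (Set.univ.pi fun _ : Fin n => Set.Icc (-rα) rα) :=
    isCompact_univ_pi fun _ => isCompact_Icc
  convert h1 using 1
  ext α
  simp only [setα, Set.mem_ofPred_eq, abs_le, Set.mem_pi, Set.mem_univ, forall_true_left, Set.mem_Icc]

/-- For `X = 0` and `rβ ≥ 0` the set is all of `ℝ`, so this case is treated separately throughout.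
-/
theorem isCompact_setβ {X : Matrix (Fin n) (Fin n) ℝ} (hX : X ≠ 0) (rβ : ℝ) :
    IsCompact (setβ X rβ) := by
  obtain ⟨i, j, hij⟩ : ∃ i j, X i j ≠ 0 := by
    by_contra! h; exact hX (Matrix.ext h)
  have hp : 0 < |X i j| := abs_pos.2 hij
  refine IsCompact.of_isClosed_subset (isCompact_Icc (a := -(rβ / |X i j|)) (b := rβ / |X i j|)) ?_ ?_
  · have : setβ X rβ = ⋂ i, ⋂ j, {β : ℝ | |β| * |X i j| ≤ rβ} := by ext β; simp [setβ]
    rw [this]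
    exact isClosed_iInter fun i => isClosed_iInter fun j =>
      isClosed_le (by fun_prop) continuous_const
  · intro β hβ
    exact abs_le.1 ((le_div_iff₀ hp).2 (hβ i j))

theorem convex_setG (n : ℕ) (rG : ℝ) : Convex ℝ (setG n rG) := by
  intro G hG H hH a b ha hb hab
  refine ⟨(hG.1.smul ha).add (hH.1.smul hb), ?_, fun i j => ?_⟩
  · rw [mul_add, Matrix.mul_smul, Matrix.mul_smul, hG.2.1, hH.2.1]
  · have h1 := hG.2.2 i j
    have h2 := hH.2.2 i j
    calc |(a • G + b • H) i j| ≤ |a * G i j| + |b * H i j| := abs_add_le _ _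
      _ = a * |G i j| + b * |H i j| := by rw [abs_mul, abs_mul, abs_of_nonneg ha, abs_of_nonneg hb]
      _ ≤ a * rG + b * rG := by gcongr
      _ = rG := by rw [← add_mul, hab, one_mul]

theorem convex_setα (n : ℕ) (rα : ℝ) : Convex ℝ (setα n rα) := by
  intro G hG H hH a b ha hb hab i
  have h1 := hG i
  have h2 := hH i
  calc |(a • G + b • H) i| ≤ |a * G i| + |b * H i| := abs_add_le _ _
    _ = a * |G i| + b * |H i| := by rw [abs_mul, abs_mul, abs_of_nonneg ha, abs_of_nonneg hb]
    _ ≤ a * rα + b * rα := by gcongr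
    _ = rα := by rw [← add_mul, hab, one_mul]

theorem convex_setβ (X : Matrix (Fin n) (Fin n) ℝ) (rβ : ℝ) : Convex ℝ (setβ X rβ) := by
  intro G hG H hH a b ha hb hab i j
  have h1 := hG i j
  have h2 := hH i j
  have h3 : |a • G + b • H| ≤ a * |G| + b * |H| := by
    refine (abs_add_le _ _).trans (le_of_eq ?_)
    rw [smul_eq_mul, smul_eq_mul, abs_mul, abs_mul, abs_of_nonneg ha, abs_of_nonneg hb]
  calc |a • G + b • H| * |X i j| ≤ (a * |G| + b * |H|) * |X i j| :=
        mul_le_mul_of_nonneg_right h3 (abs_nonneg _)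
    _ = a * (|G| * |X i j|) + b * (|H| * |X i j|) := by ring
    _ ≤ a * rβ + b * rβ := by gcongr
    _ = rβ := by rw [← add_mul, hab, one_mul]

theorem zero_mem_setG {rG : ℝ} (h : 0 ≤ rG) : (0 : Matrix (Fin n) (Fin n) ℝ) ∈ setG n rG :=
  ⟨Matrix.PosSemidef.zero, by simp, fun i j => by simpa using h⟩

theorem zero_mem_setα {rα : ℝ} (h : 0 ≤ rα) : (0 : Fin n → ℝ) ∈ setα n rα := fun i => by simpa using h

theorem zero_mem_setβ {X : Matrix (Fin n) (Fin n) ℝ} {rβ : ℝ} (h : 0 ≤ rβ) : (0 : ℝ) ∈ setβ X rβ :=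
  fun i j => by simpa using h

theorem vecNorm_sq (v : Fin n → ℝ) : vecNorm v ^ 2 = ∑ i, v i ^ 2 :=
  Real.sq_sqrt (Finset.sum_nonneg fun _ _ => sq_nonneg _)

theorem add_smul_sub_mem {E : Type*} [AddCommGroup E] [Module ℝ E] {C : Set E} (hC : Convex ℝ C)
    {p q : E} (hp : p ∈ C) (hq : q ∈ C) {t : ℝ} (h0 : 0 ≤ t) (h1 : t ≤ 1) :
    p + t • (q - p) ∈ C := by
  have := hC hp hq (sub_nonneg.2 h1) h0 (by ring)
  convert this using 1
  module

theorem nearest_setG {rG : ℝ} (h : 0 ≤ rG) (y : Matrix (Fin n) (Fin n) ℝ) :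
    nearest frob (setG n rG) y ∈ setG n rG ∧ ∀ q ∈ setG n rG,
      trInner (y - nearest frob (setG n rG) y) (q - nearest frob (setG n rG) y) ≤ 0 := by
  obtain ⟨h1, h2⟩ := nearest_spec (isCompact_setG n rG) ⟨0, zero_mem_setG h⟩ y
    (size := frob) (continuous_frob.comp (by fun_prop))
  refine ⟨h1, fun q hq => ?_⟩
  set p := nearest frob (setG n rG) y
  refine nonpos_of_forall_le_quadratic (a := frob (y - p) ^ 2) (c := frob (q - p) ^ 2)
    fun t ht0 ht1 => ?_
  have h3 := pow_le_pow_left₀ (frob_nonneg _)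
    (h2 _ (add_smul_sub_mem (convex_setG n rG) h1 hq ht0 ht1)) 2
  refine h3.trans (le_of_eq ?_)
  have e : y - (p + t • (q - p)) = (y - p) + (-t) • (q - p) := by module
  rw [e, frob_add_sq, trInner_smul_right, frob_smul, mul_pow, sq_abs]
  ring

theorem nearest_setα {rα : ℝ} (h : 0 ≤ rα) (y : Fin n → ℝ) :
    nearest vecNorm (setα n rα) y ∈ setα n rα ∧ ∀ q ∈ setα n rα,
      ∑ i, (y i - nearest vecNorm (setα n rα) y i) * (q i - nearest vecNorm (setα n rα) y i) ≤ 0 := by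
  obtain ⟨h1, h2⟩ := nearest_spec (isCompact_setα n rα) ⟨0, zero_mem_setα h⟩ y
    (size := vecNorm) (by unfold vecNorm; fun_prop)
  refine ⟨h1, fun q hq => ?_⟩
  set p := nearest vecNorm (setα n rα) y
  refine nonpos_of_forall_le_quadratic (a := ∑ i, (y i - p i) ^ 2) (c := ∑ i, (q i - p i) ^ 2)
    fun t ht0 ht1 => ?_
  have h3 := pow_le_pow_left₀ (Real.sqrt_nonneg _)
    (h2 _ (add_smul_sub_mem (convex_setα n rα) h1 hq ht0 ht1)) 2
  change vecNorm _ ^ 2 ≤ vecNorm _ ^ 2 at h3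
  rw [vecNorm_sq, vecNorm_sq] at h3
  refine h3.trans (le_of_eq ?_)
  rw [Finset.mul_sum, Finset.mul_sum, ← Finset.sum_sub_distrib, ← Finset.sum_add_distrib]
  refine Finset.sum_congr rfl fun i _ => ?_
  simp only [Pi.sub_apply, Pi.add_apply, Pi.smul_apply, smul_eq_mul]
  ring

theorem nearest_setβ {X : Matrix (Fin n) (Fin n) ℝ} (hX : X ≠ 0) {rβ : ℝ} (h : 0 ≤ rβ) (y : ℝ) :
    nearest abs (setβ X rβ) y ∈ setβ X rβ ∧ ∀ q ∈ setβ X rβ,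
      (y - nearest abs (setβ X rβ) y) * (q - nearest abs (setβ X rβ) y) ≤ 0 := by
  obtain ⟨h1, h2⟩ := nearest_spec (isCompact_setβ hX rβ) ⟨0, zero_mem_setβ h⟩ y
    (size := abs) (by fun_prop)
  refine ⟨h1, fun q hq => ?_⟩
  set p := nearest abs (setβ X rβ) y
  refine nonpos_of_forall_le_quadratic (a := (y - p) ^ 2) (c := (q - p) ^ 2)
    fun t ht0 ht1 => ?_
  have h3 := sq_le_sq.2 (h2 _ (add_smul_sub_mem (convex_setβ X rβ) h1 hq ht0 ht1))
  refine h3.trans (le_of_eq ?_)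
  rw [smul_eq_mul]
  ring

end Projection

/-! ### The penalized likelihood as an objective function -/

section Objective

variable {n : ℕ}

instance : Sub (State n) := ⟨fun s t => ⟨s.G - t.G, s.α - t.α, s.β - t.β⟩⟩

theorem State.sub_G (s t : State n) : (s - t).G = s.G - t.G := rfl
theorem State.sub_α (s t : State n) : (s - t).α = s.α - t.α := rfl
theorem State.sub_β (s t : State n) : (s - t).β = s.β - t.β := rfl

/-- The inner product in which the algorithm is a projected gradient method. -/
noncomputable def stateInner (X : Matrix (Fin n) (Fin n) ℝ) (s t : State n) : ℝ :=
  trInner s.G t.G + 4 * n * ∑ i, s.α i * t.α i + frob X ^ 2 * (s.β * t.β)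

variable {A X : Matrix (Fin n) (Fin n) ℝ}

theorem stateInner_comm (s t : State n) : stateInner X s t = stateInner X t s := by
  unfold stateInner
  rw [trInner_comm, mul_comm s.β]
  simp only [mul_comm (s.α _)]

theorem stateInner_sub_right (s t u : State n) :
    stateInner X s (t - u) = stateInner X s t - stateInner X s u := by
  unfold stateInner
  rw [State.sub_G, State.sub_α, State.sub_β, trInner_sub_right]
  simp only [Pi.sub_apply, mul_sub, Finset.sum_sub_distrib]
  ring

theorem stateInner_sub_left (s t u : State n) :
    stateInner X (s - t) u = stateInner X s u - stateInner X t u := by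
  rw [stateInner_comm, stateInner_sub_right, stateInner_comm u, stateInner_comm u]

theorem stateInner_self (s : State n) :
    stateInner X s s = frob s.G ^ 2 + 4 * n * ∑ i, s.α i ^ 2 + frob X ^ 2 * s.β ^ 2 := by
  unfold stateInner
  rw [trInner_self]
  simp only [sq]

theorem stateInner_self_nonneg (s : State n) : 0 ≤ stateInner X s s := by
  rw [stateInner_self]
  have := Finset.sum_nonneg fun i (_ : i ∈ Finset.univ) => sq_nonneg (s.α i)
  positivity

theorem frob_rowConst_sq (a : Fin n → ℝ) : frob (rowConst a) ^ 2 = n * ∑ i, a i ^ 2 := by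
  rw [frob_sq]
  simp [rowConst, Finset.mul_sum]

theorem frob_transpose {m k : Type*} [Fintype m] [Fintype k] (M : Matrix m k ℝ) :
    frob Mᵀ = frob M := by
  unfold frob
  rw [Finset.sum_comm]
  rfl

theorem theta_sub (s t : State n) :
    theta X s.G s.α s.β - theta X t.G t.α t.β = theta X (s - t).G (s - t).α (s - t).β := by
  ext i j
  simp [theta, rowConst, State.sub_G, State.sub_α, State.sub_β]
  ring

/-- Source of the smoothness constant: combined with `bregmanSum_le` the likelihood term is at most
`3/8` of the squared `stateInner` norm of the increment. -/
theorem frob_theta_sq_le (G : Matrix (Fin n) (Fin n) ℝ) (α : Fin n → ℝ) (β : ℝ) :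
    frob (theta X G α β) ^ 2 ≤
      3 * (frob G ^ 2 + 4 * n * ∑ i, α i ^ 2 + frob X ^ 2 * β ^ 2) := by
  have h1 : frob (rowConst α + (rowConst α)ᵀ) ^ 2 ≤ 4 * n * ∑ i, α i ^ 2 := by
    have h2 := frob_add_le (rowConst α) (rowConst α)ᵀ
    rw [frob_transpose] at h2
    have h3 := pow_le_pow_left₀ (frob_nonneg _) h2 2
    have h4 := frob_rowConst_sq α
    nlinarith
  have h2 : frob (β • X) ^ 2 = frob X ^ 2 * β ^ 2 := by
    rw [frob_smul, mul_pow, sq_abs, mul_comm]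
  set a := frob (rowConst α + (rowConst α)ᵀ)
  set b := frob (β • X)
  have h3 : frob (theta X G α β) ≤ a + b + frob G :=
    (frob_add_le _ _).trans (add_le_add_left (frob_add_le _ _) _)
  have h4 := pow_le_pow_left₀ (frob_nonneg _) h3 2
  nlinarith [sq_nonneg (a - b), sq_nonneg (a - frob G), sq_nonneg (b - frob G)]

theorem trInner_theta {R : Matrix (Fin n) (Fin n) ℝ} (hR : R.IsSymm)
    (G : Matrix (Fin n) (Fin n) ℝ) (α : Fin n → ℝ) (β : ℝ) :
    trInner R (theta X G α β) =
      trInner R G + 2 * ∑ i, (∑ j, R i j) * α i + trInner R X * β := by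
  have h1 : trInner R (rowConst α) = ∑ i, (∑ j, R i j) * α i := by
    simp only [trInner, rowConst, Matrix.of_apply, Finset.sum_mul]
  have h2 : trInner R (rowConst α)ᵀ = trInner R (rowConst α) := by
    unfold trInner
    rw [Finset.sum_comm]
    refine Finset.sum_congr rfl fun i _ => Finset.sum_congr rfl fun j _ => ?_
    rw [Matrix.transpose_apply, hR.apply]
  rw [theta, trInner_add_right, trInner_add_right, trInner_add_right, trInner_smul_right, h2, h1]
  ring

theorem theta_isSymm {G : Matrix (Fin n) (Fin n) ℝ} (hX : X.IsSymm) (hG : G.IsSymm)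
    (α : Fin n → ℝ) (β : ℝ) : (theta X G α β).IsSymm := by
  ext i j
  simp only [theta, rowConst, Matrix.transpose_apply, Matrix.add_apply, Matrix.smul_apply,
    Matrix.of_apply, smul_eq_mul, hX.apply, hG.apply]
  ring

theorem sub_sigm_isSymm {Θ : Matrix (Fin n) (Fin n) ℝ} (hA : A.IsSymm) (hΘ : Θ.IsSymm) :
    (A - sigm Θ).IsSymm := by
  ext i j
  simp only [Matrix.transpose_apply, Matrix.sub_apply, sigm, Matrix.map_apply, hA.apply, hΘ.apply]

/-- The negative log-likelihood. -/
noncomputable def negLogLik (A Θ : Matrix (Fin n) (Fin n) ℝ) : ℝ :=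
  ∑ i, ∑ j, (softplus (Θ i j) - A i j * Θ i j)

/-- The penalized negative log-likelihood. -/
noncomputable def objective (A X : Matrix (Fin n) (Fin n) ℝ) (lam γ : ℝ) (s : State n) : ℝ :=
  negLogLik A (theta X s.G s.α s.β) + lam * s.G.trace + γ / 2 * stateInner X s s

/-- The direction of the gradient step. -/
noncomputable def direction (A X : Matrix (Fin n) (Fin n) ℝ) (lam γ : ℝ) (s : State n) : State n where
  G := residual A X s - lam • (1 : Matrix (Fin n) (Fin n) ℝ) - γ • s.G
  α := fun i => (∑ j, residual A X s i j) / (2 * n) - γ * s.α i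
  β := trInner (residual A X s) X / frob X ^ 2 - γ * s.β

/-- The sum of the entrywise Bregman divergences. -/
noncomputable def bregmanSum (Θ Θ' : Matrix (Fin n) (Fin n) ℝ) : ℝ :=
  ∑ i, ∑ j, bregman (Θ i j) (Θ' i j)

theorem negLogLik_sub (Θ Θ' : Matrix (Fin n) (Fin n) ℝ) :
    negLogLik A Θ' - negLogLik A Θ = -trInner (A - sigm Θ) (Θ' - Θ) + bregmanSum Θ Θ' := by
  simp only [negLogLik, trInner, bregmanSum, ← Finset.sum_sub_distrib, ← Finset.sum_neg_distrib,
    ← Finset.sum_add_distrib]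
  refine Finset.sum_congr rfl fun i _ => Finset.sum_congr rfl fun j _ => ?_
  simp only [bregman, Matrix.sub_apply, sigm, Matrix.map_apply]
  ring

theorem bregmanSum_nonneg (Θ Θ' : Matrix (Fin n) (Fin n) ℝ) : 0 ≤ bregmanSum Θ Θ' :=
  Finset.sum_nonneg fun _ _ => Finset.sum_nonneg fun _ _ => bregman_nonneg _ _

theorem bregmanSum_le (Θ Θ' : Matrix (Fin n) (Fin n) ℝ) :
    bregmanSum Θ Θ' ≤ 1 / 8 * frob (Θ' - Θ) ^ 2 := by
  rw [frob_sq]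
  simp only [bregmanSum, Finset.mul_sum]
  exact Finset.sum_le_sum fun i _ => Finset.sum_le_sum fun j _ => bregman_le _ _

theorem le_bregmanSum {M : ℝ} {Θ Θ' : Matrix (Fin n) (Fin n) ℝ} (h : ∀ i j, |Θ i j| ≤ M)
    (h' : ∀ i j, |Θ' i j| ≤ M) :
    Real.exp (-M) / 8 * frob (Θ' - Θ) ^ 2 ≤ bregmanSum Θ Θ' := by
  rw [frob_sq]
  simp only [bregmanSum, Finset.mul_sum]
  exact Finset.sum_le_sum fun i _ => Finset.sum_le_sum fun j _ => le_bregman (h i j) (h' i j)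

theorem trInner_one_left (M : Matrix (Fin n) (Fin n) ℝ) : trInner 1 M = M.trace := by
  rw [trInner_eq_trace, Matrix.transpose_one, Matrix.one_mul]

/-- Shows that `direction` is the negative gradient for `stateInner`. The weight `4n` turns the
divisor `2n` into the factor `2` coming from `α 1ᵀ + 1 αᵀ`, and `‖X‖_F²` cancels the divisor of the
`β` step. -/
theorem stateInner_direction (hA : A.IsSymm) (hX : X.IsSymm) {lam γ : ℝ} {s : State n}
    (hs : s.G.IsSymm) (t : State n) :
    stateInner X (direction A X lam γ s) t =
      trInner (residual A X s) (theta X t.G t.α t.β) - lam * t.G.trace - γ * stateInner X s t := by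
  have hR : (residual A X s).IsSymm := sub_sigm_isSymm hA (theta_isSymm hX hs _ _)
  rw [trInner_theta hR]
  unfold stateInner direction
  simp only [trInner_sub_left, trInner_smul_left, trInner_one_left]
  have h1 : 4 * (n : ℝ) * ∑ i, ((∑ j, residual A X s i j) / (2 * n) - γ * s.α i) * t.α i =
      2 * ∑ i, (∑ j, residual A X s i j) * t.α i - γ * (4 * n * ∑ i, s.α i * t.α i) := by
    simp only [Finset.mul_sum, ← Finset.sum_sub_distrib]
    refine Finset.sum_congr rfl fun i _ => ?_
    have hn : (n : ℝ) ≠ 0 := by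
      have := i.pos; positivity
    field_simp
    ring
  have h2 : frob X ^ 2 * ((trInner (residual A X s) X / frob X ^ 2 - γ * s.β) * t.β) =
      trInner (residual A X s) X * t.β - γ * (frob X ^ 2 * (s.β * t.β)) := by
    -- If `X` has norm zero the quotient in `direction` is zero by convention, and so is the pairing
    -- with `X`.
    by_cases h0 : frob X = 0
    · have : trInner (residual A X s) X = 0 := by
        have := abs_trInner_le (residual A X s) X
        rw [h0, mul_zero] at this
        exact abs_eq_zero.1 (le_antisymm this (abs_nonneg _))
      rw [h0, this]; ring
    · field_simp
  rw [h1, h2]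
  ring

/-- An exact expansion, with the Bregman divergence in place of a Hessian term. Bounding that
divergence by zero, from above, or from below yields convexity, smoothness, and the statistical
basic inequality. -/
theorem objective_sub (hA : A.IsSymm) (hX : X.IsSymm) {lam γ : ℝ} {s : State n}
    (hs : s.G.IsSymm) (t : State n) :
    objective A X lam γ t - objective A X lam γ s =
      -stateInner X (direction A X lam γ s) (t - s) + γ / 2 * stateInner X (t - s) (t - s) +
        bregmanSum (theta X s.G s.α s.β) (theta X t.G t.α t.β) := by
  rw [stateInner_direction hA hX hs, ← theta_sub]
  have h1 := negLogLik_sub (A := A) (theta X s.G s.α s.β) (theta X t.G t.α t.β)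
  unfold objective residual
  rw [State.sub_G, Matrix.trace_sub]
  simp only [stateInner_sub_right, stateInner_sub_left]
  rw [stateInner_comm t s]
  linarith

end Objective

/-! ### Linear convergence to the constrained minimizer -/

section Descent

variable {n : ℕ} {A X : Matrix (Fin n) (Fin n) ℝ} {rG rα rβ η lam γ : ℝ}

/-- Feasible states. If there is no covariate, its coefficient is zero. -/
structure IsFeasible (X : Matrix (Fin n) (Fin n) ℝ) (rG rα rβ : ℝ) (s : State n) : Prop where
  G_mem : s.G ∈ setG n rG
  α_mem : s.α ∈ setα n rα
  β_mem : s.β ∈ setβ X rβ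
  β_zero : X = 0 → s.β = 0

theorem IsFeasible.symm {s : State n} (h : IsFeasible X rG rα rβ s) : s.G.IsSymm := by
  have := h.G_mem.1.1
  rwa [Matrix.IsHermitian, Matrix.conjTranspose_eq_transpose_of_trivial] at this

theorem isFeasible_zero (hG : 0 ≤ rG) (hα : 0 ≤ rα) (hβ : 0 ≤ rβ) :
    IsFeasible X rG rα rβ ⟨0, 0, 0⟩ :=
  ⟨zero_mem_setG hG, zero_mem_setα hα, zero_mem_setβ hβ, fun _ => rfl⟩

theorem step_feasible (hG : 0 ≤ rG) (hα : 0 ≤ rα) (hβ : 0 ≤ rβ) {s : State n}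
    (h : IsFeasible X rG rα rβ s) : IsFeasible X rG rα rβ (step A X rG rα rβ η lam γ s) := by
  refine ⟨(nearest_setG hG _).1, (nearest_setα hα _).1, ?_, fun h0 => ?_⟩
  · unfold step
    by_cases h0 : X = 0
    · simp only [h0, if_true]; rw [← h0]; exact h.β_mem
    · simp only [h0, if_false]; exact (nearest_setβ h0 hβ _).1
  · simp only [step, h0, if_true]; exact h.β_zero h0

theorem iterate_succ (T : ℕ) : iterate A X rG rα rβ η lam γ (T + 1) =
    step A X rG rα rβ η lam γ (iterate A X rG rα rβ η lam γ T) :=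
  Function.iterate_succ_apply' _ _ _

theorem iterate_feasible (hG : 0 ≤ rG) (hα : 0 ≤ rα) (hβ : 0 ≤ rβ) (T : ℕ) :
    IsFeasible X rG rα rβ (iterate A X rG rα rβ η lam γ T) := by
  induction T with
  | zero => exact isFeasible_zero hG hα hβ
  | succ T ih => rw [iterate_succ]; exact step_feasible hG hα hβ ih

/-- The three projection inequalities added with the weights of `stateInner`. If `X = 0` the weight
of the `β` component vanishes, so its missing update does no harm. -/
theorem step_variational (hG : 0 ≤ rG) (hα : 0 ≤ rα) (hβ : 0 ≤ rβ) (s : State n) {q : State n}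
    (hq : IsFeasible X rG rα rβ q) {p : State n} (hp : p = step A X rG rα rβ η lam γ s) :
    stateInner X (s - p) (q - p) + η * stateInner X (direction A X lam γ s) (q - p) ≤ 0 := by
  have h1 := (nearest_setG hG (s.G + η • (direction A X lam γ s).G)).2 q.G hq.G_mem
  have h2 := (nearest_setα hα (fun i => s.α i + η * (direction A X lam γ s).α i)).2 q.α hq.α_mem
  have e1 : nearest frob (setG n rG) (s.G + η • (direction A X lam γ s).G) = p.G := by rw [hp]; rfl
  have e2 : nearest vecNorm (setα n rα) (fun i => s.α i + η * (direction A X lam γ s).α i) = p.α := by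
    rw [hp]; rfl
  rw [e1] at h1
  rw [e2] at h2
  have h3 : frob X ^ 2 * ((s.β + η * (direction A X lam γ s).β - p.β) * (q.β - p.β)) ≤ 0 := by
    by_cases h0 : X = 0
    · rw [h0, frob_zero]; simp
    · have h4 := (nearest_setβ h0 hβ (s.β + η * (direction A X lam γ s).β)).2 q.β hq.β_mem
      have e3 : nearest abs (setβ X rβ) (s.β + η * (direction A X lam γ s).β) = p.β := by
        rw [hp]; simp only [step, h0, if_false]; rfl
      rw [e3] at h4
      exact mul_nonpos_of_nonneg_of_nonpos (sq_nonneg _) h4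
  have e : stateInner X (s - p) (q - p) + η * stateInner X (direction A X lam γ s) (q - p) =
      trInner (s.G + η • (direction A X lam γ s).G - p.G) (q.G - p.G) +
      4 * n * ∑ i, (s.α i + η * (direction A X lam γ s).α i - p.α i) * (q.α i - p.α i) +
      frob X ^ 2 * ((s.β + η * (direction A X lam γ s).β - p.β) * (q.β - p.β)) := by
    have e3 : ∑ i, (s.α i + η * (direction A X lam γ s).α i - p.α i) * (q.α i - p.α i) =
        ∑ i, (s.α i - p.α i) * (q.α i - p.α i) +
          η * ∑ i, (direction A X lam γ s).α i * (q.α i - p.α i) := by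
      rw [Finset.mul_sum, ← Finset.sum_add_distrib]
      exact Finset.sum_congr rfl fun i _ => by ring
    rw [e3, add_sub_right_comm s.G, trInner_add_left, trInner_smul_left]
    unfold stateInner
    simp only [State.sub_G, State.sub_α, State.sub_β, Pi.sub_apply]
    ring
  rw [e]
  have h5 : 4 * (n : ℝ) * ∑ i, (s.α i + η * (direction A X lam γ s).α i - p.α i) * (q.α i - p.α i) ≤ 0 :=
    mul_nonpos_of_nonneg_of_nonpos (by positivity) h2
  linarith

/-- One step contracts the distance to the minimizer of the objective. -/
theorem step_contraction (hA : A.IsSymm) (hX : X.IsSymm) (hG : 0 ≤ rG) (hα : 0 ≤ rα) (hβ : 0 ≤ rβ)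
    (hη : 0 < η) (hηγ : η * (3 / 4 + γ) ≤ 1) {q : State n} (hq : IsFeasible X rG rα rβ q)
    (hmin : ∀ t, IsFeasible X rG rα rβ t → objective A X lam γ q ≤ objective A X lam γ t)
    {s : State n} (hs : IsFeasible X rG rα rβ s) {p : State n}
    (hp : p = step A X rG rα rβ η lam γ s) :
    stateInner X (p - q) (p - q) ≤ (1 - η * γ) * stateInner X (s - q) (s - q) := by
  have hpf : IsFeasible X rG rα rβ p := hp ▸ step_feasible hG hα hβ hs
  have h1 := step_variational hG hα hβ s hq hp
  have h2 := objective_sub hA hX (lam := lam) (γ := γ) hs.symm q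
  have h3 := objective_sub hA hX (lam := lam) (γ := γ) hs.symm p
  have h4 := hmin p hpf
  have h5 := bregmanSum_nonneg (theta X s.G s.α s.β) (theta X q.G q.α q.β)
  have h6 := bregmanSum_le (theta X s.G s.α s.β) (theta X p.G p.α p.β)
  rw [theta_sub] at h6
  have h7 := frob_theta_sq_le (X := X) (p - s).G (p - s).α (p - s).β
  rw [← stateInner_self] at h7
  have h8 : 0 ≤ stateInner X (p - s) (p - s) := stateInner_self_nonneg _
  have h9 : bregmanSum (theta X s.G s.α s.β) (theta X p.G p.α p.β) ≤
      3 / 8 * stateInner X (p - s) (p - s) := by linarith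
  -- The step size condition absorbs the smoothness term into the `‖p - s‖²` supplied by the
  -- projection inequality.
  have h10 : η * (3 / 8 + γ / 2) * stateInner X (p - s) (p - s) ≤
      1 / 2 * stateInner X (p - s) (p - s) :=
    mul_le_mul_of_nonneg_right (by linarith) h8
  -- Minimality of `q` is used only as `objective q ≤ objective p`, with both values expanded around
  -- `s`. The Bregman term at `q` is discarded, so all strong convexity comes from the ridge term.
  have h11 : 0 ≤ η * (-stateInner X (direction A X lam γ s) (p - q) +
      (3 / 8 + γ / 2) * stateInner X (p - s) (p - s) - γ / 2 * stateInner X (q - s) (q - s)) := by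
    refine mul_nonneg hη.le ?_
    simp only [stateInner_sub_right (direction A X lam γ s)] at h2 h3 ⊢
    linarith
  set u := direction A X lam γ s
  simp only [stateInner_sub_right, stateInner_sub_left] at *
  rw [stateInner_comm p s, stateInner_comm q s, stateInner_comm q p] at *
  linarith

theorem continuous_objective (A X : Matrix (Fin n) (Fin n) ℝ) (lam γ : ℝ) :
    Continuous fun p : Matrix (Fin n) (Fin n) ℝ × (Fin n → ℝ) × ℝ =>
      objective A X lam γ ⟨p.1, p.2.1, p.2.2⟩ := by
  refine Continuous.add (Continuous.add ?_ ?_) ?_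
  · refine continuous_finsetSum _ fun i _ => continuous_finsetSum _ fun j _ => ?_
    have hθ : Continuous fun p : Matrix (Fin n) (Fin n) ℝ × (Fin n → ℝ) × ℝ =>
      p.2.1 i + p.2.1 j + p.2.2 * X i j + p.1 i j := by fun_prop
    exact (continuous_softplus.comp hθ).sub (continuous_const.mul hθ)
  · fun_prop
  · unfold stateInner trInner; fun_prop

/-- For `X = 0` the coefficient is pinned to `0`, its value along all iterates, which restores
compactness. -/
theorem exists_compact_setβ (X : Matrix (Fin n) (Fin n) ℝ) (hβ : 0 ≤ rβ) :
    ∃ B : Set ℝ, IsCompact B ∧ ∀ β, β ∈ B ↔ β ∈ setβ X rβ ∧ (X = 0 → β = 0) := by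
  by_cases h0 : X = 0
  · exact ⟨{0}, isCompact_singleton, fun β =>
      ⟨fun h => ⟨(Set.mem_singleton_iff.1 h) ▸ zero_mem_setβ hβ, fun _ => h⟩, fun h => h.2 h0⟩⟩
  · exact ⟨setβ X rβ, isCompact_setβ h0 rβ, fun β =>
      ⟨fun h => ⟨h, fun h1 => absurd h1 h0⟩, And.left⟩⟩

theorem exists_minimizer_prod (A X : Matrix (Fin n) (Fin n) ℝ) (lam γ : ℝ) (hG : 0 ≤ rG)
    (hα : 0 ≤ rα) {B : Set ℝ} (hB : IsCompact B) (h0 : 0 ∈ B) :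
    ∃ p ∈ (setG n rG) ×ˢ ((setα n rα) ×ˢ B), ∀ t ∈ (setG n rG) ×ˢ ((setα n rα) ×ˢ B),
      objective A X lam γ ⟨p.1, p.2.1, p.2.2⟩ ≤ objective A X lam γ ⟨t.1, t.2.1, t.2.2⟩ := by
  have hne : ((setG n rG) ×ˢ ((setα n rα) ×ˢ B)).Nonempty :=
    ⟨(0, 0, 0), zero_mem_setG hG, zero_mem_setα hα, h0⟩
  obtain ⟨p, hp, hmin⟩ :=
    ((isCompact_setG n rG).prod ((isCompact_setα n rα).prod hB)).exists_isMinOn hne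
      (continuous_objective A X lam γ).continuousOn
  exact ⟨p, hp, isMinOn_iff.1 hmin⟩

theorem exists_minimizer (A X : Matrix (Fin n) (Fin n) ℝ) (lam γ : ℝ) (hG : 0 ≤ rG) (hα : 0 ≤ rα)
    (hβ : 0 ≤ rβ) : ∃ q, IsFeasible X rG rα rβ q ∧
      ∀ t, IsFeasible X rG rα rβ t → objective A X lam γ q ≤ objective A X lam γ t := by
  obtain ⟨B, hB, hB'⟩ := exists_compact_setβ X hβ
  obtain ⟨p, hp, hmin⟩ := exists_minimizer_prod A X lam γ hG hα hB
    ((hB' 0).2 ⟨zero_mem_setβ hβ, fun _ => rfl⟩)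
  rw [Set.mem_prod, Set.mem_prod] at hp
  have h3 := (hB' _).1 hp.2.2
  refine ⟨⟨p.1, p.2.1, p.2.2⟩, ⟨hp.1, hp.2.1, h3.1, h3.2⟩, fun t ht => ?_⟩
  exact hmin (t.G, t.α, t.β) (Set.mk_mem_prod ht.G_mem
    (Set.mk_mem_prod ht.α_mem ((hB' _).2 ⟨ht.β_mem, ht.β_zero⟩)))

theorem iterate_contraction (hA : A.IsSymm) (hX : X.IsSymm) (hG : 0 ≤ rG) (hα : 0 ≤ rα)
    (hβ : 0 ≤ rβ) (hη : 0 < η) (hηγ : η * (3 / 4 + γ) ≤ 1) {q : State n}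
    (hq : IsFeasible X rG rα rβ q)
    (hmin : ∀ t, IsFeasible X rG rα rβ t → objective A X lam γ q ≤ objective A X lam γ t) (T : ℕ) :
    stateInner X (iterate A X rG rα rβ η lam γ T - q) (iterate A X rG rα rβ η lam γ T - q) ≤
      (1 - η * γ) ^ T * stateInner X q q := by
  induction T with
  | zero =>
    rw [pow_zero, one_mul]
    have : iterate A X rG rα rβ η lam γ 0 = ⟨0, 0, 0⟩ := rfl
    rw [this, stateInner_self, stateInner_self]
    simp [State.sub_G, State.sub_α, State.sub_β, frob_neg]
  | succ T ih =>
    refine (step_contraction hA hX hG hα hβ hη hηγ hq hmin (iterate_feasible hG hα hβ T)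
      (iterate_succ T)).trans ?_
    rw [pow_succ', mul_assoc]
    exact mul_le_mul_of_nonneg_left ih (by nlinarith)

end Descent

/-! ### Near orthogonality of the three components of `Θ` -/

section Curvature

variable {n k : ℕ}

theorem trInner_rowConst_rowConst (a a' : Fin n → ℝ) :
    trInner (rowConst a) (rowConst a') = n * ∑ i, a i * a' i := by
  simp [trInner, rowConst, Finset.mul_sum]

theorem trInner_rowConst_add {R : Matrix (Fin n) (Fin n) ℝ} (hR : R.IsSymm) (a : Fin n → ℝ) :
    trInner R (rowConst a + (rowConst a)ᵀ) = 2 * ∑ i, (∑ j, R i j) * a i := by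
  have := trInner_theta (X := 0) hR 0 a 0
  have e : trInner R 0 = 0 := by simp [trInner]
  simpa [theta, e] using this

/-- Tests the form on `a` and the all-ones vector, using `‖a 1ᵀ‖_F = √n ‖a‖`. -/
theorem BilinBound.abs_sum_le {W : Matrix (Fin n) (Fin n) ℝ} {w : ℝ} (hW : BilinBound W w)
    (a : Fin n → ℝ) : |∑ i, (∑ j, W i j) * a i| ≤ w * frob (rowConst a) := by
  have h := hW a 1
  have e1 : a ⬝ᵥ W *ᵥ 1 = ∑ i, (∑ j, W i j) * a i := by
    simp only [dotProduct, Matrix.mulVec, Pi.one_apply, mul_one]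
    exact Finset.sum_congr rfl fun i _ => mul_comm _ _
  have e2 : frob (rowConst a) = √(a ⬝ᵥ a) * √((1 : Fin n → ℝ) ⬝ᵥ 1) := by
    rw [← Real.sqrt_mul (dotProduct_self_nonneg' a), ← Real.sqrt_sq (frob_nonneg (rowConst a)),
      frob_rowConst_sq]
    congr 1
    simp [dotProduct, sq, mul_comm]
  rwa [e1, ← e2] at h

theorem two_mul_frob_rowConst_sq_le (a : Fin n → ℝ) :
    2 * frob (rowConst a) ^ 2 ≤ frob (rowConst a + (rowConst a)ᵀ) ^ 2 := by
  have h1 : trInner (rowConst a) (rowConst a)ᵀ = (∑ i, a i) ^ 2 := by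
    simp only [trInner, rowConst, Matrix.of_apply, Matrix.transpose_apply]
    rw [sq, Finset.sum_mul_sum]
  rw [frob_add_sq, h1, frob_transpose]
  nlinarith [sq_nonneg (∑ i, a i)]

theorem sum_row_eq_zero {G : Matrix (Fin n) (Fin n) ℝ} (hG : G.IsSymm)
    (hc : centering n * G = G) (i : Fin n) : ∑ j, G i j = 0 := by
  have hn : (n : ℝ) ≠ 0 := by have := i.pos; positivity
  have h1 := congrFun (congrFun hc i) i
  rw [centering, Matrix.sub_mul, Matrix.one_mul, Matrix.sub_apply, Matrix.mul_apply] at h1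
  simp only [Matrix.of_apply, ← Finset.mul_sum] at h1
  have h2 : 1 / (n : ℝ) * ∑ j, G j i = 0 := by linarith
  have h3 : ∑ j, G j i = 0 := by
    rcases mul_eq_zero.1 h2 with h | h
    · exact absurd h (one_div_ne_zero hn)
    · exact h
  rw [← h3]
  exact Finset.sum_congr rfl fun j _ => hG.apply i j ▸ rfl

/-- Lower bound for the norm of a sum of the three components of the model. -/
theorem frob_theta_sq_ge {X M : Matrix (Fin n) (Fin n) ℝ} (hM : M.IsSymm)
    (hM0 : ∀ i, ∑ j, M i j = 0) (hX : X.IsSymm) {v : ℝ} (hv : BilinBound X v) (a : Fin n → ℝ)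
    (β : ℝ) :
    2 * frob (rowConst a) ^ 2 + frob (β • X) ^ 2 + frob M ^ 2 -
      4 * (|β| * v * frob (rowConst a)) - 2 * (|β| * |trInner X M|) ≤
        frob (theta X M a β) ^ 2 := by
  -- Zero row sums of `M` make the node effects exactly orthogonal to it; only the two cross terms
  -- with `X` survive.
  have h1 : trInner (rowConst a + (rowConst a)ᵀ) M = 0 := by
    rw [trInner_comm, trInner_rowConst_add hM]
    simp [hM0]
  have h2 : |trInner (rowConst a + (rowConst a)ᵀ) (β • X)| ≤ 2 * (|β| * v * frob (rowConst a)) := by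
    rw [trInner_smul_right, trInner_comm, trInner_rowConst_add hX, abs_mul, abs_mul, abs_two]
    have := mul_le_mul_of_nonneg_left (hv.abs_sum_le a) (abs_nonneg β)
    linarith
  have h3 : |trInner (β • X) M| = |β| * |trInner X M| := by
    rw [trInner_smul_left, abs_mul]
  have h4 := two_mul_frob_rowConst_sq_le a
  rw [theta, frob_add_sq, frob_add_sq _ (β • X), trInner_add_left _ (β • X), h1]
  have h5 := (abs_le.1 h2).1
  have h6 := neg_abs_le (trInner (β • X) M)
  rw [h3] at h6
  linarith

/-- A nonzero `X` with operator norm `0` would have `stableRank X = 0` by the convention for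
division by zero, contrary to the assumption. -/
theorem mul_opNorm_le_frob {X : Matrix (Fin n) (Fin n) ℝ} {c : ℝ} (hc : 0 < c) (hk : 1 ≤ k)
    (h : X ≠ 0 → c ^ 2 * k ≤ stableRank X) : c * √k * opNorm X ≤ frob X := by
  by_cases hX : X = 0
  · have h0 : opNorm X ≤ 0 := opNorm_le_of X le_rfl fun x => by rw [hX]; simp
    have := frob_nonneg X
    have h1 : c * √k * opNorm X ≤ 0 := mul_nonpos_of_nonneg_of_nonpos (by positivity) h0
    linarith
  · have h1 := h hX
    have hk' : (0 : ℝ) < k := by exact_mod_cast hk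
    have h0 : opNorm X ≠ 0 := by
      intro h0
      rw [stableRank, h0] at h1
      simp only [ne_eq, OfNat.ofNat_ne_zero, not_false_eq_true, zero_pow, div_zero] at h1
      have : 0 < c ^ 2 * k := by positivity
      linarith
    have h2 : 0 < opNorm X := lt_of_le_of_ne (opNorm_nonneg X) h0.symm
    rw [stableRank, le_div_iff₀ (by positivity)] at h1
    refine abs_le_of_sq_le_sq' ?_ (frob_nonneg X) |>.2
    rw [mul_pow, mul_pow, Real.sq_sqrt hk'.le]
    exact h1

variable {G V : Matrix (Fin n) (Fin n) ℝ} {Z : Matrix (Fin n) (Fin k) ℝ} {d : Fin n → ℝ}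

theorem IsTopBasis.conj_sub (h : IsTopBasis G Z V d) (G₁ : Matrix (Fin n) (Fin n) ℝ) :
    Vᵀ * (G₁ - G) * V = Vᵀ * G₁ * V - Matrix.diagonal d := by
  rw [Matrix.mul_sub, Matrix.sub_mul, h.conj]

/-- Conjugation by `V` makes `G` diagonal and changes neither inner products nor Frobenius norms, so
the block estimate applies. -/
theorem IsTopBasis.abs_trInner_sub_le (h : IsTopBasis G Z V d) {G₁ W : Matrix (Fin n) (Fin n) ℝ}
    (hG₁ : G₁.PosSemidef) {w : ℝ} (hw0 : 0 ≤ w) (hW : BilinBound W w) :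
    |trInner W (G₁ - G)| ≤ w * (2 * √k * frob (G₁ - G) +
      ∑ i : Fin n, (if (i : ℕ) < k then 0 else (Vᵀ * G₁ * V) i i) +
      ∑ i : Fin n, (if (i : ℕ) < k then 0 else d i)) := by
  have h1 : (Vᵀ * G₁ * V).PosSemidef := by
    have := hG₁.conjTranspose_mul_mul_same V
    rwa [Matrix.conjTranspose_eq_transpose_of_trivial] at this
  have h2 := abs_trInner_sub_diagonal_le k hw0 (hW.conj h.left) h1 h.nonneg
  rwa [← h.conj_sub, trInner_conj_orthogonal h.right, frob_conj_orthogonal h.right] at h2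

theorem IsTopBasis.trace_sub_ge (h : IsTopBasis G Z V d) (G₁ : Matrix (Fin n) (Fin n) ℝ) :
    -(√k * frob (G₁ - G)) + ∑ i : Fin n, (if (i : ℕ) < k then 0 else (Vᵀ * G₁ * V) i i) -
      ∑ i : Fin n, (if (i : ℕ) < k then 0 else d i) ≤ (G₁ - G).trace := by
  have h2 := trace_sub_diagonal_ge k (Vᵀ * G₁ * V) d
  rw [← h.conj_sub, frob_conj_orthogonal h.right, Matrix.trace_mul_comm, ← Matrix.mul_assoc,
    h.right, Matrix.one_mul] at h2
  exact h2

end Curvature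

/-! ### Distance from the minimizer to the truth -/

section Minimizer

variable {n k : ℕ} {A X : Matrix (Fin n) (Fin n) ℝ} {rG rα rβ lam γ : ℝ}

theorem abs_stateInner_le (s t : State n) :
    |stateInner X s t| ≤ frob s.G * frob t.G + 4 * (frob (rowConst s.α) * frob (rowConst t.α)) +
      frob (s.β • X) * frob (t.β • X) := by
  have e : stateInner X s t = trInner s.G t.G + 4 * trInner (rowConst s.α) (rowConst t.α) +
      trInner (s.β • X) (t.β • X) := by
    rw [trInner_rowConst_rowConst, trInner_smul_left, trInner_smul_right, trInner_self]
    unfold stateInner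
    ring
  rw [e]
  have h1 := abs_trInner_le s.G t.G
  have h2 := abs_trInner_le (rowConst s.α) (rowConst t.α)
  have h3 := abs_trInner_le (s.β • X) (t.β • X)
  rw [abs_le] at *
  constructor <;> linarith

/-- The arithmetic core. `D`, `a`, `y` are the errors of the three components, `Q` the squared error
of `Θ`, `τ` and `b` the masses of estimate and truth outside the top `k` eigenspace, `r = √k`, `l =
lam`, `m = e^{-M₁}`, and `ε` bounds the interaction with `X`. -/
theorem error_le_of_basic_inequality {D a y τ b r ε Q m l B : ℝ} (hD : 0 ≤ D) (ha : 0 ≤ a)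
    (hy : 0 ≤ y) (hτ : 0 ≤ τ) (hr : 0 < r) (hε : 0 ≤ ε) (hB : 0 ≤ B) (hl : 0 < l) (hm : 0 < m) (hQ : 0 ≤ Q)
    (hb : b = r * B) (hεy : 66 * r * ε ≤ y)
    (h1 : 2 * a ^ 2 + y ^ 2 + D ^ 2 - 4 * (ε * a) - 2 * (ε * (2 * r * D + τ + b)) ≤ Q)
    (h2 : m / 8 * Q + 3 / 4 * l * τ ≤ 5 / 4 * l * b + 5 / 2 * l * r * (D + a + y))
    (hr1 : 1 ≤ r) :
    D ^ 2 + a ^ 2 + y ^ 2 ≤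
      4 * B ^ 2 + 40 * (l * r / m) * B + 6400 * (l * r / m) ^ 2 := by
  -- Dropping the curvature term gives a cone condition: the mass `τ` outside the top eigenspace is
  -- controlled by the true tail and the Frobenius errors.
  have h3 : l * τ ≤ l * (5 / 3 * r * B + 10 / 3 * r * (D + a + y)) := by
    rw [hb] at h2
    nlinarith [mul_nonneg hm.le hQ]
  have h4 : τ ≤ 5 / 3 * r * B + 10 / 3 * r * (D + a + y) := le_of_mul_le_mul_left h3 hl
  have h5 : r * ε ≤ y / 66 := by linarith
  have h6 : ε * a ≤ y / 66 * a := mul_le_mul_of_nonneg_right (by nlinarith) ha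
  have h7 : ε * (2 * r * D + τ + b) ≤ y / 66 * (2 * D + 8 / 3 * B + 10 / 3 * (D + a + y)) := by
    calc ε * (2 * r * D + τ + b)
        ≤ ε * (2 * r * D + (5 / 3 * r * B + 10 / 3 * r * (D + a + y)) + r * B) := by
          rw [hb]; gcongr
      _ = r * ε * (2 * D + 8 / 3 * B + 10 / 3 * (D + a + y)) := by ring
      _ ≤ _ := mul_le_mul_of_nonneg_right h5 (by positivity)
  -- By the cone condition every interaction with `X` carries the factor `r ε ≤ y/66`, so half of
  -- the sum of squares survives, up to `B²`.
  have h8 : (D ^ 2 + a ^ 2 + y ^ 2) / 2 - B ^ 2 ≤ Q := by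
    nlinarith [sq_nonneg (y - a), sq_nonneg (y - D), sq_nonneg (y - B), sq_nonneg a, sq_nonneg D,
      sq_nonneg B, sq_nonneg y]
  set Λ := l * r / m with hΛ
  have hlr : l * r = m * Λ := by rw [hΛ]; field_simp
  have hΛ0 : 0 ≤ Λ := by positivity
  have h9 : m * (D ^ 2 + a ^ 2 + y ^ 2) ≤ m * (2 * B ^ 2 + 20 * Λ * B + 40 * Λ * (D + a + y)) := by
    have h10 : m / 8 * ((D ^ 2 + a ^ 2 + y ^ 2) / 2 - B ^ 2) ≤ m / 8 * Q :=
      mul_le_mul_of_nonneg_left h8 (by positivity)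
    have h12 : 5 / 4 * l * b = 5 / 4 * (m * Λ) * B := by rw [hb, ← hlr]; ring
    have h13 : 5 / 2 * l * r * (D + a + y) = 5 / 2 * (m * Λ) * (D + a + y) := by rw [← hlr]; ring
    rw [h12, h13] at h2
    have h14 : 0 ≤ 3 / 4 * l * τ := by positivity
    linarith
  have h11 := le_of_mul_le_mul_left h9 hm
  nlinarith [sq_nonneg (D - 40 * Λ), sq_nonneg (a - 40 * Λ), sq_nonneg (y - 40 * Λ)]

/-- The basic inequality for a state whose objective is at most that of the truth. -/
theorem basic_inequality {M w K : ℝ} {s q : State n} {Z : Matrix (Fin n) (Fin k) ℝ}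
    {V : Matrix (Fin n) (Fin n) ℝ} {d : Fin n → ℝ} (hk : 1 ≤ k) (hA : A.IsSymm) (hX : X.IsSymm)
    (hs : IsFeasible X rG rα rβ s) (hq : IsFeasible X rG rα rβ q)
    (hobj : objective A X lam γ q ≤ objective A X lam γ s)
    (hΘs : ∀ i j, |theta X s.G s.α s.β i j| ≤ M) (hΘq : ∀ i j, |theta X q.G q.α q.β i j| ≤ M)
    (hb : IsTopBasis s.G Z V d) (hw0 : 0 ≤ w) (hW : BilinBound (A - sigm (theta X s.G s.α s.β)) w)
    (hWX : |trInner (A - sigm (theta X s.G s.α s.β)) X| ≤ w * frob X) (hw : 4 * w ≤ lam)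
    (hlam : 0 < lam) (hγ : 0 ≤ γ) (hK : 0 ≤ K) (hreg : γ * frob s.G * (1 + 4 * K) ≤ lam * √k)
    (hα : frob (rowConst s.α) ≤ K * frob s.G) (hβ : frob (s.β • X) ≤ K * frob s.G) :
    Real.exp (-M) / 8 * frob (theta X (q - s).G (q - s).α (q - s).β) ^ 2 +
        3 / 4 * lam * ∑ i : Fin n, (if (i : ℕ) < k then 0 else (Vᵀ * q.G * V) i i) ≤
      5 / 4 * lam * ∑ i : Fin n, (if (i : ℕ) < k then 0 else d i) + 5 / 2 * lam * √k *
        (frob (q.G - s.G) + frob (rowConst (q.α - s.α)) + frob ((q.β - s.β) • X)) := by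
  have hWs : (A - sigm (theta X s.G s.α s.β)).IsSymm :=
    sub_sigm_isSymm hA (theta_isSymm hX hs.symm _ _)
  have h2 := le_bregmanSum hΘs hΘq
  have h1 := objective_sub hA hX (lam := lam) (γ := γ) hs.symm q
  rw [stateInner_direction hA hX hs.symm] at h1
  unfold residual at h1
  rw [theta_sub] at h2
  obtain ⟨W, hWdef⟩ : ∃ W, W = A - sigm (theta X s.G s.α s.β) := ⟨_, rfl⟩
  rw [← hWdef] at hWs hW hWX h1
  obtain ⟨D, hD⟩ : ∃ D, D = frob (q.G - s.G) := ⟨_, rfl⟩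
  obtain ⟨a, ha⟩ : ∃ a, a = frob (rowConst (q.α - s.α)) := ⟨_, rfl⟩
  obtain ⟨y, hy⟩ : ∃ y, y = frob ((q.β - s.β) • X) := ⟨_, rfl⟩
  have h5 := (abs_le.1 (hb.abs_trInner_sub_le hq.G_mem.1 hw0 hW)).2
  have h4 := hb.trace_sub_ge q.G
  have h6 := (abs_le.1 (hW.abs_sum_le (q.α - s.α))).2
  have hτ0 : 0 ≤ ∑ i : Fin n, (if (i : ℕ) < k then 0 else (Vᵀ * q.G * V) i i) := by
    have h1 : (Vᵀ * q.G * V).PosSemidef := by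
      have := hq.G_mem.1.conjTranspose_mul_mul_same V
      rwa [Matrix.conjTranspose_eq_transpose_of_trivial] at this
    exact Finset.sum_nonneg fun i _ => by split_ifs; exacts [le_rfl, h1.diag_nonneg]
  have hb0 : 0 ≤ ∑ i : Fin n, (if (i : ℕ) < k then 0 else d i) :=
    Finset.sum_nonneg fun i _ => by split_ifs; exacts [le_rfl, hb.nonneg i]
  generalize (∑ i : Fin n, (if (i : ℕ) < k then 0 else (Vᵀ * q.G * V) i i)) = τ at *
  generalize (∑ i : Fin n, (if (i : ℕ) < k then 0 else d i)) = b at *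
  have hD0 : 0 ≤ D := hD ▸ frob_nonneg _
  have ha0 : 0 ≤ a := ha ▸ frob_nonneg _
  have hy0 : 0 ≤ y := hy ▸ frob_nonneg _
  rw [← hD, ← ha, ← hy]
  rw [← hD] at h4 h5
  rw [← ha] at h6
  have hr1 : 1 ≤ √(k : ℝ) := Real.one_le_sqrt.2 (by exact_mod_cast hk)
  have h3 : 0 ≤ γ / 2 * stateInner X (q - s) (q - s) :=
    mul_nonneg (by linarith) (stateInner_self_nonneg _)
  have h7 : trInner W X * (q.β - s.β) ≤ w * y := by
    have e : y = |q.β - s.β| * frob X := hy ▸ frob_smul _ _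
    rw [e]
    calc _ ≤ |trInner W X * (q.β - s.β)| := le_abs_self _
      _ = |trInner W X| * |q.β - s.β| := abs_mul _ _
      _ ≤ w * frob X * |q.β - s.β| := mul_le_mul_of_nonneg_right hWX (abs_nonneg _)
      _ = _ := by ring
  have h8 : trInner W (theta X (q - s).G (q - s).α (q - s).β) ≤
      w * (2 * √k * D + τ + b) + 2 * (w * a) + w * y := by
    rw [trInner_theta hWs, State.sub_G, State.sub_α, State.sub_β]
    linarith
  -- The bias of the ridge term. Comparability of `α⋆` and `β⋆ X` with `G⋆` in norm, through `hreg`,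
  -- makes it no larger than the effect of the trace penalty.
  have h9 : -(γ * stateInner X s (q - s)) ≤ lam * √k * (D + a + y) := by
    have g1 := (abs_le.1 (abs_stateInner_le (X := X) s (q - s))).1
    rw [State.sub_G, State.sub_α, State.sub_β, ← hD, ← ha, ← hy] at g1
    have g0 := frob_nonneg s.G
    have g2 : frob (rowConst s.α) * a ≤ K * frob s.G * a := mul_le_mul_of_nonneg_right hα ha0
    have g3 : frob (s.β • X) * y ≤ K * frob s.G * y := mul_le_mul_of_nonneg_right hβ hy0
    have g4 : -stateInner X s (q - s) ≤ frob s.G * (1 + 4 * K) * (D + a + y) := by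
      have g5 : 0 ≤ frob s.G * a := mul_nonneg g0 ha0
      have g6 : 0 ≤ frob s.G * y := mul_nonneg g0 hy0
      have g7 : 0 ≤ K * (frob s.G * D) := by positivity
      have g8 : 0 ≤ K * (frob s.G * y) := by positivity
      linarith
    calc -(γ * stateInner X s (q - s)) = γ * -stateInner X s (q - s) := by ring
      _ ≤ γ * (frob s.G * (1 + 4 * K) * (D + a + y)) := mul_le_mul_of_nonneg_left g4 hγ
      _ = γ * frob s.G * (1 + 4 * K) * (D + a + y) := by ring
      _ ≤ _ := mul_le_mul_of_nonneg_right hreg (by positivity)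
  have h10 := mul_le_mul_of_nonneg_left h4 hlam.le
  have e10 : (q - s).G.trace = (q.G - s.G).trace := rfl
  rw [e10] at h1
  -- The noise consumes at most a quarter of the penalty; three quarters of `lam * τ` remain on the
  -- left.
  have h11 : w * (2 * √k * D + τ + b) + 2 * (w * a) + w * y ≤
      lam / 4 * (2 * √k * D + τ + b + 2 * a + y) := by
    have : w * (2 * √k * D + τ + b + 2 * a + y) ≤ lam / 4 * (2 * √k * D + τ + b + 2 * a + y) :=
      mul_le_mul_of_nonneg_right (by linarith) (by positivity)
    linarith
  have h12 : lam * a ≤ lam * √k * a :=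
    mul_le_mul_of_nonneg_right (le_mul_of_one_le_right hlam.le hr1) ha0
  have h13 : lam * y ≤ lam * √k * y :=
    mul_le_mul_of_nonneg_right (le_mul_of_one_le_right hlam.le hr1) hy0
  have h14 : 0 ≤ lam * √k * y := by positivity
  have h15 : 0 ≤ lam * √k * a := by positivity
  linarith

/-- A state whose objective is at most that of the truth is close to the truth. -/
theorem error_le_of_objective_le {M w K v : ℝ} {s q : State n} {Z : Matrix (Fin n) (Fin k) ℝ}
    {V : Matrix (Fin n) (Fin n) ℝ} {d : Fin n → ℝ} (hk : 1 ≤ k) (hA : A.IsSymm) (hX : X.IsSymm)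
    (hs : IsFeasible X rG rα rβ s) (hq : IsFeasible X rG rα rβ q)
    (hobj : objective A X lam γ q ≤ objective A X lam γ s)
    (hΘs : ∀ i j, |theta X s.G s.α s.β i j| ≤ M) (hΘq : ∀ i j, |theta X q.G q.α q.β i j| ≤ M)
    (hb : IsTopBasis s.G Z V d) (hw0 : 0 ≤ w) (hW : BilinBound (A - sigm (theta X s.G s.α s.β)) w)
    (hWX : |trInner (A - sigm (theta X s.G s.α s.β)) X| ≤ w * frob X) (hw : 4 * w ≤ lam)
    (hlam : 0 < lam) (hγ : 0 ≤ γ) (hK : 0 ≤ K) (hreg : γ * frob s.G * (1 + 4 * K) ≤ lam * √k)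
    (hα : frob (rowConst s.α) ≤ K * frob s.G) (hβ : frob (s.β • X) ≤ K * frob s.G)
    (hv0 : 0 ≤ v) (hv : BilinBound X v) (hXr : 66 * √k * v ≤ frob X)
    (htail : ∑ i : Fin n, (if (i : ℕ) < k then 0 else d i) ≤
      √k * (lam * √k / Real.exp (-M))) :
    frob (q.G - s.G) ^ 2 + frob (rowConst (q.α - s.α)) ^ 2 + frob ((q.β - s.β) • X) ^ 2 ≤
      6500 * (lam * √k / Real.exp (-M)) ^ 2 := by
  set D := frob (q.G - s.G)
  set a := frob (rowConst (q.α - s.α))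
  set y := frob ((q.β - s.β) • X)
  set Q := frob (theta X (q - s).G (q - s).α (q - s).β) ^ 2
  set τ := ∑ i : Fin n, (if (i : ℕ) < k then 0 else (Vᵀ * q.G * V) i i)
  set b := ∑ i : Fin n, (if (i : ℕ) < k then 0 else d i)
  have hD0 : 0 ≤ D := frob_nonneg _
  have ha0 : 0 ≤ a := frob_nonneg _
  have hy0 : 0 ≤ y := frob_nonneg _
  have hb0 : 0 ≤ b := Finset.sum_nonneg fun i _ => by split_ifs; exacts [le_rfl, hb.nonneg i]
  have hτ0 : 0 ≤ τ := by
    have h1 : (Vᵀ * q.G * V).PosSemidef := by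
      have := hq.G_mem.1.conjTranspose_mul_mul_same V
      rwa [Matrix.conjTranspose_eq_transpose_of_trivial] at this
    exact Finset.sum_nonneg fun i _ => by split_ifs; exacts [le_rfl, h1.diag_nonneg]
  have hr1 : 1 ≤ √(k : ℝ) := Real.one_le_sqrt.2 (by exact_mod_cast hk)
  have hr0 : 0 < √(k : ℝ) := by linarith
  have hsymm : (q - s).G.IsSymm := by
    rw [State.sub_G]; exact hq.symm.sub hs.symm
  have hrow : ∀ i, ∑ j, (q - s).G i j = 0 := by
    intro i
    rw [State.sub_G]
    simp only [Matrix.sub_apply, Finset.sum_sub_distrib]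
    rw [sum_row_eq_zero hq.symm hq.G_mem.2.1, sum_row_eq_zero hs.symm hs.G_mem.2.1, sub_zero]
  have hXε : 66 * √k * (|q.β - s.β| * v) ≤ y := by
    have : y = |q.β - s.β| * frob X := frob_smul _ _
    rw [this]
    calc _ = |q.β - s.β| * (66 * √k * v) := by ring
      _ ≤ _ := mul_le_mul_of_nonneg_left hXr (abs_nonneg _)
  have curv : 2 * a ^ 2 + y ^ 2 + D ^ 2 - 4 * (|q.β - s.β| * v * a) -
      2 * (|q.β - s.β| * v * (2 * √k * D + τ + b)) ≤ Q := by
    have h1 := frob_theta_sq_ge hsymm hrow hX hv (q - s).α (q - s).β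
    have h2 := mul_le_mul_of_nonneg_left (hb.abs_trInner_sub_le hq.G_mem.1 hv0 hv)
      (abs_nonneg (q.β - s.β))
    rw [State.sub_G, State.sub_α, State.sub_β] at h1
    change 2 * a ^ 2 + y ^ 2 + D ^ 2 - _ - _ ≤ Q at h1
    linarith
  have basic := basic_inequality hk hA hX hs hq hobj hΘs hΘq hb hw0 hW hWX hw hlam hγ hK hreg hα hβ
  have hB0 : 0 ≤ b / √k := by positivity
  have hBle : b / √k ≤ lam * √k / Real.exp (-M) := by rwa [div_le_iff₀' hr0]
  have key := error_le_of_basic_inequality hD0 ha0 hy0 hτ0 hr0 (mul_nonneg (abs_nonneg _) hv0) hB0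
    hlam (Real.exp_pos (-M)) (sq_nonneg _) (by field_simp) hXε curv basic hr1
  set Λ := lam * √k / Real.exp (-M)
  -- Here `B = b / √k ≤ Λ`, and `4 + 40 + 6400 ≤ 6500`.
  nlinarith

end Minimizer

/-! ### Feasibility of the truth and the error of the iterates -/

section Truth

variable {n k : ℕ} {A X : Matrix (Fin n) (Fin n) ℝ} {rG rα rβ lam γ η : ℝ}

theorem sigmoid_le_exp (x : ℝ) : Real.sigmoid x ≤ Real.exp x := by
  rw [Real.sigmoid_def]
  have e : Real.exp x = (Real.exp (-x))⁻¹ := by rw [Real.exp_neg, inv_inv]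
  rw [e]
  exact inv_anti₀ (Real.exp_pos _) (by linarith)

theorem IsFeasible.abs_theta_le {M : ℝ} {s : State n} (h : IsFeasible X rG rα rβ s)
    (hM : rG + 2 * rα + rβ ≤ M) (i j : Fin n) : |theta X s.G s.α s.β i j| ≤ M := by
  have h1 := h.G_mem.2.2 i j
  have h2 := h.α_mem i
  have h3 := h.α_mem j
  have h4 := h.β_mem i j
  rw [← abs_mul] at h4
  have e : theta X s.G s.α s.β i j = s.α i + s.α j + s.β * X i j + s.G i j := by
    simp [theta, rowConst]
  rw [e]
  have h5 := abs_add_le (s.α i + s.α j + s.β * X i j) (s.G i j)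
  have h6 := abs_add_le (s.α i + s.α j) (s.β * X i j)
  have h7 := abs_add_le (s.α i) (s.α j)
  linarith

/-- Cauchy–Schwarz for a Gram matrix. The parameter space bounds only the diagonal of `G`, the
constraint set all entries. -/
theorem abs_apply_le_of_posSemidef {G : Matrix (Fin n) (Fin n) ℝ} (hG : G.PosSemidef) {r : ℝ}
    (h : ∀ i, G i i ≤ r) (i j : Fin n) : |G i j| ≤ r := by
  obtain ⟨B, rfl⟩ := exists_gram_of_posSemidef hG
  have e : ∀ i j, (Bᵀ * B) i j = Bᵀ i ⬝ᵥ Bᵀ j := fun i j => rfl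
  have h1 := abs_dotProduct_le (Bᵀ i) (Bᵀ j)
  have h2 : ∀ i, √(Bᵀ i ⬝ᵥ Bᵀ i) ≤ √r := fun i => Real.sqrt_le_sqrt (by rw [← e]; exact h i)
  have hr : 0 ≤ r := (dotProduct_self_nonneg' (Bᵀ i)).trans (by rw [← e]; exact h i)
  rw [e]
  calc _ ≤ _ := h1
    _ ≤ √r * √r := mul_le_mul (h2 i) (h2 j) (Real.sqrt_nonneg _) (Real.sqrt_nonneg _)
    _ = r := Real.mul_self_sqrt hr

/-- If `X = 0` the true coefficient is arbitrary and is replaced by `0`. Only `β • X` enters `Θ` and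
the error, so nothing changes. -/
theorem InParamSpace.exists_feasible {M₂ : ℝ} {G : Matrix (Fin n) (Fin n) ℝ} {α : Fin n → ℝ}
    {β : ℝ} (h : InParamSpace M₂ rG rα rβ X G α β) (hX : IsCovariate X) (hβ : 0 ≤ rβ) :
    ∃ β', β' • X = β • X ∧ IsFeasible X rG rα rβ ⟨G, α, β'⟩ := by
  have h1 : G ∈ setG n rG := ⟨h.psd, h.centered, abs_apply_le_of_posSemidef h.psd h.G_le⟩
  by_cases h0 : X = 0
  · exact ⟨0, by rw [h0]; simp, h1, h.α_le, zero_mem_setβ hβ, fun _ => rfl⟩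
  · refine ⟨β, rfl, h1, h.α_le, fun i j => ?_, fun h2 => absurd h2 h0⟩
    rcases lt_trichotomy i j with hij | hij | hij
    · exact h.β_le i j hij
    · rw [hij, hX.diag]; simpa using hβ
    · rw [← hX.symm.apply]; exact h.β_le j i hij

/-- Error bound for the output of the algorithm, given bounds for the noise. -/
theorem initError_iterate_le {M w K : ℝ} {s : State n} {Z : Matrix (Fin n) (Fin k) ℝ}
    (hk : 1 ≤ k) (hA : A.IsSymm) (hX : X.IsSymm) (hG : 0 ≤ rG) (hrα : 0 ≤ rα) (hrβ : 0 ≤ rβ)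
    (hM : rG + 2 * rα + rβ ≤ M) (hs : IsFeasible X rG rα rβ s)
    (hZ : IsTopFactor s.G Z) (hsv : ∀ j, 0 < singVal Z j)
    (hw0 : 0 ≤ w) (hW : BilinBound (A - sigm (theta X s.G s.α s.β)) w)
    (hWX : |trInner (A - sigm (theta X s.G s.α s.β)) X| ≤ w * frob X) (hw : 4 * w ≤ lam)
    (hlam : 0 < lam) (hγ : 0 ≤ γ) (hη : 0 < η) (hηγ : η * (3 / 4 + γ) ≤ 1)
    (hK : 0 ≤ K) (hreg : γ * frob s.G * (1 + 4 * K) ≤ lam * √k)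
    (hα : frob (rowConst s.α) ≤ K * frob s.G) (hβ : frob (s.β • X) ≤ K * frob s.G)
    (hXr : 66 * √k * opNorm X ≤ frob X) {Λ : ℝ} (hΛ : Λ = lam * √k / Real.exp (-M))
    (htail : nuclearNorm (s.G - Z * Zᵀ) ≤ √k * Λ) (T : ℕ) {t : State n}
    (ht : t = iterate A X rG rα rβ η lam γ T) {ZT : Matrix (Fin n) (Fin k) ℝ}
    (hZT : IsTopFactor t.G ZT) :
    initError X Z s.α s.β ZT t.α t.β ≤ 10 * condNumber Z ^ 2 * (13000 * Λ ^ 2 +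
      2 * ((1 - η * γ) ^ T * (2 * (1 + 5 * K ^ 2) * frob s.G ^ 2 + 52000 * Λ ^ 2)) +
      frob (s.G - Z * Zᵀ) ^ 2) := by
  obtain ⟨q, hq, hmin⟩ := exists_minimizer A X lam γ hG hrα hrβ
  obtain ⟨V, d, hb⟩ := hZ.exists_basis hs.G_mem.1
  have htf : IsFeasible X rG rα rβ t := ht ▸ iterate_feasible hG hrα hrβ T
  have h1 := error_le_of_objective_le hk hA hX hs hq (hmin s hs) (hs.abs_theta_le hM)
    (hq.abs_theta_le hM) hb hw0 hW hWX hw hlam hγ hK hreg hα hβ (opNorm_nonneg X)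
    (bilinBound_opNorm X) hXr (hΛ ▸ hb.tail_le.trans htail)
  rw [← hΛ] at h1
  have h2 := iterate_contraction (lam := lam) hA hX hG hrα hrβ hη hηγ hq hmin T
  rw [← ht] at h2
  have h3 := opNorm_sq_mul_orthDist_sq_le hk htf.G_mem.1 hs.G_mem.1 hZT hZ hsv
  have norm_eq : ∀ u : State n, stateInner X u u =
      frob u.G ^ 2 + 4 * frob (rowConst u.α) ^ 2 + frob (u.β • X) ^ 2 := by
    intro u
    rw [stateInner_self, frob_rowConst_sq, frob_smul, mul_pow, sq_abs]; ring
  have tri : ∀ {x y z : ℝ}, 0 ≤ x → x ≤ y + z → x ^ 2 ≤ 2 * y ^ 2 + 2 * z ^ 2 := by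
    intro x y z hx hxyz
    have := pow_le_pow_left₀ hx hxyz 2
    nlinarith [sq_nonneg (y - z)]
  have rc_sub : ∀ a b : Fin n → ℝ, rowConst (a - b) = rowConst a - rowConst b := by
    intro a b; ext i j; simp [rowConst]
  -- The iteration starts at zero, so the initial distance to `q` is the norm of `q`. The constants
  -- are `1 + 4K² + K² = 1 + 5K²` and `8 · 6500 = 52000`.
  have nq : stateInner X q q ≤ 2 * (1 + 5 * K ^ 2) * frob s.G ^ 2 + 52000 * Λ ^ 2 := by
    rw [norm_eq]
    have g1 : frob q.G ^ 2 ≤ 2 * frob (q.G - s.G) ^ 2 + 2 * frob s.G ^ 2 :=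
      tri (frob_nonneg _) (by have := frob_add_le (q.G - s.G) s.G; rwa [sub_add_cancel] at this)
    have g2 : frob (rowConst q.α) ^ 2 ≤
        2 * frob (rowConst (q.α - s.α)) ^ 2 + 2 * frob (rowConst s.α) ^ 2 :=
      tri (frob_nonneg _) (by
        have := frob_add_le (rowConst (q.α - s.α)) (rowConst s.α)
        rwa [rc_sub, sub_add_cancel] at this)
    have g3 : frob (q.β • X) ^ 2 ≤ 2 * frob ((q.β - s.β) • X) ^ 2 + 2 * frob (s.β • X) ^ 2 :=
      tri (frob_nonneg _) (by
        have := frob_add_le ((q.β - s.β) • X) (s.β • X)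
        rwa [← add_smul, sub_add_cancel] at this)
    have g4 := pow_le_pow_left₀ (frob_nonneg _) hα 2
    have g5 := pow_le_pow_left₀ (frob_nonneg _) hβ 2
    have g6 := sq_nonneg (frob (q.G - s.G))
    have g7 := sq_nonneg (frob ((q.β - s.β) • X))
    have g8 := sq_nonneg (frob s.G)
    rw [mul_pow] at g4 g5
    linarith
  have hρ : 0 ≤ (1 - η * γ) ^ T := pow_nonneg (by nlinarith) T
  have h4 := h2.trans (mul_le_mul_of_nonneg_left nq hρ)
  rw [norm_eq, State.sub_G, State.sub_α, State.sub_β] at h4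
  have f1 : frob (t.G - s.G) ^ 2 ≤ 2 * frob (t.G - q.G) ^ 2 + 2 * frob (q.G - s.G) ^ 2 :=
    tri (frob_nonneg _) (frob_sub_le _ _ _)
  have f2 : frob (rowConst (t.α - s.α)) ^ 2 ≤
      2 * frob (rowConst (t.α - q.α)) ^ 2 + 2 * frob (rowConst (q.α - s.α)) ^ 2 :=
    tri (frob_nonneg _) (by
      have := frob_add_le (rowConst (t.α - q.α)) (rowConst (q.α - s.α))
      rwa [rc_sub t.α, rc_sub q.α s.α, sub_add_sub_cancel, ← rc_sub, ← rc_sub, ← rc_sub] at this)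
  have f3 : frob ((t.β - s.β) • X) ^ 2 ≤
      2 * frob ((t.β - q.β) • X) ^ 2 + 2 * frob ((q.β - s.β) • X) ^ 2 :=
    tri (frob_nonneg _) (by
      have := frob_add_le ((t.β - q.β) • X) ((q.β - s.β) • X)
      rwa [← add_smul, sub_add_sub_cancel] at this)
  have f4 : (frob (t.G - s.G) + frob (s.G - Z * Zᵀ)) ^ 2 ≤
      2 * frob (t.G - s.G) ^ 2 + 2 * frob (s.G - Z * Zᵀ) ^ 2 :=
    tri (add_nonneg (frob_nonneg _) (frob_nonneg _)) le_rfl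
  have : Nonempty (Fin k) := ⟨⟨0, hk⟩⟩
  have hκ : 1 ≤ condNumber Z ^ 2 := one_le_pow₀ (one_le_condNumber hsv)
  have f5 : initError X Z s.α s.β ZT t.α t.β ≤ 10 * condNumber Z ^ 2 *
      (frob (t.G - s.G) ^ 2 + frob (rowConst (t.α - s.α)) ^ 2 + frob ((t.β - s.β) • X) ^ 2 +
        frob (s.G - Z * Zᵀ) ^ 2) := by
    unfold initError
    have g1 := mul_le_mul_of_nonneg_left f4 (show 0 ≤ 5 * condNumber Z ^ 2 by positivity)
    have g2 := mul_le_mul_of_nonneg_right hκ (sq_nonneg (frob (rowConst (t.α - s.α))))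
    have g3 := mul_le_mul_of_nonneg_right hκ (sq_nonneg (frob ((t.β - s.β) • X)))
    have g4 := sq_nonneg (frob (rowConst (t.α - s.α)))
    have g5 := sq_nonneg (frob ((t.β - s.β) • X))
    linarith
  refine f5.trans (mul_le_mul_of_nonneg_left ?_ (by positivity))
  have g4 := sq_nonneg (frob (rowConst (t.α - q.α)))
  linarith

end Truth

/-! ### Number of steps -/

section Constants

/-- Exponentiating `numSteps ≤ T`; a negative threshold is allowed. -/
theorem pow_le_of_numSteps_le {C₁ c₁ M₁ κ γ η : ℝ} {k T : ℕ} (hC : 0 < C₁) (hc : 0 < c₁)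
    (hk : 1 ≤ k) (hκ : 1 ≤ κ) (h0 : 0 < γ * η) (h1 : γ * η < 1)
    (hT : numSteps C₁ c₁ M₁ k κ γ η ≤ T) :
    (1 - η * γ) ^ T ≤ c₁ ^ 2 / (C₁ * Real.exp (2 * M₁) * k * κ ^ 6) := by
  have hk' : (0 : ℝ) < k := by exact_mod_cast hk
  have hκ' : 0 < κ := by linarith
  have hlog : 0 < Real.log (1 / (1 - γ * η)) :=
    Real.log_pos (by rw [lt_div_iff₀ (by linarith)]; linarith)
  rw [numSteps, div_le_iff₀ hlog, ← Real.log_pow] at hT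
  have hpos : 0 < (1 / (1 - γ * η)) ^ T := by
    have : 0 < 1 - γ * η := by linarith
    positivity
  have h2 := (Real.log_le_log_iff (by positivity) hpos).1 hT
  rw [one_div, inv_pow] at h2
  have h3 : 0 < (1 - γ * η) ^ T := pow_pos (by linarith) T
  have h4 := inv_anti₀ (by positivity) h2
  rw [inv_inv, inv_div] at h4
  rwa [mul_comm η γ]

end Constants

/-! ### Calibration of the constants -/

section Combination

variable {n k : ℕ} {M₁ M₂ rG rα rβ η C₀ c₀ c₁ C K : ℝ} {A X G : Matrix (Fin n) (Fin n) ℝ}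
  {α : Fin n → ℝ} {β : ℝ} {Z : Matrix (Fin n) (Fin k) ℝ}

theorem mul_le_sq_of_scale {E κ L m : ℝ} (hE : 0 < E) (hκ : 0 < κ)
    (h : C * κ ^ 6 * E ^ 2 * m ≤ L ^ 2) : C * m ≤ (L / (E * κ ^ 3)) ^ 2 := by
  rw [div_pow, le_div_iff₀ (by positivity)]
  calc C * m * (E * κ ^ 3) ^ 2 = C * κ ^ 6 * E ^ 2 * m := by ring
    _ ≤ L ^ 2 := h

theorem mul_le_sq_mul_sq {a m x F : ℝ} (hm : 0 ≤ m) (h1 : C * m ≤ F ^ 2) (h2 : a ≤ C * x ^ 2) :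
    a * m ≤ x ^ 2 * F ^ 2 := by
  have h3 := mul_le_mul_of_nonneg_left h1 (sq_nonneg x)
  have h4 := mul_le_mul_of_nonneg_right h2 hm
  linarith

/-- The error bound at the scale `F = ‖G‖ / (e^{M₁} κ³)`. -/
theorem error_le_of_scale {κ E L F x ρ g b z kr : ℝ} (hc₁ : 0 < c₁)
    (hκ : 1 ≤ κ) (hE : 1 ≤ E) (hk : 1 ≤ kr) (hL : 0 ≤ L)
    (hF : F = L / (E * κ ^ 3)) (hx0 : 0 ≤ x) (hx1 : x ≤ c₁ / 1000) (hx2 : x ≤ 1 / 100)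
    (hC1 : 1 ≤ C) (hC : 30 / c₁ ^ 2 ≤ C)
    (hρ0 : 0 ≤ ρ) (hρ : ρ ≤ c₁ ^ 2 / (60 * (10 + 20 * K ^ 2) * E ^ 2 * kr * κ ^ 6))
    (hb : C * b ^ 2 ≤ F ^ 2) (hg : g ^ 2 ≤ kr * L ^ 2 + b ^ 2) (hz : L ^ 2 ≤ z ^ 4) :
    10 * κ ^ 2 * (13000 * (x * F) ^ 2 +
      2 * (ρ * (2 * (1 + 5 * K ^ 2) * g ^ 2 + 52000 * (x * F) ^ 2)) + b ^ 2) ≤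
      c₁ ^ 2 * (E ^ 2)⁻¹ * z ^ 4 / κ ^ 4 := by
  have hκ0 : 0 < κ := by linarith
  have hE0 : 0 < E := by linarith
  have hk0 : 0 < kr := by linarith
  have hF0 : 0 ≤ F := by rw [hF]; positivity
  have hFL : F ^ 2 ≤ L ^ 2 := by
    refine pow_le_pow_left₀ hF0 ?_ 2
    rw [hF]
    exact div_le_self hL (one_le_mul_of_one_le_of_one_le hE (one_le_pow₀ hκ))
  have hx3 : x ^ 2 ≤ c₁ ^ 2 / 1000000 := by
    have := pow_le_pow_left₀ hx0 hx1 2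
    linarith [div_pow c₁ 1000 2, show (c₁ / 1000) ^ 2 = c₁ ^ 2 / 1000000 by ring]
  have hx4 : x ^ 2 ≤ 1 / 10000 := by
    have := pow_le_pow_left₀ hx0 hx2 2
    linarith [show ((1 : ℝ) / 100) ^ 2 = 1 / 10000 by norm_num]
  have t1 : (x * F) ^ 2 ≤ c₁ ^ 2 / 1000000 * F ^ 2 := by
    rw [mul_pow]; exact mul_le_mul_of_nonneg_right hx3 (sq_nonneg _)
  have hLk : L ^ 2 ≤ kr * L ^ 2 := le_mul_of_one_le_left (sq_nonneg _) hk
  have t2 : 52000 * (x * F) ^ 2 ≤ 6 * (kr * L ^ 2) := by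
    rw [mul_pow]
    have := mul_le_mul_of_nonneg_right hx4 (sq_nonneg F)
    linarith [sq_nonneg F, sq_nonneg L]
  have t3 : b ^ 2 ≤ F ^ 2 := le_trans (le_mul_of_one_le_left (sq_nonneg b) hC1) hb
  have t4 : g ^ 2 ≤ 2 * (kr * L ^ 2) := by linarith
  have t5 : 2 * (1 + 5 * K ^ 2) * g ^ 2 + 52000 * (x * F) ^ 2 ≤ (10 + 20 * K ^ 2) * (kr * L ^ 2) := by
    have := mul_le_mul_of_nonneg_left t4 (show 0 ≤ 2 * (1 + 5 * K ^ 2) by positivity)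
    linarith
  have t6 : ρ * (2 * (1 + 5 * K ^ 2) * g ^ 2 + 52000 * (x * F) ^ 2) ≤ c₁ ^ 2 / 60 * F ^ 2 := by
    calc _ ≤ ρ * ((10 + 20 * K ^ 2) * (kr * L ^ 2)) := mul_le_mul_of_nonneg_left t5 hρ0
      _ ≤ c₁ ^ 2 / (60 * (10 + 20 * K ^ 2) * E ^ 2 * kr * κ ^ 6) *
          ((10 + 20 * K ^ 2) * (kr * L ^ 2)) := mul_le_mul_of_nonneg_right hρ (by positivity)
      _ = c₁ ^ 2 / 60 * F ^ 2 := by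
        rw [hF]
        have : (10 + 20 * K ^ 2) ≠ 0 := by positivity
        field_simp
  have t7 : b ^ 2 ≤ c₁ ^ 2 / 30 * F ^ 2 := by
    have h1 : 30 / c₁ ^ 2 * b ^ 2 ≤ F ^ 2 :=
      le_trans (mul_le_mul_of_nonneg_right hC (sq_nonneg _)) hb
    have h2 := mul_le_mul_of_nonneg_left h1 (show 0 ≤ c₁ ^ 2 / 30 by positivity)
    have h3 : c₁ ^ 2 / 30 * (30 / c₁ ^ 2 * b ^ 2) = b ^ 2 := by field_simp
    rwa [h3] at h2
  -- Minimizer error, optimization error and truncation error have coefficients `13/1000`, `1/30`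
  -- and `1/30`, whose sum is below `1/10`.
  calc _ ≤ 10 * κ ^ 2 * (c₁ ^ 2 / 10 * F ^ 2) := by
        refine mul_le_mul_of_nonneg_left ?_ (by positivity)
        have : 0 ≤ c₁ ^ 2 * F ^ 2 := by positivity
        linarith
    _ = c₁ ^ 2 * (E ^ 2)⁻¹ * L ^ 2 / κ ^ 4 := by rw [hF]; field_simp
    _ ≤ _ := by gcongr

/-- The error bound for the output of the algorithm on the event that the noise is small. -/
theorem initError_le_of_noise_le (hK : 0 < K) (hC₀ : 6 * K + 6 ≤ C₀) (hc₁ : 0 < c₁) (hc₀ : 0 < c₀)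
    (hc₀1 : c₀ ≤ 1) (hx1 : C₀ * c₀ ≤ c₁ / 1000) (hx2 : C₀ * c₀ ≤ 1 / 100)
    (hCx : 16 * 12002 ^ 2 + 1 ≤ C * (C₀ * c₀) ^ 2) (hCc : 30 / c₁ ^ 2 ≤ C) (hC1 : 1 ≤ C)
    (hk : 1 ≤ k) (hG : 0 ≤ rG) (hrα : 0 ≤ rα) (hrβ : 0 ≤ rβ)
    (hM : rG + 2 * rα + rβ ≤ M₁) (hη : 0 < η) (hη' : η ≤ 2 / 9) (hX : IsCovariate X)
    (hXr : X ≠ 0 → 66 ^ 2 * k ≤ stableRank X) (hP : InParamSpace M₂ rG rα rβ X G α β)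
    (hZ : IsTopFactor G Z) (hsv : ∀ j, 0 < singVal Z j)
    (hα : frob (rowConst α) ≤ K * frob G) (hβ : frob (β • X) ≤ K * frob G)
    (hL0 : 0 < opNorm G)
    (hL : C * condNumber Z ^ 6 * Real.exp (2 * M₁) *
          max (psiSq n k M₁ M₂)
            (max (nuclearNorm (G - Z * Z.transpose) ^ 2 / k) (frob (G - Z * Z.transpose) ^ 2))
        ≤ opNorm G ^ 2)
    (hA : A.IsSymm) {w : ℝ} (hw : w = 12002 * √(max (Real.exp (-M₂)) (Real.log n / n) * n))
    (hW : BilinBound (A - sigm (theta X G α β)) w)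
    (hWX : |trInner (A - sigm (theta X G α β)) X| ≤ w * frob X) {T : ℕ}
    (hT : numSteps (60 * (10 + 20 * K ^ 2)) c₁ M₁ k (condNumber Z)
      (gammaChoice c₀ M₁ k (condNumber Z)) η ≤ T) {t : State n}
    (ht : t = iterate A X rG rα rβ η (C₀ * gammaChoice c₀ M₁ k (condNumber Z) * opNorm G)
      (gammaChoice c₀ M₁ k (condNumber Z)) T) {ZT : Matrix (Fin n) (Fin k) ℝ}
    (hZT : IsTopFactor t.G ZT) :
    initError X Z α β ZT t.α t.β ≤
      c₁ ^ 2 * Real.exp (-2 * M₁) * opNorm Z ^ 4 / condNumber Z ^ 4 := by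
  have : Nonempty (Fin k) := ⟨⟨0, hk⟩⟩
  have hκ : 1 ≤ condNumber Z := one_le_condNumber hsv
  set κ := condNumber Z
  set L := opNorm G
  set γ := gammaChoice c₀ M₁ k κ with hγdef
  set E := Real.exp M₁ with hEdef
  have hM0 : 0 ≤ M₁ := by linarith
  have hE : 1 ≤ E := Real.one_le_exp hM0
  have hE2 : Real.exp (2 * M₁) = E ^ 2 := by rw [hEdef, ← Real.exp_nat_mul]; norm_num
  have hEm : Real.exp (-M₁) = E⁻¹ := Real.exp_neg _
  have hEm2 : Real.exp (-2 * M₁) = (E ^ 2)⁻¹ := by rw [neg_mul, Real.exp_neg, hE2]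
  have hk0 : (1 : ℝ) ≤ k := by exact_mod_cast hk
  have hsk : 1 ≤ √(k : ℝ) := Real.one_le_sqrt.2 hk0
  have hsk2 : √(k : ℝ) ^ 2 = k := Real.sq_sqrt (by linarith)
  have hE0 : 0 < E := by linarith
  have hκ0 : 0 < κ := by linarith
  have hsk0 : 0 < √(k : ℝ) := by linarith
  have hC₀0 : 0 < C₀ := by linarith
  set x := C₀ * c₀ with hx
  have hx0 : 0 < x := mul_pos hC₀0 hc₀
  set F := L / (E * κ ^ 3) with hF
  have hF0 : 0 < F := by positivity
  have hγe : γ = c₀ / (E ^ 2 * √k * κ ^ 3) := by rw [hγdef, gammaChoice, hE2]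
  have hγ0 : 0 < γ := by rw [hγe]; positivity
  have hγ1 : γ ≤ 1 := by
    rw [hγe]
    refine (div_le_self hc₀.le ?_).trans hc₀1
    exact one_le_mul_of_one_le_of_one_le
      (one_le_mul_of_one_le_of_one_le (one_le_pow₀ hE) hsk) (one_le_pow₀ hκ)
  -- The choice of `γ` cancels `√k` and one factor `e^{M₁}`, so `Λ` equals `C₀ c₀` times the scale
  -- `F`.
  have hΛ : x * F = C₀ * γ * L * √k / Real.exp (-M₁) := by
    rw [hEm, hγe, hF, hx]; field_simp
  rw [hE2] at hL
  have hL' := mul_le_sq_of_scale hE0 hκ0 hL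
  rw [← hF] at hL'
  have hC0 : 0 < C := by linarith
  have b1 : C * psiSq n k M₁ M₂ ≤ F ^ 2 :=
    (mul_le_mul_of_nonneg_left (le_max_left _ _) hC0.le).trans hL'
  have b2 : C * (nuclearNorm (G - Z * Zᵀ) ^ 2 / k) ≤ F ^ 2 :=
    (mul_le_mul_of_nonneg_left ((le_max_left _ _).trans (le_max_right _ _)) hC0.le).trans hL'
  have b3 : C * frob (G - Z * Zᵀ) ^ 2 ≤ F ^ 2 :=
    (mul_le_mul_of_nonneg_left ((le_max_right _ _).trans (le_max_right _ _)) hC0.le).trans hL'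
  obtain ⟨V, d, hb⟩ := hZ.exists_basis hP.psd
  have hg : frob G ^ 2 ≤ k * L ^ 2 + frob (G - Z * Zᵀ) ^ 2 := hb.frob_sq_le
  have hFL : F ^ 2 ≤ L ^ 2 := by
    refine pow_le_pow_left₀ hF0.le ?_ 2
    exact div_le_self hL0.le (one_le_mul_of_one_le_of_one_le hE (one_le_pow₀ hκ))
  have hCx1 : 1 ≤ C * x ^ 2 := by linarith
  have htail : nuclearNorm (G - Z * Zᵀ) ≤ √k * (x * F) := by
    refine abs_le_of_sq_le_sq' ?_ (by positivity) |>.2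
    rw [mul_pow, mul_pow, hsk2]
    have h1 : nuclearNorm (G - Z * Zᵀ) ^ 2 / k ≤ x ^ 2 * F ^ 2 := by
      have h2 := mul_le_sq_mul_sq (by positivity) b2 hCx1
      rwa [one_mul] at h2
    rw [div_le_iff₀ (by linarith)] at h1
    linarith
  -- Here `lam = x F / (e^{M₁} √k)`. The loss of `e^{M₁} √k` against `F` is matched by the factor
  -- `e^{2M₁} k` in `psiSq`.
  have hwl : 4 * w ≤ C₀ * γ * L := by
    have e : C₀ * γ * L = x * F / (E * √k) := by
      rw [hγe, hF, hx]; field_simp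
    refine abs_le_of_sq_le_sq' ?_ (by positivity) |>.2
    rw [e, div_pow, le_div_iff₀ (by positivity), hw]
    have hq : 0 ≤ max (Real.exp (-M₂)) (Real.log n / n) * n :=
      mul_nonneg ((Real.exp_pos _).le.trans (le_max_left _ _)) (Nat.cast_nonneg n)
    have e2 : psiSq n k M₁ M₂ = E ^ 2 * k * (max (Real.exp (-M₂)) (Real.log n / n) * n) := by
      rw [psiSq, hE2]; ring
    rw [e2] at b1
    rw [mul_pow, mul_pow, Real.sq_sqrt hq, mul_pow, mul_pow, hsk2]
    set m := E ^ 2 * k * (max (Real.exp (-M₂)) (Real.log n / n) * n) with hm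
    have hm0 : 0 ≤ m := by positivity
    have h2 := mul_le_sq_mul_sq hm0 b1 hCx
    have e3 : (4 : ℝ) ^ 2 * (12002 ^ 2 * (max (Real.exp (-M₂)) (Real.log n / n) * n)) * (E ^ 2 * k) =
      16 * 12002 ^ 2 * m := by rw [hm]; ring
    rw [e3]
    refine le_trans (mul_le_mul_of_nonneg_right ?_ hm0) h2
    norm_num
  -- Uses `‖G‖_F ≤ 3/2 √k ‖G‖_op`; then `3/2 (1 + 4K) ≤ 6K + 6 ≤ C₀` explains the minimal `C₀`.
  have hreg : γ * frob G * (1 + 4 * K) ≤ C₀ * γ * L * √k := by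
    have h1 : frob G ≤ 3 / 2 * (√k * L) := by
      refine abs_le_of_sq_le_sq' ?_ (by positivity) |>.2
      rw [mul_pow, mul_pow, hsk2]
      have h2 : frob (G - Z * Zᵀ) ^ 2 ≤ F ^ 2 :=
        le_trans (le_mul_of_one_le_left (sq_nonneg _) hC1) b3
      have h3 : L ^ 2 ≤ k * L ^ 2 := le_mul_of_one_le_left (sq_nonneg _) hk0
      have h4 := sq_nonneg L
      linarith
    have h2 : frob G * (1 + 4 * K) ≤ 3 / 2 * (√k * L) * (1 + 4 * K) :=
      mul_le_mul_of_nonneg_right h1 (by linarith)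
    have h3 : √k * L * (3 / 2 * (1 + 4 * K)) ≤ √k * L * C₀ :=
      mul_le_mul_of_nonneg_left (by linarith) (by positivity)
    calc γ * frob G * (1 + 4 * K) = γ * (frob G * (1 + 4 * K)) := by ring
      _ ≤ γ * (√k * L * C₀) := mul_le_mul_of_nonneg_left (by linarith) hγ0.le
      _ = _ := by ring
  obtain ⟨β', hβ', hs⟩ := hP.exists_feasible hX hrβ
  have hθ : theta X G α β' = theta X G α β := by simp only [theta, hβ']
  have hηγ : η * (3 / 4 + γ) ≤ 1 :=
    (mul_le_mul hη' (show 3 / 4 + γ ≤ 7 / 4 by linarith) (by positivity) (by norm_num)).trans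
      (by norm_num)
  have hw0 : 0 ≤ w := by rw [hw]; positivity
  have main := initError_iterate_le (s := ⟨G, α, β'⟩) hk hA hX.symm hG hrα hrβ hM hs hZ hsv hw0
    (by rw [hθ]; exact hW) (by rw [hθ]; exact hWX) hwl (by positivity) hγ0.le hη hηγ hK.le
    hreg hα (by rw [hβ']; exact hβ) (mul_opNorm_le_frob (by norm_num) hk hXr) hΛ htail T ht hZT
  have e1 : initError X Z α β ZT t.α t.β = initError X Z α β' ZT t.α t.β := by
    simp only [initError, sub_smul, hβ']
  rw [e1, hEm2]
  refine main.trans ?_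
  have hγη : γ * η < 1 :=
    (mul_le_mul hγ1 hη' hη.le zero_le_one).trans_lt (by norm_num)
  have hρ := pow_le_of_numSteps_le (by positivity) hc₁ hk hκ (mul_pos hγ0 hη) hγη hT
  rw [hE2] at hρ
  refine error_le_of_scale hc₁ hκ hE hk0 hL0.le hF hx0.le hx1 hx2 hC1 hCc
    (pow_nonneg (by rw [mul_comm]; exact sub_nonneg.2 hγη.le) T) hρ b3 hg ?_
  have := pow_le_pow_left₀ hL0.le (hb.opNorm_le hk) 2
  rwa [← pow_mul] at this

theorem opNorm_pos_of_le (hC : 0 < C) (hk : 1 ≤ k) (hn : 0 < n) (hκ : 1 ≤ condNumber Z) {m : ℝ}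
    (hL : C * condNumber Z ^ 6 * Real.exp (2 * M₁) * max (psiSq n k M₁ M₂) m ≤ opNorm G ^ 2) :
    0 < opNorm G := by
  have hk' : (0 : ℝ) < k := by exact_mod_cast hk
  have hn' : (0 : ℝ) < n := by exact_mod_cast hn
  have h1 : 0 < psiSq n k M₁ M₂ := by
    have : 0 < max (Real.exp (-M₂)) (Real.log n / n) := lt_max_of_lt_left (Real.exp_pos _)
    unfold psiSq
    positivity
  have h2 : 0 < max (psiSq n k M₁ M₂) m := lt_max_of_lt_left h1
  have h3 : 0 < opNorm G ^ 2 := lt_of_lt_of_le (by positivity) hL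
  refine lt_of_le_of_ne (opNorm_nonneg G) fun h => ?_
  rw [← h] at h3
  simp at h3

/-- For `n = 1` the centering matrix is zero, which forces `G = 0`. -/
theorem two_le_of_opNorm_pos {n : ℕ} {G : Matrix (Fin n) (Fin n) ℝ} (hc : centering n * G = G)
    (h : 0 < opNorm G) : 2 ≤ n := by
  by_contra! hn
  have h0 : G = 0 := by
    have : n = 0 ∨ n = 1 := by omega
    rcases this with rfl | rfl
    · exact Subsingleton.elim _ _
    · rw [← hc]
      have : centering 1 = 0 := by ext i j; simp [centering, Subsingleton.elim i j]
      rw [this, Matrix.zero_mul]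
  have : opNorm G ≤ 0 := opNorm_le_of G le_rfl fun x => by rw [h0]; simp
  linarith

end Combination

end LatentSpace

/-! ### The main theorem -/

theorem corollary4p1 :
    ∃ M₀ : ℝ, 0 < M₀ ∧ ∃ c : ℝ, 0 < c ∧
    ∀ K : ℝ, 0 < K →
    ∃ C₁ : ℝ, 0 < C₁ ∧ ∃ Cmin : ℝ, 0 < Cmin ∧
    ∀ C₀ : ℝ, Cmin ≤ C₀ → ∀ c₁ : ℝ, 0 < c₁ →
    ∃ cmax : ℝ, 0 < cmax ∧ ∀ c₀ : ℝ, 0 < c₀ → c₀ ≤ cmax →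
    ∃ C : ℝ, 0 < C ∧
    ∀ (n k : ℕ) (M₁ M₂ rG rα rβ η : ℝ) (X G : Matrix (Fin n) (Fin n) ℝ) (α : Fin n → ℝ) (β : ℝ)
      (Z : Matrix (Fin n) (Fin k) ℝ)
      (Ω : Type*) (_ : MeasurableSpace Ω) (μ : Measure Ω) (A : Ω → Matrix (Fin n) (Fin n) ℝ),
      1 ≤ k → 0 ≤ M₂ → 0 ≤ rG → 0 ≤ rα → 0 ≤ rβ → rG + 2 * rα + rβ ≤ M₁ →
      0 < η → η ≤ 2 / 9 →
      IsCovariate X → (X ≠ 0 → M₀ * k ≤ stableRank X) →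
      InParamSpace M₂ rG rα rβ X G α β →
      IsTopFactor G Z → (∀ j, 0 < singVal Z j) →
      frob (rowConst α) ≤ K * frob G → frob (β • X) ≤ K * frob G →
      C * condNumber Z ^ 6 * Real.exp (2 * M₁) *
          max (psiSq n k M₁ M₂)
            (max (nuclearNorm (G - Z * Z.transpose) ^ 2 / k) (frob (G - Z * Z.transpose) ^ 2))
        ≤ opNorm G ^ 2 →
      IsProbabilityMeasure μ → IsNetwork μ (theta X G α β) A →
      1 - (n : ℝ) ^ (-c) ≤ μ.real {ω |
        ∀ T : ℕ, numSteps C₁ c₁ M₁ k (condNumber Z) (gammaChoice c₀ M₁ k (condNumber Z)) η ≤ T →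
        ∀ s : State n,
          s = iterate (A ω) X rG rα rβ η
            (C₀ * gammaChoice c₀ M₁ k (condNumber Z) * opNorm G)
            (gammaChoice c₀ M₁ k (condNumber Z)) T →
        ∀ ZT : Matrix (Fin n) (Fin k) ℝ, IsTopFactor s.G ZT →
          initError X Z α β ZT s.α s.β ≤
            c₁ ^ 2 * Real.exp (-2 * M₁) * opNorm Z ^ 4 / condNumber Z ^ 4} := by
  refine ⟨66 ^ 2, by norm_num, 1, one_pos, fun K hK => ⟨60 * (10 + 20 * K ^ 2), by positivity,
    6 * K + 6, by positivity, fun C₀ hC₀ c₁ hc₁ => ?_⟩⟩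
  have hC₀0 : 0 < C₀ := by linarith
  -- The bound on `c₀` makes `C₀ c₀`, the ratio of `Λ` to the scale `F`, small against `c₁`.
  refine ⟨min (min (c₁ / 1000 / C₀) (1 / 100 / C₀)) 1, by positivity, fun c₀ hc₀ hcm => ?_⟩
  have hcm1 : C₀ * c₀ ≤ c₁ / 1000 := by
    have := hcm.trans ((min_le_left _ _).trans (min_le_left _ _))
    rwa [le_div_iff₀ hC₀0, mul_comm] at this
  have hcm2 : C₀ * c₀ ≤ 1 / 100 := by
    have := hcm.trans ((min_le_left _ _).trans (min_le_right _ _))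
    rwa [le_div_iff₀ hC₀0, mul_comm] at this
  have hcm3 : c₀ ≤ 1 := hcm.trans (min_le_right _ _)
  have hx : 0 < C₀ * c₀ := mul_pos hC₀0 hc₀
  have hp1 : 0 < (16 * 12002 ^ 2 + 1) / (C₀ * c₀) ^ 2 := by positivity
  have hp2 : 0 < 30 / c₁ ^ 2 := by positivity
  -- The three summands make `lam` dominate the noise, the truncation error small against `c₁`, and
  -- `C ≥ 1`.
  obtain ⟨C, hC⟩ : ∃ C, C = (16 * 12002 ^ 2 + 1) / (C₀ * c₀) ^ 2 + 30 / c₁ ^ 2 + 1 := ⟨_, rfl⟩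
  have hCx : 16 * 12002 ^ 2 + 1 ≤ C * (C₀ * c₀) ^ 2 := by
    rw [← div_le_iff₀ (by positivity)]; linarith
  refine ⟨C, by linarith, ?_⟩
  intro n k M₁ M₂ rG rα rβ η X G α β Z Ω _ μ A hk _ hrG hrα hrβ hM hη hη' hX hXr hP hZ hsv hα hβ hL
    hμ hN
  have : Nonempty (Fin k) := ⟨⟨0, hk⟩⟩
  have hkn : k ≤ n := hZ.1
  have hL0 := opNorm_pos_of_le (by linarith) hk (by omega) (one_le_condNumber hsv) hL
  have hn := two_le_of_opNorm_pos hP.centered hL0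
  have hn0 : (0 : ℝ) < n := by exact_mod_cast (by omega : 0 < n)
  have hGs : G.IsSymm := by
    have := hP.psd.1
    rwa [Matrix.IsHermitian, Matrix.conjTranspose_eq_transpose_of_trivial] at this
  have hΘ := theta_isSymm hX.symm hGs α β
  have hq : ∀ i j, i ≠ j → Real.sigmoid (theta X G α β i j) ≤
      max (Real.exp (-M₂)) (Real.log n / n) := fun i j hij =>
    ((sigmoid_le_exp _).trans (Real.exp_le_exp.2 (hP.sparse i j hij))).trans (le_max_left _ _)
  have hlog : Real.log n ≤ max (Real.exp (-M₂)) (Real.log n / n) * n := by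
    rw [← div_le_iff₀ hn0]; exact le_max_right _ _
  have hbad := prob_noise hN hn hΘ hX hq hlog
  rw [Real.rpow_neg_one]
  -- Subadditivity alone is used, so the good event, defined through all `T` and all top factors,
  -- need not be measurable.
  have key : ∀ S B : Set Ω, μ.real B ≤ (n : ℝ)⁻¹ → Bᶜ ⊆ S → 1 - (n : ℝ)⁻¹ ≤ μ.real S := by
    intro S B hB hS
    have h1 : μ.real (S ∪ B) = 1 := by
      have : S ∪ B = Set.univ := by
        rw [Set.eq_univ_iff_forall]
        intro ω
        by_cases h : ω ∈ B
        · exact Or.inr h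
        · exact Or.inl (hS h)
      rw [this]; simp
    have h2 := measureReal_union_le (μ := μ) S B
    linarith
  refine key _ _ hbad fun ω hω => ?_
  rw [Set.mem_compl_iff, Set.mem_ofPred_eq, not_not] at hω
  obtain ⟨hω1, hω2⟩ := hω
  rw [Set.mem_ofPred_eq]
  intro T hT s hs ZT hZT
  exact initError_le_of_noise_le hK hC₀ hc₁ hc₀ hcm3 hcm1 hcm2 hCx (by linarith) (by linarith) hk hrG
    hrα hrβ hM hη hη' hX hXr hP hZ hsv hα hβ hL0 hL (hN.symm ω) rfl
    (abs_bilin_le_of_quad (sub_sigm_isSymm (hN.symm ω) hΘ) hω1) hω2 hT hs hZT
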